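/- Let $d\ge 1$ and let $\mathcal P$ be a simple, stationary (translation invariant in law), locally finite point process on $\mathbb R^d$ with correlation functions $\rho^{(p)}:(\mathbb R^d)^p\to[0,\infty)$ (Lebesgue densities of the factorial moment measures), and let $\mathbb E_{x}$, $x=(x_1,\dots,x_p)$, denote expectation under its (non-reduced) Palm distributions, so that $$\mathbb E\sum_{x\in\mathcal P^{p},\ x_i\ne x_j} g(x,\mathcal P)=\int \mathbb E_x[g(x,\mathcal P)]\,\rho^{(p)}(x)\,dx\qquad(g\ge 0\text{ measurable}).$$ Put $W_n=[-\tfrac12 n^{1/d},\tfrac12 n^{1/d}]^d$, $\mathcal P_n=\mathcal P\cap W_n$, and let $B_r(x)$ be the closed ball. Let $\xi(x,\mathcal X)\in\mathbb R$ be a measurable score function of a point $x$ and a locally finite set $\mathcal X\ni x$. Its radius of stabilization $R^\xi(x,\mathcal X)\in[0,\infty]$ (assumed measurable) is the infimum of all $r\ge0$ such that $\xi(x,(\mathcal X\cap B_r(x))\cup(\mathcal Y\setminus B_r(x)))=\xi(x,\mathcal X\cap B_r(x))$ for all locally finite $\mathcal Y$. Let $\mu_n^\xi(f)=\sum_{x\in\mathcal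 P_n}\xi(x,\mathcal P_n)f(n^{-1/d}x)$. Let $a\in[0,1)$, $\hat a>0$ and $b,\beta,\gamma_1,\gamma_2\ge0$, and assume that there are a constant $C_0\ge1$ and a function $\Phi:[0,\infty)\to[0,\infty)$ with $\Phi(s)\le C' e^{-c s^{\hat a}}$ for all $s\ge0$ and some $c,C'>0$ such that the following hold (for almost every $x$ in the first three conditions: Lebesgue almost every $x$ in EDC, and almost every $x\in W_n^p$ with respect to $\rho^{(p)}(x)\,dx$ in ST and MG). * EDC$(a,\hat a)$: for all $p$, $x\in(\mathbb R^d)^p$ and $\emptyset\ne I\subsetneq\{1,\dots,p\}$, $\;|\rho^{(p)}(x)-\rho^{(|I|)}(x_I)\rho^{(|I^c|)}(x_{I^c})|\le C_0^p\,p!^{a}\,\Phi(\operatorname{dist}(x_I,x_{I^c}))$, where $\operatorname{dist}(x_I,x_{I^c})=\min_{i\in I,j\notin I}|x_i-x_j|$. * ST$(b)$: $\mathbb E_x[R^\xi(x_i,\mathcal P_n)^N]\le C_0^N N!^b$ for all $p,n,N\ge1$, $x\in W_n^p$ and $i\le p$. * MG$(\beta)$: $\mathbb E_x[|\xi(x_i,\mathcal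 P_n)|^k]\le C_0^k k!^\beta$ for all $n\ge1$, $1\le p\le k$, $x\in W_n^p$ and $i\le p$. * PG$(\gamma_1,\gamma_2)$: $|\xi(x,\mathcal X\cap B_r(x))|\le C_0\max\{1,r\}^{\gamma_1}\,\#(\mathcal X\cap B_r(x))^{\gamma_2}$ for all locally finite $\mathcal X$, $x\in\mathcal X$ and $r>0$. Then there is a constant $C\ge1$ such that for all $k,n\ge1$ and all bounded measurable $f:\mathbb R^d\to\mathbb R$ the $k$-th moment of $\mu_n^\xi(f)$ is finite, and the $k$-th cumulant satisfies $$|\kappa^{(k)}(\mu_n^\xi(f))|\le\begin{cases} n\|f\|_\infty^kC^k\,k!^{\,2+\max\{\gamma_2,\beta\}+\frac{d}{(1-a)\hat a}+\frac{bd^2}{(1-a)\hat a}}&\text{if }\frac{(1-a)\hat a}{d}\le1,\\[4pt] n\|f\|_\infty^kC^k\,k!^{\,2+\max\{\gamma_2,\beta\}+\frac d{\hat a}+a+bd}&\text{if }\frac{(1-a)\hat a}{d}\ge1.\end{cases}$$ Here $\|f\|_\infty=\sup_x|f(x)|$. -/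

import Mathlib

open MeasureTheory ProbabilityTheory
open scoped ENNReal NNReal Nat

/-- A locally finite point configuration in `ℝ^d`: a set with finitely many points in every
bounded region. As configurations are sets, point processes with values in this space are simple. -/
@[ext]
structure Config (d : ℕ) where
  carrier : Set (EuclideanSpace ℝ (Fin d))
  finite_inter : ∀ s : Set (EuclideanSpace ℝ (Fin d)), Bornology.IsBounded s →
    (carrier ∩ s).Finite

namespace Config

variable {d : ℕ}

instance : Membership (EuclideanSpace ℝ (Fin d)) (Config d) := ⟨fun X x => x ∈ X.carrier⟩

/-- The standard σ-algebra on configurations, generated by the counting maps `X ↦ #(X ∩ s)` for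
Borel sets `s`. -/
noncomputable instance : MeasurableSpace (Config d) :=
  ⨆ (s : Set (EuclideanSpace ℝ (Fin d))) (_ : MeasurableSet s),
    MeasurableSpace.comap (fun X : Config d => (X.carrier ∩ s).encard) inferInstance

/-- The restriction `X ∩ s`. -/
def restrict (X : Config d) (s : Set (EuclideanSpace ℝ (Fin d))) : Config d where
  carrier := X.carrier ∩ s
  finite_inter t ht := (X.finite_inter t ht).subset fun _ hx => ⟨hx.1.1, hx.2⟩

/-- The union `X ∪ Y`. -/
def union (X Y : Config d) : Config d where
  carrier := X.carrier ∪ Y.carrier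
  finite_inter t ht := by
    rw [Set.union_inter_distrib_right]
    exact (X.finite_inter t ht).union (Y.finite_inter t ht)

/-- The translate `X + v`. -/
def translate (v : EuclideanSpace ℝ (Fin d)) (X : Config d) : Config d where
  carrier := (fun x => x + v) '' X.carrier
  finite_inter t ht := by
    have hb : Bornology.IsBounded ((fun x => x - v) '' t) := by
      obtain ⟨r, hr⟩ := ht.exists_norm_le
      refine isBounded_iff_forall_norm_le.2 ⟨r + ‖v‖, ?_⟩
      rintro _ ⟨x, hx, rfl⟩
      exact (norm_sub_le x v).trans (add_le_add (hr x hx) le_rfl)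
    refine ((X.finite_inter _ hb).image (fun x => x + v)).subset ?_
    rintro _ ⟨⟨x, hx, rfl⟩, hxt⟩
    exact ⟨x, ⟨hx, ⟨x + v, hxt, by simp⟩⟩, rfl⟩

/-- The `p`-tuples of pairwise distinct points of `X`. -/
def distinctTuples (X : Config d) (p : ℕ) : Set (Fin p → EuclideanSpace ℝ (Fin d)) :=
  {x | Function.Injective x ∧ ∀ i, x i ∈ X}

end Config

section PointProcess

variable {d : ℕ}

/-- The cube `W_n = [-n^{1/d}/2, n^{1/d}/2]^d` of volume `n`. -/
def obsWindow (d n : ℕ) : Set (EuclideanSpace ℝ (Fin d)) :=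
  {x | ∀ i, |x i| ≤ (n : ℝ) ^ (1 / (d : ℝ)) / 2}

/-- A point process with distribution `P` is stationary: its law is invariant under translations. -/
def IsStationaryProcess (P : Measure (Config d)) : Prop :=
  ∀ v : EuclideanSpace ℝ (Fin d), P.map (Config.translate v) = P

/-- `ρ p` is (a version of) the `p`-point correlation function of the point process `P`, i.e. the
Lebesgue density of its `p`-th factorial moment measure. -/
structure IsCorrelationFamily (P : Measure (Config d))
    (ρ : (p : ℕ) → (Fin p → EuclideanSpace ℝ (Fin d)) → ℝ) : Prop where
  measurable : ∀ p, Measurable (ρ p)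
  nonneg : ∀ p x, 0 ≤ ρ p x
  campbell : ∀ (p : ℕ) (g : (Fin p → EuclideanSpace ℝ (Fin d)) → ℝ≥0∞), Measurable g →
    ∫⁻ X, ∑' x : X.distinctTuples p, g x ∂P = ∫⁻ x, g x * ENNReal.ofReal (ρ p x)

/-- `Q p x` is (a version of) the Palm distribution of the point process `P` at the points
`x 0, …, x (p - 1)` (these points belong to the configuration, i.e. it is not reduced): the
Markov kernels that disintegrate the Campbell measures (refined Campbell formula). -/
structure IsPalmFamily (P : Measure (Config d))
    (ρ : (p : ℕ) → (Fin p → EuclideanSpace ℝ (Fin d)) → ℝ)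
    (Q : (p : ℕ) → Kernel (Fin p → EuclideanSpace ℝ (Fin d)) (Config d)) : Prop where
  markov : ∀ p, IsMarkovKernel (Q p)
  refined_campbell : ∀ (p : ℕ) (g : (Fin p → EuclideanSpace ℝ (Fin d)) → Config d → ℝ≥0∞),
    Measurable (Function.uncurry g) →
    ∫⁻ X, ∑' x : X.distinctTuples p, g x X ∂P
      = ∫⁻ x, (∫⁻ X, g x X ∂(Q p x)) * ENNReal.ofReal (ρ p x)

/-- The distance `min_{i ∈ I, j ∉ I} |x_i - x_j|` between `x_I` and `x_{I^c}` (for nonempty, proper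
`I`). -/
noncomputable def clusterDist {p : ℕ} (x : Fin p → EuclideanSpace ℝ (Fin d))
    (I : Finset (Fin p)) : ℝ :=
  ⨅ q : {i // i ∈ I} × {j // j ∈ Iᶜ}, dist (x q.1) (x q.2)

/-- The subtuple `x_I`, listed in increasing order of the indices. -/
def subTuple {p : ℕ} (x : Fin p → EuclideanSpace ℝ (Fin d)) (I : Finset (Fin p)) :
    Fin I.card → EuclideanSpace ℝ (Fin d) :=
  fun i => x (I.orderEmbOfFin rfl i)

/-- `Φ : [0, ∞) → [0, ∞)` decays exponentially fast with exponent `a'`. -/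
def IsExpDecaying (a' : ℝ) (Φ : ℝ → ℝ) : Prop :=
  (∀ s, 0 ≤ s → 0 ≤ Φ s) ∧
    ∃ C c : ℝ, 0 < C ∧ 0 < c ∧ ∀ s, 0 ≤ s → Φ s ≤ C * Real.exp (-c * s ^ a')

/-- `EDC(a, a')`: exponential decay of correlations. As correlation functions are only defined up
to null sets, the bound is required for almost every `x`. -/
def ExpDecayCorrelations (ρ : (p : ℕ) → (Fin p → EuclideanSpace ℝ (Fin d)) → ℝ)
    (a a' : ℝ) : Prop :=
  ∃ (Φ : ℝ → ℝ) (C : ℝ), IsExpDecaying a' Φ ∧ 1 ≤ C ∧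
    ∀ (p : ℕ), ∀ᵐ x : Fin p → EuclideanSpace ℝ (Fin d),
      ∀ I : Finset (Fin p), I.Nonempty → Iᶜ.Nonempty →
        |ρ p x - ρ I.card (subTuple x I) * ρ Iᶜ.card (subTuple x Iᶜ)|
          ≤ C ^ p * (p ! : ℝ) ^ a * Φ (clusterDist x I)

/-- The score of `x` in `X` is not affected by the configuration outside the ball `B_r(x)`. -/
def StabilizesAt (ξ : EuclideanSpace ℝ (Fin d) → Config d → ℝ)
    (x : EuclideanSpace ℝ (Fin d)) (X : Config d) (r : ℝ≥0) : Prop :=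
  ∀ Y : Config d,
    ξ x ((X.restrict (Metric.closedBall x r)).union (Y.restrict (Metric.closedBall x r)ᶜ))
      = ξ x (X.restrict (Metric.closedBall x r))

/-- The radius of stabilization `R^ξ(x, X) ∈ [0, ∞]`. -/
noncomputable def stabRadius (ξ : EuclideanSpace ℝ (Fin d) → Config d → ℝ)
    (x : EuclideanSpace ℝ (Fin d)) (X : Config d) : ℝ≥0∞ :=
  ⨅ (r : ℝ≥0) (_ : StabilizesAt ξ x X r), (r : ℝ≥0∞)

/-- `ST(b)`: under the Palm distributions, the moments of the radius of stabilization with respect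
to `P_n = P ∩ W_n` satisfy `E_x[R^ξ(x_i, P_n)^N] ≤ C^N N!^b`, uniformly in `p`, `n` and `x`
(almost every `x` with respect to the factorial moment measure). -/
def StabilizationCond (ρ : (p : ℕ) → (Fin p → EuclideanSpace ℝ (Fin d)) → ℝ)
    (Q : (p : ℕ) → Kernel (Fin p → EuclideanSpace ℝ (Fin d)) (Config d))
    (ξ : EuclideanSpace ℝ (Fin d) → Config d → ℝ) (b : ℝ) : Prop :=
  ∃ C : ℝ, 1 ≤ C ∧ ∀ p n N : ℕ, 1 ≤ p → 1 ≤ n → 1 ≤ N →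
    ∀ᵐ x : Fin p → EuclideanSpace ℝ (Fin d), (∀ i, x i ∈ obsWindow d n) → 0 < ρ p x →
      ∀ i, ∫⁻ X, stabRadius ξ (x i) (X.restrict (obsWindow d n)) ^ N ∂(Q p x)
        ≤ ENNReal.ofReal (C ^ N * (N ! : ℝ) ^ b)

/-- `MG(β)`: under the Palm distributions at `p ≤ k` points, the `k`-th absolute moment of the
scores satisfies `E_x[|ξ(x_i, P_n)|^k] ≤ C^k k!^β`, uniformly in `p`, `n` and `x`
(almost every `x` with respect to the factorial moment measure). -/
def MomentGrowthCond (ρ : (p : ℕ) → (Fin p → EuclideanSpace ℝ (Fin d)) → ℝ)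
    (Q : (p : ℕ) → Kernel (Fin p → EuclideanSpace ℝ (Fin d)) (Config d))
    (ξ : EuclideanSpace ℝ (Fin d) → Config d → ℝ) (β : ℝ) : Prop :=
  ∃ C : ℝ, 1 ≤ C ∧ ∀ p n k : ℕ, 1 ≤ p → p ≤ k → 1 ≤ n →
    ∀ᵐ x : Fin p → EuclideanSpace ℝ (Fin d), (∀ i, x i ∈ obsWindow d n) → 0 < ρ p x →
      ∀ i, ∫⁻ X, ‖ξ (x i) (X.restrict (obsWindow d n))‖ₑ ^ k ∂(Q p x)
        ≤ ENNReal.ofReal (C ^ k * (k ! : ℝ) ^ β)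

/-- `PG(γ₁, γ₂)`: `|ξ(x, X ∩ B_r(x))| ≤ C max(1, r)^{γ₁} #(X ∩ B_r(x))^{γ₂}`. -/
def PowerGrowthCond (ξ : EuclideanSpace ℝ (Fin d) → Config d → ℝ) (γ₁ γ₂ : ℝ) : Prop :=
  ∃ C : ℝ, 1 ≤ C ∧ ∀ (X : Config d) (x : EuclideanSpace ℝ (Fin d)) (r : ℝ), x ∈ X → 0 < r →
    |ξ x (X.restrict (Metric.closedBall x r))|
      ≤ C * max 1 r ^ γ₁ * ((X.carrier ∩ Metric.closedBall x r).ncard : ℝ) ^ γ₂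

/-- The integral `μ_n^ξ(f) = ∑_{x ∈ P_n} ξ(x, P_n) f(n^{-1/d} x)` of `f` with respect to the
`ξ`-weighted measure of `P_n = P ∩ W_n`, as a function of the configuration (a finite sum). -/
noncomputable def weightedSum (ξ : EuclideanSpace ℝ (Fin d) → Config d → ℝ) (n : ℕ)
    (f : EuclideanSpace ℝ (Fin d) → ℝ) (X : Config d) : ℝ :=
  ∑ᶠ x ∈ X.carrier ∩ obsWindow d n,
    ξ x (X.restrict (obsWindow d n)) * f ((n : ℝ) ^ (-1 / (d : ℝ)) • x)

end PointProcess

/-- The `k`-th cumulant of a random variable `Y` (with finite moments up to order `k`, `k ≥ 1`), in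
terms of its moments: `∑_Π (-1)^{|Π|-1} (|Π|-1)! ∏_{π ∈ Π} E[Y^{|π|}]`, the sum running over the
set partitions `Π` of a set with `k` elements. -/
noncomputable def kthCumulant {Ω : Type*} [MeasurableSpace Ω] (P : Measure Ω) (Y : Ω → ℝ)
    (k : ℕ) : ℝ :=
  ∑ S : Finpartition (Finset.univ : Finset (Fin k)),
    (-1 : ℝ) ^ (S.parts.card - 1) * ((S.parts.card - 1)! : ℝ) *
      ∏ B ∈ S.parts, ∫ ω, Y ω ^ B.card ∂P

/-! The window is cut into unit cubes, so that `weightedSum` is a sum of at most `3 ^ d * n`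
variables `Y_z`, the score sums over single cubes, indexed by lattice points
(`weightedSum_eq_sum_cubeSum`). Cumulants are multilinear (`kthCumulant_sum`), and the task is to
bound the joint cumulants of `Y_{z 1}, …, Y_{z k}` and to sum over all `z`.

Cumulants. A joint cumulant is a function of the set function `A ↦ E ∏_{i ∈ A} Y_{z i}`. It vanishes
if this function is multiplicative across a splitting of the indices into two groups, and it is
stable under perturbation: mixed moments of size `c^|A| |A|!^κ` with `κ ≥ 1` that factorize up to a
relative error `ε` give a cumulant of size `ε (8c)^k k!^κ` (`abs_setCumulant_le_of_split`). Bounds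
of this form survive convolution over subsets, so that the number of partitions costs only a factor
`C^k`. If the error is `M / (1+s)^(dk+2)` when the two groups are at distance `s`, the sum over `z`
converges: the tuples that first become connected at scale `s` are coded by a tree and number at
most `#Z k^k (2s+1)^(dk)` (`sum_lattice_le`).

Moments. The Campbell formula with one-point Palm distributions, together with exponential moments
of the number of points in a cube, gives `E Y_z^m ≤ C^m m!^(1+β)`.

Factorization. The score is replaced by zero where its stabilization radius reaches `r` or its
absolute value exceeds `T` (`truncScore`). A product of truncated cube sums depends only on the
points in a region of volume at most `V = k (1+2r)^d`. Expanding such a functional in factorial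
moments turns a covariance into a double series in `ρ^(l+m) - ρ^(l) ρ^(m)`. Exponential decay of
correlations bounds it by `exp(-c δ^a')` times the square of `∑ x^l / l!^(1-a)`, with `x`
proportional to `V`, and the square is at most `4 exp(c₂ V^(1/(1-a)))` (`Config.covariance_le`,
`exists_cluster_bounds`). The error of truncation is controlled by Markov's inequality.

Choice of levels. Put `D = d / ((1-a) a')`. The covariance bound is useful if `(k r^d)^(1/(1-a))` is
small compared with `s^a'`, which suggests `r = min (s/8) (ε s^(1/D) k^(-1/d))`. Moments of the
radius of order about `dk` (for `s/8`) or `D dk` (for the other level) then give an error `C^k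
(k^k)^G / (1+s)^(dk+2)` as soon as `G ≥ bd` and `G ≥ bdD + D` (`exists_truncation_levels`).
Altogether the exponent of `k!` is `2 + β + G`: `1` from the trees, `1 + β` from the moments and `G`
from the factorization. The two cases of the theorem are the two ranges `D ≥ 1` and `D ≤ 1`, with a
suitable `G` in each. -/

namespace Config

variable {d : ℕ}

/-! ### Measurability on the space of configurations -/

theorem measurable_encard {s : Set (EuclideanSpace ℝ (Fin d))} (hs : MeasurableSet s) :
    Measurable fun X : Config d => (X.carrier ∩ s).encard := by
  apply Measurable.mono (comap_measurable _) _ le_rfl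
  exact le_iSup₂_of_le s hs le_rfl

theorem measurable_iff_encard {α : Type*} [MeasurableSpace α] {f : α → Config d} :
    Measurable f ↔ ∀ s, MeasurableSet s → Measurable fun a => ((f a).carrier ∩ s).encard := by
  refine ⟨fun h s hs => (measurable_encard hs).comp h, fun h => ?_⟩
  rw [measurable_iff_comap_le]
  change MeasurableSpace.comap f (⨆ (s : Set (EuclideanSpace ℝ (Fin d))) (_ : MeasurableSet s),
    MeasurableSpace.comap (fun X : Config d => (X.carrier ∩ s).encard) inferInstance) ≤ _
  simp only [MeasurableSpace.comap_iSup, MeasurableSpace.comap_comp]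
  exact iSup₂_le fun s hs => (h s hs).comap_le

theorem measurable_restrict {s : Set (EuclideanSpace ℝ (Fin d))} (hs : MeasurableSet s) :
    Measurable fun X : Config d => X.restrict s := by
  rw [measurable_iff_encard]
  intro t ht
  have := measurable_encard (d := d) (hs.inter ht)
  simpa only [restrict, Set.inter_assoc] using this

theorem measurable_translate (v : EuclideanSpace ℝ (Fin d)) :
    Measurable (translate v : Config d → Config d) := by
  rw [measurable_iff_encard]
  intro t ht
  have ht' : MeasurableSet ((fun x => x + v) ⁻¹' t) := (measurable_add_const v) ht
  convert measurable_encard ht' using 2 with X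
  have : (translate v X).carrier ∩ t
      = (fun x => x + v) '' (X.carrier ∩ (fun x => x + v) ⁻¹' t) := by
    rw [Set.image_inter_preimage]; rfl
  rw [this, (add_left_injective v).encard_image]

theorem countable_carrier (X : Config d) : X.carrier.Countable := by
  have : X.carrier = ⋃ n : ℕ, X.carrier ∩ Metric.closedBall 0 n := by
    rw [← Set.inter_iUnion, Metric.iUnion_closedBall_nat, Set.inter_univ]
  rw [this]
  exact Set.countable_iUnion fun n => (X.finite_inter _ Metric.isBounded_closedBall).countable

end Config

/-! ### Unit cubes and their enlargements -/

section Cubes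

variable {d : ℕ}

/-- The half-open unit cube of points with integer part `z`. -/
def unitCube (z : Fin d → ℤ) : Set (EuclideanSpace ℝ (Fin d)) := {x | ∀ i, ⌊x i⌋ = z i}

theorem measurableSet_unitCube (z : Fin d → ℤ) : MeasurableSet (unitCube z) := by
  have : unitCube z = ⋂ i, {x : EuclideanSpace ℝ (Fin d) | ⌊x i⌋ = z i} := by
    ext x; simp [unitCube]
  rw [this]
  refine MeasurableSet.iInter fun i => ?_
  have : Measurable fun x : EuclideanSpace ℝ (Fin d) => ⌊x i⌋ :=
    Int.measurable_floor.comp (by fun_prop)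
  exact this (measurableSet_singleton (z i))

/-- The unit cube with integer part `z`, closed and enlarged by `r` on every side. -/
def enlargedCube (z : Fin d → ℤ) (r : ℝ) : Set (EuclideanSpace ℝ (Fin d)) :=
  {x | ∀ i, x i ∈ Set.Icc (z i - r) (z i + 1 + r)}

theorem enlargedCube_eq_preimage (z : Fin d → ℤ) (r : ℝ) :
    enlargedCube z r = WithLp.ofLp ⁻¹'
      (Set.univ.pi fun i : Fin d => Set.Icc ((z i : ℝ) - r) (z i + 1 + r)) := by
  ext x
  simp only [enlargedCube, Set.mem_ofPred_eq, Set.mem_preimage, Set.mem_univ_pi]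

theorem measurableSet_enlargedCube (z : Fin d → ℤ) (r : ℝ) :
    MeasurableSet (enlargedCube z r) := by
  rw [enlargedCube_eq_preimage]
  exact (EuclideanSpace.volume_preserving_symm_measurableEquiv_toLp (Fin d)).measurable
    (MeasurableSet.univ_pi fun i => measurableSet_Icc)

theorem volume_enlargedCube (z : Fin d → ℤ) {r : ℝ} (hr : 0 ≤ r) :
    volume (enlargedCube z r) = ENNReal.ofReal ((1 + 2 * r) ^ d) := by
  rw [enlargedCube_eq_preimage]
  have := (EuclideanSpace.volume_preserving_symm_measurableEquiv_toLp (Fin d)).measure_preimage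
    (MeasurableSet.univ_pi (t := fun i : Fin d => Set.Icc ((z i : ℝ) - r) (z i + 1 + r))
      fun i => measurableSet_Icc).nullMeasurableSet
  refine this.trans ?_
  rw [volume_pi, Measure.pi_pi]
  simp only [Real.volume_Icc]
  rw [ENNReal.ofReal_pow (by linarith)]
  have : ∀ i, ENNReal.ofReal ((z i : ℝ) + 1 + r - (z i - r)) = ENNReal.ofReal (1 + 2 * r) :=
    fun i => by congr 1; ring
  simp [this]

theorem isBounded_enlargedCube (z : Fin d → ℤ) (r : ℝ) :
    Bornology.IsBounded (enlargedCube z r) := by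
  have h : Bornology.IsBounded (Set.univ.pi fun i : Fin d =>
      Set.Icc ((z i : ℝ) - r) (z i + 1 + r)) :=
    Bornology.IsBounded.pi fun i => Metric.isBounded_Icc _ _
  rw [enlargedCube_eq_preimage]
  exact (PiLp.antilipschitzWith_ofLp 2 (fun _ : Fin d => ℝ)).isBounded_preimage h

theorem unitCube_subset_enlargedCube (z : Fin d → ℤ) {r : ℝ} (hr : 0 ≤ r) :
    unitCube z ⊆ enlargedCube z r := by
  intro x hx i
  have h1 := Int.floor_le (x i)
  have h2 := Int.lt_floor_add_one (x i)
  rw [hx i] at h1 h2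
  exact ⟨by linarith, by linarith⟩

theorem isBounded_unitCube (z : Fin d → ℤ) : Bornology.IsBounded (unitCube z) :=
  (isBounded_enlargedCube z 0).subset (unitCube_subset_enlargedCube z le_rfl)

theorem closedBall_subset_enlargedCube {z : Fin d → ℤ} {r : ℝ}
    {x : EuclideanSpace ℝ (Fin d)} (hx : x ∈ unitCube z) :
    Metric.closedBall x r ⊆ enlargedCube z r := by
  intro y hy i
  have h0 := unitCube_subset_enlargedCube z le_rfl hx i
  have h1 : |y i - x i| ≤ r := by
    have := PiLp.norm_apply_le (y - x) i
    rw [Real.norm_eq_abs] at this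
    exact this.trans (by simpa [dist_eq_norm] using hy)
  rw [abs_le] at h1
  simp only [sub_zero, add_zero, Set.mem_Icc] at h0 ⊢
  exact ⟨by linarith, by linarith⟩

theorem iUnion_unitCube : ⋃ z : Fin d → ℤ, unitCube z = Set.univ :=
  Set.eq_univ_of_forall fun x => Set.mem_iUnion.2 ⟨fun i => ⌊x i⌋, fun _ => rfl⟩

theorem pairwise_disjoint_unitCube :
    Pairwise (Function.onFun Disjoint (unitCube : (Fin d → ℤ) → _)) := by
  intro z w hzw
  refine Set.disjoint_left.2 fun x hx hy => hzw ?_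
  ext i
  rw [← hx i, ← hy i]

end Cubes

/-! ### Sums over points and over tuples of distinct points -/

section PointSums

variable {d : ℕ}

namespace Config

theorem count_restrict_apply (X : Config d) {s : Set (EuclideanSpace ℝ (Fin d))}
    (hs : MeasurableSet s) : (Measure.count.restrict X.carrier) s = (X.carrier ∩ s).encard := by
  rw [Measure.restrict_apply hs, Measure.count_apply (hs.inter X.countable_carrier.measurableSet),
    Set.inter_comm]

theorem lintegral_count_restrict (X : Config d) (g : EuclideanSpace ℝ (Fin d) → ℝ≥0∞) :
    ∫⁻ x, g x ∂(Measure.count.restrict X.carrier) = ∑' x : X.carrier, g x := by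
  rw [lintegral_countable _ X.countable_carrier]
  simp

/-- The counting measure of a configuration, as a kernel. -/
noncomputable def pointKernel (d : ℕ) : Kernel (Config d) (EuclideanSpace ℝ (Fin d)) where
  toFun X := Measure.count.restrict X.carrier
  measurable' := by
    refine Measure.measurable_of_measurable_coe _ fun s hs => ?_
    simp only [count_restrict_apply _ hs]
    exact measurable_from_top.comp (measurable_encard hs)

/-- A configuration may have infinitely many points, and the counts in a cube are finite but not
uniformly bounded. The kernel is therefore decomposed according to the cube and to the number of
points in it; each piece is finite. -/
instance : IsSFiniteKernel (pointKernel d) := by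
  classical
  have hms : ∀ q : (Fin d → ℤ) × ℕ, MeasurableSet {X : Config d |
      (X.carrier ∩ unitCube q.1).encard = q.2} := fun q =>
    measurable_encard (measurableSet_unitCube q.1) (measurableSet_singleton _)
  let K : (Fin d → ℤ) × ℕ → Kernel (Config d) (EuclideanSpace ℝ (Fin d)) := fun q =>
    Kernel.piecewise (hms q) ((pointKernel d).restrict (measurableSet_unitCube q.1)) 0
  have hK : ∀ q, IsFiniteKernel (K q) := by
    intro q
    refine ⟨⟨q.2, ENNReal.natCast_lt_top _, fun X => ?_⟩⟩
    simp only [K, Kernel.piecewise_apply]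
    split_ifs with h
    · rw [Kernel.restrict_apply, Measure.restrict_apply_univ]
      change (Measure.count.restrict X.carrier) _ ≤ _
      rw [count_restrict_apply _ (measurableSet_unitCube _)]
      rw [Set.mem_ofPred_eq] at h
      rw [h]; simp
    · simp
  have : pointKernel d = Kernel.sum K := by
    ext X s hs
    rw [Kernel.sum_apply' _ _ hs, ENNReal.tsum_prod']
    have h1 : ∀ z : Fin d → ℤ, ∑' j : ℕ, K (z, j) X s = pointKernel d X (s ∩ unitCube z) := by
      intro z
      obtain ⟨j, hj⟩ := ENat.ne_top_iff_exists.1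
        (Set.encard_ne_top_iff.2 (X.finite_inter _ (isBounded_unitCube z)))
      rw [tsum_eq_single j]
      · simp only [K, Kernel.piecewise_apply]
        rw [if_pos (by simpa using hj.symm), Kernel.restrict_apply, Measure.restrict_apply hs]
      · intro i hi
        simp only [K, Kernel.piecewise_apply]
        rw [if_neg]
        · simp
        · simp only [Set.mem_ofPred_eq, ← hj]
          exact fun h => hi (by exact_mod_cast h.symm)
    simp_rw [h1]
    rw [← measure_iUnion, ← Set.inter_iUnion, iUnion_unitCube, Set.inter_univ]
    · intro z w hzw
      exact (pairwise_disjoint_unitCube hzw).mono Set.inter_subset_right Set.inter_subset_right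
    · exact fun z => hs.inter (measurableSet_unitCube z)
  rw [this]
  exact Kernel.isSFiniteKernel_sum

theorem measurable_tsum_carrier {α : Type*} [MeasurableSpace α] {c : α → Config d}
    (hc : Measurable c) {g : α → EuclideanSpace ℝ (Fin d) → ℝ≥0∞}
    (hg : Measurable (Function.uncurry g)) :
    Measurable fun a => ∑' x : (c a).carrier, g a x := by
  have : ∀ a, ∑' x : (c a).carrier, g a x = ∫⁻ x, g a x ∂((pointKernel d).comap c hc a) := by
    intro a
    rw [Kernel.comap_apply]
    exact (lintegral_count_restrict _ _).symm
  simp_rw [this]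
  exact hg.lintegral_kernel_prod_right'

-- Peeling off one coordinate reduces sums over tuples to sums over points, which makes
-- measurability accessible by induction on the length.
open Classical in
theorem tsum_distinctTuples_succ (X : Config d) (p : ℕ)
    (g : (Fin (p + 1) → EuclideanSpace ℝ (Fin d)) → ℝ≥0∞) :
    ∑' u : X.distinctTuples (p + 1), g u = ∑' u : X.distinctTuples p, ∑' x : X.carrier,
      if x.1 ∈ Set.range u.1 then 0 else g (Fin.cons x u.1) := by
  rw [tsum_subtype, tsum_subtype (X.distinctTuples p)
    (fun u => ∑' x : X.carrier, if x.1 ∈ Set.range u then 0 else g (Fin.cons x.1 u))]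
  rw [← (Fin.consEquiv fun _ => EuclideanSpace ℝ (Fin d)).tsum_eq, ENNReal.tsum_prod',
    ENNReal.tsum_comm]
  have hcons : ∀ x u, (Fin.consEquiv fun _ => EuclideanSpace ℝ (Fin d)) (x, u)
      = (Fin.cons x u : Fin (p + 1) → EuclideanSpace ℝ (Fin d)) := fun _ _ => rfl
  refine tsum_congr fun u => ?_
  by_cases hu : u ∈ X.distinctTuples p
  · rw [Set.indicator_of_mem hu, tsum_subtype X.carrier
      (fun x => if x ∈ Set.range u then 0 else g (Fin.cons x u))]
    refine tsum_congr fun x => ?_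
    rw [Set.indicator_apply, hcons]
    have : (Fin.cons x u : Fin (p + 1) → EuclideanSpace ℝ (Fin d)) ∈ X.distinctTuples (p + 1) ↔
        x ∈ X.carrier ∧ x ∉ Set.range u := by
      simp only [distinctTuples, Set.mem_ofPred_eq, Fin.cons_injective_iff, Fin.forall_fin_succ,
        Fin.cons_zero, Fin.cons_succ]
      exact ⟨fun h => ⟨h.2.1, h.1.1⟩, fun h => ⟨⟨h.2, hu.1⟩, h.1, hu.2⟩⟩
    by_cases h1 : x ∈ X.carrier <;> by_cases h2 : x ∈ Set.range u <;>
      simp only [this, Set.indicator_apply, h1, h2, not_true_eq_false, not_false_eq_true, and_true,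
        and_false, if_true, if_false]
  · rw [Set.indicator_of_notMem hu]
    refine ENNReal.tsum_eq_zero.2 fun x => Set.indicator_of_notMem ?_ _
    intro h
    simp only [distinctTuples, Set.mem_ofPred_eq, hcons, Fin.cons_injective_iff,
      Fin.forall_fin_succ, Fin.cons_zero, Fin.cons_succ] at h
    exact hu ⟨h.1.2, h.2.2⟩

theorem measurable_tsum_distinctTuples (p : ℕ) {α : Type*} [MeasurableSpace α] {c : α → Config d}
    (hc : Measurable c) {g : α → (Fin p → EuclideanSpace ℝ (Fin d)) → ℝ≥0∞}
    (hg : Measurable (Function.uncurry g)) :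
    Measurable fun a => ∑' u : (c a).distinctTuples p, g a u := by
  classical
  induction p with
  | zero =>
    have h : ∀ a, ∑' u : (c a).distinctTuples 0, g a u = g a Fin.elim0 := by
      intro a
      have hm : ∀ u : Fin 0 → EuclideanSpace ℝ (Fin d), u ∈ (c a).distinctTuples 0 := fun u =>
        ⟨Function.injective_of_subsingleton u, fun i => i.elim0⟩
      rw [tsum_subtype, tsum_eq_single Fin.elim0
        (fun b hb => (hb (Subsingleton.elim _ _)).elim), Set.indicator_of_mem (hm _)]
    simp_rw [h]
    exact hg.comp (measurable_id.prodMk measurable_const)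
  | succ p ih =>
    simp_rw [tsum_distinctTuples_succ]
    -- The induction hypothesis is needed for functions of an additional parameter, because the
    -- inner sum over the peeled point depends on the configuration.
    refine ih (g := fun a u => ∑' x : (c a).carrier,
      if x.1 ∈ Set.range u then 0 else g a (Fin.cons x.1 u)) ?_
    refine measurable_tsum_carrier (α := α × (Fin p → EuclideanSpace ℝ (Fin d)))
      (c := fun q => c q.1) (hc.comp measurable_fst)
      (g := fun q x => if x ∈ Set.range q.2 then 0 else g q.1 (Fin.cons x q.2)) ?_
    refine Measurable.ite ?_ measurable_const ?_
    · have : {q : (α × (Fin p → EuclideanSpace ℝ (Fin d))) × EuclideanSpace ℝ (Fin d) |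
          q.2 ∈ Set.range q.1.2} = ⋃ i, {q | q.1.2 i = q.2} := by
        ext q; simp
      rw [this]
      refine MeasurableSet.iUnion fun i => measurableSet_eq_fun ?_ measurable_snd
      exact (measurable_pi_apply i).comp (measurable_snd.comp measurable_fst)
    · refine hg.comp (Measurable.prodMk (measurable_fst.comp measurable_fst) ?_)
      refine measurable_pi_iff.2 fun i => ?_
      refine Fin.cases ?_ (fun j => ?_) i
      · exact measurable_snd
      · exact (measurable_pi_apply j).comp (measurable_snd.comp measurable_fst)

/-- The points of `X` in a set `A` (which has to be bounded). -/
noncomputable def pts (X : Config d) (A : Set (EuclideanSpace ℝ (Fin d))) :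
    Finset (EuclideanSpace ℝ (Fin d)) := by
  classical exact if h : (X.carrier ∩ A).Finite then h.toFinset else ∅

theorem mem_pts {X : Config d} {A : Set (EuclideanSpace ℝ (Fin d))}
    (hA : Bornology.IsBounded A) {x : EuclideanSpace ℝ (Fin d)} :
    x ∈ X.pts A ↔ x ∈ X.carrier ∧ x ∈ A := by
  rw [pts, dif_pos (X.finite_inter A hA)]
  simp

theorem coe_pts {X : Config d} {A : Set (EuclideanSpace ℝ (Fin d))}
    (hA : Bornology.IsBounded A) : (X.pts A : Set (EuclideanSpace ℝ (Fin d))) = X.carrier ∩ A := by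
  ext x; simp [mem_pts hA]

open Classical in
/-- The tuples of distinct points of `X` in `A`. -/
noncomputable def tuples (X : Config d) (A : Set (EuclideanSpace ℝ (Fin d))) (p : ℕ) :
    Finset (Fin p → EuclideanSpace ℝ (Fin d)) :=
  (Fintype.piFinset fun _ => X.pts A).filter Function.Injective

theorem mem_tuples {X : Config d} {A : Set (EuclideanSpace ℝ (Fin d))}
    (hA : Bornology.IsBounded A) {p : ℕ} {u : Fin p → EuclideanSpace ℝ (Fin d)} :
    u ∈ X.tuples A p ↔ u ∈ X.distinctTuples p ∧ ∀ i, u i ∈ A := by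
  simp only [tuples, Finset.mem_filter, Fintype.mem_piFinset, mem_pts hA, distinctTuples,
    Set.mem_ofPred_eq]
  exact ⟨fun h => ⟨⟨h.2, fun i => (h.1 i).1⟩, fun i => (h.1 i).2⟩,
    fun h => ⟨fun i => ⟨h.1.2 i, h.2 i⟩, h.1.1⟩⟩

theorem tsum_carrier_indicator (X : Config d) {A : Set (EuclideanSpace ℝ (Fin d))}
    (hA : Bornology.IsBounded A) (g : EuclideanSpace ℝ (Fin d) → ℝ≥0∞) :
    ∑' x : X.carrier, A.indicator g x = ∑ x ∈ X.pts A, g x := by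
  rw [tsum_subtype X.carrier (A.indicator g), Set.indicator_indicator, ← coe_pts hA,
    ← tsum_subtype, Finset.tsum_subtype']

theorem tsum_distinctTuples_indicator (X : Config d) {A : Set (EuclideanSpace ℝ (Fin d))}
    (hA : Bornology.IsBounded A) (p : ℕ) (g : (Fin p → EuclideanSpace ℝ (Fin d)) → ℝ≥0∞) :
    ∑' u : X.distinctTuples p, {u | ∀ i, u i ∈ A}.indicator g u = ∑ u ∈ X.tuples A p, g u := by
  have : (X.tuples A p : Set (Fin p → EuclideanSpace ℝ (Fin d)))
      = X.distinctTuples p ∩ {u | ∀ i, u i ∈ A} := by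
    ext u; simp [mem_tuples hA]
  rw [tsum_subtype (X.distinctTuples p) ({u | ∀ i, u i ∈ A}.indicator g),
    Set.indicator_indicator, ← this, ← tsum_subtype, Finset.tsum_subtype']

theorem tsum_distinctTuples_one (X : Config d) (g : EuclideanSpace ℝ (Fin d) → ℝ≥0∞) :
    ∑' u : X.distinctTuples 1, g (u.1 0) = ∑' x : X.carrier, g x := by
  rw [tsum_distinctTuples_succ X 0 (fun u => g (u 0))]
  have h0 : Fin.elim0 ∈ X.distinctTuples 0 :=
    ⟨Function.injective_of_subsingleton _, fun i => i.elim0⟩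
  rw [tsum_eq_single ⟨Fin.elim0, h0⟩
    (fun b hb => (hb (Subtype.ext (Subsingleton.elim _ _))).elim)]
  simp

/-- Sums over the points in a bounded set are measurable. -/
theorem measurable_sum_pts {A : Set (EuclideanSpace ℝ (Fin d))} (hA : Bornology.IsBounded A)
    (hAm : MeasurableSet A) {g : Config d → EuclideanSpace ℝ (Fin d) → ℝ}
    (hg : Measurable (Function.uncurry g)) : Measurable fun X => ∑ x ∈ X.pts A, g X x := by
  have h : ∀ X : Config d, ∑ x ∈ X.pts A, g X x
      = (∑' x : X.carrier, A.indicator (fun x => ENNReal.ofReal (g X x)) x).toReal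
        - (∑' x : X.carrier, A.indicator (fun x => ENNReal.ofReal (-g X x)) x).toReal := by
    intro X
    rw [tsum_carrier_indicator X hA, tsum_carrier_indicator X hA,
      ENNReal.toReal_sum (by simp), ENNReal.toReal_sum (by simp), ← Finset.sum_sub_distrib]
    refine Finset.sum_congr rfl fun x _ => ?_
    simp only [ENNReal.toReal_ofReal', max_comm _ (0 : ℝ)]
    exact (max_zero_sub_eq_self (g X x)).symm ▸ by simp [max_comm]
  simp_rw [h]
  refine Measurable.sub ?_ ?_ <;> refine Measurable.ennreal_toReal ?_
  · exact measurable_tsum_carrier measurable_id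
      (g := fun X => A.indicator fun x => ENNReal.ofReal (g X x))
      (hg.ennreal_ofReal.indicator (s := Prod.snd ⁻¹' A) (measurable_snd hAm))
  · exact measurable_tsum_carrier measurable_id
      (g := fun X => A.indicator fun x => ENNReal.ofReal (-g X x))
      (hg.neg.ennreal_ofReal.indicator (s := Prod.snd ⁻¹' A) (measurable_snd hAm))

theorem measurable_sum_tuples {A : Set (EuclideanSpace ℝ (Fin d))} (hA : Bornology.IsBounded A)
    (hAm : MeasurableSet A) {p : ℕ} {g : (Fin p → EuclideanSpace ℝ (Fin d)) → ℝ≥0∞}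
    (hg : Measurable g) : Measurable fun X : Config d => ∑ u ∈ X.tuples A p, g u := by
  simp_rw [← tsum_distinctTuples_indicator _ hA]
  have hm : MeasurableSet {u : Fin p → EuclideanSpace ℝ (Fin d) | ∀ i, u i ∈ A} := by
    rw [Set.ofPred_forall]
    exact MeasurableSet.iInter fun i => measurable_pi_apply i hAm
  have hi := hg.indicator hm
  exact measurable_tsum_distinctTuples p measurable_id (hi.comp measurable_snd)

end Config

end PointSums

/-! ### Möbius inversion and the factorial moment expansion -/

section FactorialExpansion

-- Möbius inversion on the power set: splitting off an element `a`, the contributions without `a`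
-- cancel and those with `a` form the same sum for `W ↦ f (insert a W)`.
open Finset in
theorem Finset.sum_powerset_moebius {α : Type*} [DecidableEq α] (Z : Finset α)
    (f : Finset α → ℝ) :
    ∑ Y ∈ Z.powerset, ∑ W ∈ Y.powerset, (-1 : ℝ) ^ (#Y + #W) * f W = f Z := by
  induction Z using Finset.induction_on generalizing f with
  | empty => simp
  | insert a Z ha ih =>
    rw [Finset.sum_powerset_insert ha]
    have h : ∀ Y ∈ Z.powerset, ∑ W ∈ (insert a Y).powerset, (-1 : ℝ) ^ (#(insert a Y) + #W) * f W
        = - ∑ W ∈ Y.powerset, (-1 : ℝ) ^ (#Y + #W) * f W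
          + ∑ W ∈ Y.powerset, (-1 : ℝ) ^ (#Y + #W) * f (insert a W) := by
      intro Y hY
      have haY : a ∉ Y := fun h => ha (mem_powerset.1 hY h)
      rw [Finset.sum_powerset_insert haY, ← Finset.sum_neg_distrib]
      congr 1
      · refine sum_congr rfl fun W _ => ?_
        rw [card_insert_of_notMem haY]; ring
      · refine sum_congr rfl fun W hW => ?_
        rw [card_insert_of_notMem haY,
          card_insert_of_notMem fun h => haY (mem_powerset.1 hW h)]
        ring
    rw [sum_congr rfl h, sum_add_distrib, sum_neg_distrib, add_neg_cancel_left]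
    exact ih fun W => f (insert a W)

variable {d : ℕ}

namespace Config

/-- A finite set of points as a configuration. -/
def ofFinset (S : Finset (EuclideanSpace ℝ (Fin d))) : Config d where
  carrier := S
  finite_inter t _ := S.finite_toSet.inter_of_left t

theorem restrict_eq_ofFinset (X : Config d) {A : Set (EuclideanSpace ℝ (Fin d))}
    (hA : Bornology.IsBounded A) : X.restrict A = ofFinset (X.pts A) := by
  ext1
  exact (coe_pts hA).symm

-- The count of `u '' J` in `s` grows with a new index `j` by one exactly if `u j` lies in `s` and
-- does not repeat an earlier point; both are measurable conditions on `u`.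
open Classical in
theorem measurable_ofFinset_image {q : ℕ} (J : Finset (Fin q)) :
    Measurable fun u : Fin q → EuclideanSpace ℝ (Fin d) => ofFinset (J.image u) := by
  rw [measurable_iff_encard]
  intro s hs
  induction J using Finset.induction_on with
  | empty => simp [ofFinset]
  | insert j J hj ih =>
    have h : ∀ u : Fin q → EuclideanSpace ℝ (Fin d),
        ((ofFinset ((insert j J).image u)).carrier ∩ s).encard
          = ((ofFinset (J.image u)).carrier ∩ s).encard
            + (if u j ∈ s ∧ ¬ ∃ i ∈ J, u i = u j then 1 else 0) := by
      intro u
      simp only [ofFinset, Finset.image_insert, Finset.coe_insert]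
      by_cases h1 : u j ∈ s
      · rw [Set.insert_inter_of_mem h1]
        by_cases h2 : ∃ i ∈ J, u i = u j
        · rw [Set.insert_eq_of_mem (by simpa [h1] using h2)]
          simp [h2]
        · rw [Set.encard_insert_of_notMem (by simpa [h1] using h2), if_pos ⟨h1, h2⟩]
      · rw [Set.insert_inter_of_notMem h1]
        simp [h1]
    simp_rw [h]
    have hp : MeasurableSet {u : Fin q → EuclideanSpace ℝ (Fin d) |
        u j ∈ s ∧ ¬ ∃ i ∈ J, u i = u j} := by
      refine MeasurableSet.inter (measurable_pi_apply j hs) (MeasurableSet.compl ?_)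
      have : {u : Fin q → EuclideanSpace ℝ (Fin d) | ∃ i ∈ J, u i = u j}
          = ⋃ i ∈ J, {u | u i = u j} := by
        ext; simp
      change MeasurableSet {u : Fin q → EuclideanSpace ℝ (Fin d) | ∃ i ∈ J, u i = u j}
      rw [this]
      exact MeasurableSet.biUnion J.countable_toSet fun i _ =>
        measurableSet_eq_fun (measurable_pi_apply i) (measurable_pi_apply j)
    exact ih.add (Measurable.ite hp measurable_const measurable_const)

open Classical in
/-- The alternating sums of a functional over the subsets of the points of a tuple. -/
noncomputable def altSum (F : Config d → ℝ) (q : ℕ) (u : Fin q → EuclideanSpace ℝ (Fin d)) : ℝ :=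
  ∑ J : Finset (Fin q), (-1 : ℝ) ^ (q + J.card) * F (ofFinset (J.image u))

theorem measurable_altSum {F : Config d → ℝ} (hF : Measurable F) (q : ℕ) :
    Measurable (altSum F q) :=
  Finset.measurable_sum _ fun J _ => (hF.comp (measurable_ofFinset_image J)).const_mul _

theorem abs_altSum_le {F : Config d → ℝ} {M : ℝ} {q : ℕ}
    {u : Fin q → EuclideanSpace ℝ (Fin d)}
    (hF : ∀ S : Finset (EuclideanSpace ℝ (Fin d)), S.card ≤ q → |F (ofFinset S)| ≤ M) :
    |altSum F q u| ≤ 2 ^ q * M := by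
  classical
  refine (Finset.abs_sum_le_sum_abs _ _).trans ?_
  refine (Finset.sum_le_sum (g := fun _ => M) fun J _ => ?_).trans (by simp)
  rw [abs_mul, abs_pow, abs_neg, abs_one, one_pow, one_mul]
  exact hF _ (Finset.card_image_le.trans (by simpa using Finset.card_le_univ J))

-- Each set of `q` points is listed by exactly `q !` injective tuples, namely by the bijections from
-- `Fin q`.
open Finset in
theorem sum_tuples_image [DecidableEq (EuclideanSpace ℝ (Fin d))]
    (X : Config d) {A : Set (EuclideanSpace ℝ (Fin d))}
    (q : ℕ) (h : Finset (EuclideanSpace ℝ (Fin d)) → ℝ) :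
    ∑ u ∈ X.tuples A q, h (univ.image u) = q ! * ∑ Y ∈ (X.pts A).powersetCard q, h Y := by
  rw [← sum_fiberwise_of_maps_to (s := X.tuples A q) (t := (X.pts A).powersetCard q)
    (g := fun u => univ.image u), mul_sum]
  · refine sum_congr rfl fun Y hY => ?_
    rw [mem_powersetCard] at hY
    rw [sum_congr rfl (g := fun _ => h Y) (fun u hu => by rw [(mem_filter.1 hu).2]), sum_const,
      nsmul_eq_mul]
    congr 2
    have hcard : Fintype.card (Fin q ≃ Y) = q ! := by
      rw [Fintype.card_equiv (Fintype.equivOfCardEq (by simp [hY.2])), Fintype.card_fin]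
    rw [← hcard, ← card_univ]
    symm
    refine card_nbij (fun e i => ((e i : Y) : EuclideanSpace ℝ (Fin d))) ?_ ?_ ?_
    · intro e _
      have hinj : Function.Injective fun i => ((e i : Y) : EuclideanSpace ℝ (Fin d)) :=
        Subtype.val_injective.comp e.injective
      simp only [tuples, mem_coe, mem_filter, Fintype.mem_piFinset]
      refine ⟨⟨fun i => hY.1 (e i).2, hinj⟩, ?_⟩
      ext x
      simp only [mem_image, mem_univ, true_and]
      constructor
      · rintro ⟨i, rfl⟩; exact (e i).2
      · intro hx; exact ⟨e.symm ⟨x, hx⟩, by simp⟩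
    · intro e _ e' _ hee
      exact Equiv.ext fun i => Subtype.ext (congrFun hee i)
    · intro u hu
      simp only [tuples, coe_filter, mem_filter, Fintype.mem_piFinset, Set.mem_ofPred_eq] at hu
      have hu2 : ∀ i, u i ∈ Y := fun i => hu.2 ▸ mem_image_of_mem _ (mem_univ i)
      refine ⟨Equiv.ofBijective (fun i => ⟨u i, hu2 i⟩) ⟨?_, ?_⟩, by simp, rfl⟩
      · intro i j hij
        exact hu.1.2 (Subtype.ext_iff.1 hij)
      · rintro ⟨y, hy⟩
        rw [← hu.2, mem_image] at hy
        obtain ⟨i, _, rfl⟩ := hy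
        exact ⟨i, rfl⟩
  · intro u hu
    simp only [tuples, mem_filter, Fintype.mem_piFinset] at hu
    rw [mem_powersetCard]
    refine ⟨?_, by rw [card_image_of_injective _ hu.2]; simp⟩
    intro x hx
    obtain ⟨i, _, rfl⟩ := mem_image.1 hx
    exact hu.1 i

open Finset in
theorem altSum_of_injective [DecidableEq (EuclideanSpace ℝ (Fin d))] (F : Config d → ℝ) {q : ℕ}
    {u : Fin q → EuclideanSpace ℝ (Fin d)} (hu : Function.Injective u) :
    altSum F q u = ∑ W ∈ (univ.image u).powerset,
      (-1 : ℝ) ^ (#(univ.image u) + #W) * F (ofFinset W) := by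
  rw [powerset_image, sum_image fun J _ J' _ h => image_injective hu h, altSum, powerset_univ]
  refine sum_congr rfl fun J _ => ?_
  rw [card_image_of_injective _ hu, card_image_of_injective _ hu, card_univ, Fintype.card_fin]
  congr!

/-- Factorial moment expansion of a local functional. -/
theorem hasSum_altSum {F : Config d → ℝ} {A : Set (EuclideanSpace ℝ (Fin d))}
    (hA : Bornology.IsBounded A) (hF : ∀ X, F (X.restrict A) = F X) (X : Config d) :
    HasSum (fun q : ℕ => (q ! : ℝ)⁻¹ * ∑ u ∈ X.tuples A q, altSum F q u) (F X) := by
  classical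
  have h1 : ∀ q : ℕ, (q ! : ℝ)⁻¹ * ∑ u ∈ X.tuples A q, altSum F q u
      = ∑ Y ∈ (X.pts A).powersetCard q, ∑ W ∈ Y.powerset,
        (-1 : ℝ) ^ (Y.card + W.card) * F (ofFinset W) := by
    intro q
    rw [← mul_right_inj' (a := (q ! : ℝ)) (by positivity), ← sum_tuples_image X q fun Y =>
      ∑ W ∈ Y.powerset, (-1 : ℝ) ^ (Y.card + W.card) * F (ofFinset W),
      mul_inv_cancel_left₀ (by positivity)]
    refine Finset.sum_congr rfl fun u hu => altSum_of_injective F ?_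
    exact (Finset.mem_filter.1 hu).2
  simp_rw [h1]
  -- For a fixed configuration the series is a finite sum, because only finitely many points lie in
  -- `A`; convergence questions arise only after taking expectations.
  have h2 : F X = ∑ q ∈ Finset.range ((X.pts A).card + 1),
      ∑ Y ∈ (X.pts A).powersetCard q, ∑ W ∈ Y.powerset,
        (-1 : ℝ) ^ (Y.card + W.card) * F (ofFinset W) := by
    rw [← Finset.sum_powerset, Finset.sum_powerset_moebius (X.pts A) fun W => F (ofFinset W),
      ← restrict_eq_ofFinset X hA, hF]
  rw [h2]
  refine hasSum_sum_of_ne_finset_zero fun q hq => ?_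
  rw [Finset.powersetCard_eq_empty.2 (by simpa using hq), Finset.sum_empty]

end Config

end FactorialExpansion

/-! ### Campbell formulas for sums over tuples -/

section Campbell

variable {d : ℕ} {P : Measure (Config d)} {ρ : (p : ℕ) → (Fin p → EuclideanSpace ℝ (Fin d)) → ℝ}

theorem measurableSet_forall_mem {A : Set (EuclideanSpace ℝ (Fin d))} (hA : MeasurableSet A)
    (p : ℕ) : MeasurableSet {u : Fin p → EuclideanSpace ℝ (Fin d) | ∀ i, u i ∈ A} := by
  rw [Set.ofPred_forall]
  exact MeasurableSet.iInter fun i => measurable_pi_apply i hA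

theorem IsCorrelationFamily.lintegral_sum_tuples (hρ : IsCorrelationFamily P ρ)
    {A : Set (EuclideanSpace ℝ (Fin d))} (hA : Bornology.IsBounded A) (hAm : MeasurableSet A)
    {p : ℕ} {g : (Fin p → EuclideanSpace ℝ (Fin d)) → ℝ≥0∞} (hg : Measurable g) :
    ∫⁻ X, ∑ u ∈ X.tuples A p, g u ∂P
      = ∫⁻ u in {u | ∀ i, u i ∈ A}, g u * ENNReal.ofReal (ρ p u) := by
  have hm := measurableSet_forall_mem hAm p
  simp_rw [← Config.tsum_distinctTuples_indicator _ hA]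
  rw [hρ.campbell p _ (hg.indicator hm), ← lintegral_indicator hm]
  refine lintegral_congr fun u => ?_
  by_cases h : u ∈ {u : Fin p → EuclideanSpace ℝ (Fin d) | ∀ i, u i ∈ A}
  · rw [Set.indicator_of_mem h, Set.indicator_of_mem h]
  · rw [Set.indicator_of_notMem h, Set.indicator_of_notMem h, zero_mul]

/-- The Campbell formula for nonnegative functions is applied to the positive part, the negative
part and the absolute value. -/
theorem IsCorrelationFamily.integral_sum_tuples (hρ : IsCorrelationFamily P ρ)
    {A : Set (EuclideanSpace ℝ (Fin d))} (hA : Bornology.IsBounded A) (hAm : MeasurableSet A)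
    {p : ℕ} {g : (Fin p → EuclideanSpace ℝ (Fin d)) → ℝ} (hg : Measurable g)
    (hgi : IntegrableOn (fun u => g u * ρ p u) {u | ∀ i, u i ∈ A}) :
    Integrable (fun X : Config d => ∑ u ∈ X.tuples A p, g u) P ∧
    ∫ X, ∑ u ∈ X.tuples A p, g u ∂P = ∫ u in {u | ∀ i, u i ∈ A}, g u * ρ p u ∧
    ∫ X, |∑ u ∈ X.tuples A p, g u| ∂P ≤ ∫ u in {u | ∀ i, u i ∈ A}, |g u| * ρ p u := by
  set S : Set (Fin p → EuclideanSpace ℝ (Fin d)) := {u | ∀ i, u i ∈ A}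
  have key : ∀ h : (Fin p → EuclideanSpace ℝ (Fin d)) → ℝ, Measurable h → (∀ u, 0 ≤ h u) →
      IntegrableOn (fun u => h u * ρ p u) S →
      Integrable (fun X : Config d => ∑ u ∈ X.tuples A p, h u) P ∧
      ∫ X, ∑ u ∈ X.tuples A p, h u ∂P = ∫ u in S, h u * ρ p u := by
    intro h hh h0 hi
    have e1 : ∀ X : Config d, ∑ u ∈ X.tuples A p, h u
        = (∑ u ∈ X.tuples A p, ENNReal.ofReal (h u)).toReal := by
      intro X
      rw [ENNReal.toReal_sum (by simp)]
      exact Finset.sum_congr rfl fun u _ => (ENNReal.toReal_ofReal (h0 u)).symm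
    have e2 := hρ.lintegral_sum_tuples hA hAm (p := p) hh.ennreal_ofReal
    have e3 : ∫⁻ u in S, ENNReal.ofReal (h u) * ENNReal.ofReal (ρ p u)
        = ENNReal.ofReal (∫ u in S, h u * ρ p u) := by
      rw [ofReal_integral_eq_lintegral_ofReal hi
        (ae_of_all _ fun u => mul_nonneg (h0 u) (hρ.nonneg p u))]
      exact lintegral_congr fun u => (ENNReal.ofReal_mul (h0 u)).symm
    have hm := Config.measurable_sum_tuples hA hAm (p := p) hh.ennreal_ofReal
    have hne : ∫⁻ X, ∑ u ∈ X.tuples A p, ENNReal.ofReal (h u) ∂P ≠ ∞ := by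
      rw [e2, e3]; exact ENNReal.ofReal_ne_top
    simp_rw [e1]
    refine ⟨integrable_toReal_of_lintegral_ne_top hm.aemeasurable hne, ?_⟩
    rw [integral_toReal hm.aemeasurable (ae_of_all _ fun X => by simp), e2, e3,
      ENNReal.toReal_ofReal (setIntegral_nonneg (measurableSet_forall_mem hAm p)
        fun u _ => mul_nonneg (h0 u) (hρ.nonneg p u))]
  have hmul : ∀ x u, max x 0 * ρ p u = max (x * ρ p u) 0 := fun x u => by
    rw [max_mul_of_nonneg _ _ (hρ.nonneg p u), zero_mul]
  have hpos := key (fun u => max (g u) 0) (hg.max measurable_const) (fun u => le_max_right _ _)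
    (by simp_rw [hmul]; exact hgi.pos_part)
  have hneg := key (fun u => max (-g u) 0) (hg.neg.max measurable_const)
    (fun u => le_max_right _ _) (by simp_rw [hmul, neg_mul]; exact hgi.neg_part)
  have habs := key (fun u => |g u|) hg.abs (fun u => abs_nonneg _) (by
    refine (Integrable.abs hgi).congr (ae_of_all _ fun u => ?_)
    change |g u * ρ p u| = _
    rw [abs_mul, abs_of_nonneg (hρ.nonneg p u)])
  have hsub : ∀ x : ℝ, x = max x 0 - max (-x) 0 := fun x => by
    exact (max_zero_sub_eq_self x).symm
  have e : ∀ X : Config d, ∑ u ∈ X.tuples A p, g u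
      = ∑ u ∈ X.tuples A p, max (g u) 0 - ∑ u ∈ X.tuples A p, max (-g u) 0 := fun X => by
    rw [← Finset.sum_sub_distrib]
    exact Finset.sum_congr rfl fun u _ => hsub _
  have hint : Integrable (fun X : Config d => ∑ u ∈ X.tuples A p, g u) P := by
    simp_rw [e]; exact hpos.1.sub hneg.1
  refine ⟨hint, ?_, ?_⟩
  · simp_rw [e]
    rw [integral_sub hpos.1 hneg.1, hpos.2, hneg.2, ← integral_sub]
    · refine integral_congr_ae (ae_of_all _ fun u => ?_)
      simp only
      rw [← sub_mul, ← hsub]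
    · simp_rw [hmul]; exact hgi.pos_part
    · simp_rw [hmul, neg_mul]; exact hgi.neg_part
  · rw [← habs.2]
    exact integral_mono hint.abs habs.1 fun X => Finset.abs_sum_le_sum_abs _ _

end Campbell

/-! ### Splitting tuples into two parts -/

section TupleMeasure

variable {d : ℕ}

/-- Splitting a tuple in two parts preserves the volume. -/
theorem measurePreserving_splitTuple (E : Type*) [MeasureSpace E]
    [SigmaFinite (volume : Measure E)] (l m : ℕ) :
    MeasurePreserving (fun v : Fin (l + m) → E =>
      ((fun i => v (Fin.castAdd m i), fun j => v (Fin.natAdd l j)) :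
        (Fin l → E) × (Fin m → E))) := by
  have h1 := (volume_measurePreserving_piCongrLeft (fun _ : Fin (l + m) => E)
    finSumFinEquiv).symm
  have h2 := volume_measurePreserving_sumPiEquivProdPi (fun _ : Fin l ⊕ Fin m => E)
  exact h2.comp h1

theorem subTuple_eq (ρ : (p : ℕ) → (Fin p → EuclideanSpace ℝ (Fin d)) → ℝ) {p l : ℕ}
    (x : Fin p → EuclideanSpace ℝ (Fin d)) {I : Finset (Fin p)} (hI : I.card = l)
    {f : Fin l → Fin p} (hf : ∀ i, f i ∈ I) (hmono : StrictMono f) :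
    ρ I.card (subTuple x I) = ρ l fun i => x (f i) := by
  subst hI
  congr 1
  funext i
  rw [subTuple, ← Finset.orderEmbOfFin_unique rfl hf hmono]

end TupleMeasure

/-! ### Bounds on the correlation functions -/

section CorrelationBounds

variable {d : ℕ} {P : Measure (Config d)} {ρ : (p : ℕ) → (Fin p → EuclideanSpace ℝ (Fin d)) → ℝ}

theorem IsCorrelationFamily.rho_zero [IsProbabilityMeasure P] (hρ : IsCorrelationFamily P ρ)
    (u : Fin 0 → EuclideanSpace ℝ (Fin d)) : ρ 0 u = 1 := by
  have h := hρ.campbell 0 (fun _ => 1) measurable_const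
  have h1 : ∀ X : Config d, ∑' _ : X.distinctTuples 0, (1 : ℝ≥0∞) = 1 := by
    intro X
    have h0 : u ∈ X.distinctTuples 0 :=
      ⟨Function.injective_of_subsingleton _, fun i => i.elim0⟩
    rw [tsum_eq_single ⟨u, h0⟩ (fun b hb => (hb (Subtype.ext (Subsingleton.elim _ _))).elim)]
  simp_rw [h1, one_mul] at h
  rw [volume_pi, Measure.pi_of_empty _ u, lintegral_dirac, lintegral_const, measure_univ,
    one_mul] at h
  have h2 := congrArg ENNReal.toReal h
  rw [ENNReal.toReal_ofReal (hρ.nonneg 0 u)] at h2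
  simpa using h2.symm

/-- By stationarity the intensity measure is translation invariant, hence a multiple of Lebesgue
measure, and its density is almost everywhere constant. -/
theorem IsCorrelationFamily.exists_rho_one_le (hρ : IsCorrelationFamily P ρ)
    (hstat : IsStationaryProcess P) : ∃ L : ℝ, 0 ≤ L ∧ ∀ᵐ u, ρ 1 u ≤ L := by
  let E := EuclideanSpace ℝ (Fin d)
  let dens : E → ℝ≥0∞ := fun x => ENNReal.ofReal (ρ 1 fun _ => x)
  have hdens : Measurable dens :=
    ((hρ.measurable 1).comp (measurable_pi_iff.2 fun _ => measurable_id)).ennreal_ofReal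
  let ν : Measure E := volume.withDensity dens
  have hmp := volume_preserving_funUnique (Fin 1) E
  have hν : ∀ s, MeasurableSet s → ν s = ∫⁻ X : Config d, ((X.carrier ∩ s).encard : ℝ≥0∞) ∂P := by
    intro s hs
    have h1 := hρ.campbell 1 (fun u => s.indicator 1 (u 0))
      ((measurable_one.indicator hs).comp (measurable_pi_apply 0))
    have h2 : ∀ X : Config d, ∑' u : X.distinctTuples 1, s.indicator (1 : E → ℝ≥0∞) (u.1 0)
        = ((X.carrier ∩ s).encard : ℝ≥0∞) := by
      intro X
      rw [Config.tsum_distinctTuples_one X (s.indicator 1), ← Config.lintegral_count_restrict,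
        lintegral_indicator_one hs, Config.count_restrict_apply X hs]
    simp_rw [h2] at h1
    rw [h1, withDensity_apply _ hs, ← lintegral_indicator hs, ← hmp.lintegral_comp
      (hdens.indicator hs)]
    refine lintegral_congr fun u => ?_
    have hu : (fun _ => u 0) = u := by funext i; rw [Subsingleton.elim i 0]
    have hu' : MeasurableEquiv.funUnique (Fin 1) E u = u 0 := rfl
    rw [hu']
    by_cases h : u 0 ∈ s <;> simp [h, dens, hu]
  have hinv : ν.IsAddLeftInvariant := by
    refine ⟨fun v => ?_⟩
    ext s hs
    rw [Measure.map_apply (measurable_const_add v) hs, hν _ (measurable_const_add v hs), hν s hs]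
    conv_rhs => rw [← hstat v]
    have hm : Measurable fun X : Config d => ((X.carrier ∩ s).encard : ℝ≥0∞) :=
      measurable_from_top.comp (Config.measurable_encard hs)
    rw [lintegral_map hm (Config.measurable_translate v)]
    refine lintegral_congr fun X => ?_
    have : (Config.translate v X).carrier ∩ s
        = (fun x => x + v) '' (X.carrier ∩ (fun x => v + x) ⁻¹' s) := by
      simp_rw [add_comm v]
      rw [Set.image_inter_preimage]; rfl
    rw [this, (add_left_injective v).encard_image]
  have hball0 : volume (Metric.ball (0 : E) 1) ≠ 0 := (Metric.measure_ball_pos _ _ one_pos).ne'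
  have hball1 : volume (Metric.ball (0 : E) 1) ≠ ∞ := measure_ball_lt_top.ne
  -- The density is real valued, so `ν` is σ-finite even before its local finiteness is known; this
  -- is what the uniqueness of Haar measure and of densities requires.
  have : SigmaFinite ν := SigmaFinite.withDensity_ofReal _
  set c := ν (Metric.ball (0 : E) 1) / volume (Metric.ball (0 : E) 1)
  have hc : ν = c • volume := measure_eq_sub_vadd ν volume hball0 hball1
  have hae : dens =ᵐ[volume] fun _ => c := by
    rw [← withDensity_eq_iff_of_sigmaFinite hdens.aemeasurable aemeasurable_const, withDensity_const]
    exact hc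
  refine ⟨c.toReal, ENNReal.toReal_nonneg, ?_⟩
  have := hmp.quasiMeasurePreserving.ae hae
  filter_upwards [this] with u hu
  have hu1 : (fun _ => u 0) = u := by funext i; rw [Subsingleton.elim i 0]
  have hu2 : ENNReal.ofReal (ρ 1 u) = c := by
    rw [← hu]; simp only [dens]; rw [← hu1]; rfl
  rw [← hu2, ENNReal.toReal_ofReal (hρ.nonneg 1 u)]

/-- The hypothesis is specialized to the index sets `{0, …, l-1}` and its complement, with the
prefactor of `Φ` absorbed into the geometric constant. A lower bound `δ` for the distance is more
convenient than the exact distance. -/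
theorem ExpDecayCorrelations.split {a a' : ℝ} (ha' : 0 < a') (hEDC : ExpDecayCorrelations ρ a a') :
    ∃ C c : ℝ, 1 ≤ C ∧ 0 < c ∧ ∀ l m : ℕ, 1 ≤ l → 1 ≤ m →
      ∀ᵐ v : Fin (l + m) → EuclideanSpace ℝ (Fin d), ∀ δ : ℝ, 0 ≤ δ →
        (∀ i j, δ ≤ dist (v (Fin.castAdd m i)) (v (Fin.natAdd l j))) →
        |ρ (l + m) v - ρ l (fun i => v (Fin.castAdd m i)) * ρ m (fun j => v (Fin.natAdd l j))|
          ≤ C ^ (l + m) * ((l + m)! : ℝ) ^ a * Real.exp (-c * δ ^ a') := by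
  obtain ⟨Φ, C, ⟨hΦ0, C', c, hC', hc, hΦ⟩, hC, h⟩ := hEDC
  refine ⟨C * max C' 1, c, one_le_mul_of_one_le_of_one_le hC (le_max_right _ _), hc, ?_⟩
  intro l m hl hm
  filter_upwards [h (l + m)] with v hv δ hδ hd
  set I : Finset (Fin (l + m)) := Finset.univ.image (Fin.castAdd m)
  have hIc : Iᶜ = Finset.univ.image (Fin.natAdd l) := by
    ext i
    simp only [I, Finset.mem_compl, Finset.mem_image, Finset.mem_univ, true_and]
    refine Fin.addCases (fun j => ?_) (fun j => ?_) i
    · constructor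
      · intro h; exact (h ⟨j, rfl⟩).elim
      · rintro ⟨k, hk⟩
        have := congrArg Fin.val hk
        simp at this; omega
    · constructor
      · intro _; exact ⟨j, rfl⟩
      · rintro _ ⟨k, hk⟩
        have := congrArg Fin.val hk
        simp at this; omega
  have hIcard : I.card = l := by
    rw [Finset.card_image_of_injective _ (Fin.castAdd_injective l m)]; simp
  have hIccard : Iᶜ.card = m := by
    rw [hIc, Finset.card_image_of_injective _ (Fin.natAdd_injective m l)]; simp
  have hIn : I.Nonempty := Finset.card_pos.1 (by omega)
  have hIcn : Iᶜ.Nonempty := Finset.card_pos.1 (by omega)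
  have h1 := hv I hIn hIcn
  rw [subTuple_eq ρ v hIcard (f := Fin.castAdd m)
      (fun i => Finset.mem_image_of_mem _ (Finset.mem_univ i)) (Fin.strictMono_castAdd m),
    subTuple_eq ρ v hIccard (f := Fin.natAdd l)
      (fun i => hIc ▸ Finset.mem_image_of_mem _ (Finset.mem_univ i)) (Fin.strictMono_natAdd l)]
    at h1
  have hdist : δ ≤ clusterDist v I := by
    have : Nonempty ({i // i ∈ I} × {j // j ∈ Iᶜ}) :=
      ⟨⟨⟨_, hIn.choose_spec⟩, ⟨_, hIcn.choose_spec⟩⟩⟩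
    refine le_ciInf fun q => ?_
    obtain ⟨⟨i, hi⟩, ⟨j, hj⟩⟩ := q
    rw [hIc] at hj
    obtain ⟨i', _, rfl⟩ := Finset.mem_image.1 hi
    obtain ⟨j', _, rfl⟩ := Finset.mem_image.1 hj
    exact hd i' j'
  refine h1.trans ?_
  have h2 : Φ (clusterDist v I) ≤ C' * Real.exp (-c * δ ^ a') := by
    refine (hΦ _ (hδ.trans hdist)).trans ?_
    have := Real.rpow_le_rpow hδ hdist ha'.le
    gcongr ?_ * Real.exp ?_
    nlinarith
  have h3 : C' ≤ (max C' 1) ^ (l + m) :=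
    (le_max_left _ _).trans (le_self_pow₀ (le_max_right _ _) (by omega))
  calc C ^ (l + m) * ((l + m)! : ℝ) ^ a * Φ (clusterDist v I)
      ≤ C ^ (l + m) * ((l + m)! : ℝ) ^ a * ((max C' 1) ^ (l + m) * Real.exp (-c * δ ^ a')) := by
        gcongr
        exact h2.trans (by gcongr)
    _ = _ := by rw [mul_pow]; ring

/-- The correlation functions of a stationary process with exponential decay of correlations are
bounded. -/
theorem IsCorrelationFamily.exists_rho_le [IsProbabilityMeasure P] (hρ : IsCorrelationFamily P ρ)
    (hstat : IsStationaryProcess P) {a a' : ℝ} (ha : 0 ≤ a) (ha' : 0 < a')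
    (hEDC : ExpDecayCorrelations ρ a a') :
    ∃ C : ℝ, 1 ≤ C ∧ ∀ p : ℕ, ∀ᵐ u, ρ p u ≤ C ^ p * (p ! : ℝ) ^ a := by
  obtain ⟨L, hL0, hL⟩ := hρ.exists_rho_one_le hstat
  obtain ⟨C, c, hC, hc, h⟩ := hEDC.split ha'
  refine ⟨L + C, by linarith, fun p => ?_⟩
  induction p with
  | zero => exact ae_of_all _ fun u => by simp [hρ.rho_zero]
  | succ p ih =>
    rcases Nat.eq_zero_or_pos p with rfl | hp
    · filter_upwards [hL] with u hu
      refine hu.trans ?_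
      simp; linarith
    have hmp := measurePreserving_splitTuple (EuclideanSpace ℝ (Fin d)) p 1
    have h1 := hmp.quasiMeasurePreserving.ae (Measure.quasiMeasurePreserving_fst.ae ih)
    have h2 := hmp.quasiMeasurePreserving.ae (Measure.quasiMeasurePreserving_snd.ae hL)
    filter_upwards [h p 1 hp le_rfl, h1, h2] with v hv hv1 hv2
    -- With `δ = 0` decay of correlations only says that `ρ^(p+1)` and `ρ^(p) ρ^(1)` differ by at
    -- most `C^(p+1) (p+1)!^a`, which is enough for an induction on `p`.
    have h3 := (abs_le.1 (hv 0 le_rfl fun _ _ => dist_nonneg)).2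
    have h4 : (p ! : ℝ) ^ a ≤ ((p + 1)! : ℝ) ^ a :=
      Real.rpow_le_rpow (by positivity) (by exact_mod_cast Nat.factorial_le (Nat.le_succ p)) ha
    have h5 : ρ p (fun i => v (Fin.castAdd 1 i)) * ρ 1 (fun j => v (Fin.natAdd p j))
        ≤ (L + C) ^ p * ((p + 1)! : ℝ) ^ a * L := by
      refine mul_le_mul (hv1.trans ?_) hv2 (hρ.nonneg _ _) (by positivity)
      gcongr
    have h6 : C ^ (p + 1) * ((p + 1)! : ℝ) ^ a * Real.exp (-c * (0 : ℝ) ^ a')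
        ≤ (L + C) ^ p * C * ((p + 1)! : ℝ) ^ a := by
      rw [Real.zero_rpow ha'.ne', mul_zero, Real.exp_zero, mul_one, pow_succ]
      gcongr
      linarith
    calc ρ (p + 1) v ≤ (L + C) ^ p * ((p + 1)! : ℝ) ^ a * L
          + (L + C) ^ p * C * ((p + 1)! : ℝ) ^ a := by linarith
      _ = _ := by ring

end CorrelationBounds

/-! ### The series `∑ x^l / l!^(1-a)` -/

section FactorialSeries

/-- The terms `x^l / l!^{1-a}`. -/
noncomputable def factTerm (a x : ℝ) (l : ℕ) : ℝ := x ^ l * (l ! : ℝ) ^ (a - 1)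

theorem factTerm_nonneg {a x : ℝ} (hx : 0 ≤ x) (l : ℕ) : 0 ≤ factTerm a x l := by
  unfold factTerm; positivity

/-- With `y = (2 x)^(1/(1-a))` the term equals `2^(-l) (y^l / l!)^(1-a)`, and `y^l / l! ≤ exp y`.
This is where `a < 1` is needed and where the power `1/(1-a)` of the volume comes from. -/
theorem factTerm_le {a x : ℝ} (ha : a < 1) (hx : 0 ≤ x) (l : ℕ) :
    factTerm a x l ≤ (1 / 2) ^ l *
      Real.exp ((1 - a) * (2 ^ (1 / (1 - a)) * x ^ (1 / (1 - a)))) := by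
  have hθ : 0 < 1 - a := by linarith
  set y : ℝ := 2 ^ (1 / (1 - a)) * x ^ (1 / (1 - a)) with hy
  have hy0 : 0 ≤ y := by positivity
  have hy1 : y ^ (1 - a) = 2 * x := by
    rw [hy, Real.mul_rpow (by positivity) (by positivity), ← Real.rpow_mul (by norm_num),
      ← Real.rpow_mul hx, one_div, inv_mul_cancel₀ hθ.ne', Real.rpow_one, Real.rpow_one]
  have h1 : (y ^ l / l !) ^ (1 - a) ≤ Real.exp ((1 - a) * y) := by
    rw [mul_comm, Real.exp_mul]
    exact Real.rpow_le_rpow (by positivity) (Real.pow_div_factorial_le_exp y hy0 l) hθ.le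
  have h2 : (y ^ l / l !) ^ (1 - a) = (2 * x) ^ l * (l ! : ℝ) ^ (a - 1) := by
    rw [Real.div_rpow (by positivity) (by positivity), ← Real.rpow_natCast_mul hy0,
      mul_comm (l : ℝ), Real.rpow_mul_natCast hy0, hy1, div_eq_mul_inv,
      ← Real.rpow_neg (by positivity), neg_sub]
  rw [h2] at h1
  calc factTerm a x l = (1 / 2) ^ l * ((2 * x) ^ l * (l ! : ℝ) ^ (a - 1)) := by
        rw [factTerm, mul_pow, ← mul_assoc, ← mul_assoc, ← mul_pow]; norm_num
    _ ≤ _ := by gcongr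

theorem summable_factTerm {a x : ℝ} (ha : a < 1) (hx : 0 ≤ x) : Summable (factTerm a x) :=
  Summable.of_nonneg_of_le (factTerm_nonneg hx) (factTerm_le ha hx)
    (summable_geometric_two.mul_right _)

theorem tsum_factTerm_le {a x : ℝ} (ha : a < 1) (hx : 0 ≤ x) :
    ∑' l, factTerm a x l
      ≤ 2 * Real.exp ((1 - a) * (2 ^ (1 / (1 - a)) * x ^ (1 / (1 - a)))) := by
  refine ((summable_factTerm ha hx).tsum_le_tsum (factTerm_le ha hx)
    (summable_geometric_two.mul_right _)).trans_eq ?_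
  rw [tsum_mul_right, tsum_geometric_two]

theorem factorial_add_rpow_le {a : ℝ} (ha : 0 ≤ a) (ha1 : a ≤ 1) (l m : ℕ) :
    ((l + m)! : ℝ) ^ a ≤ 2 ^ (l + m) * ((l ! : ℝ) ^ a * (m ! : ℝ) ^ a) := by
  have h1 : ((l + m)! : ℝ) ≤ 2 ^ (l + m) * (l ! * m !) := by
    have := Nat.add_choose_mul_factorial_mul_factorial l m
    have h2 : (l + m).choose m ≤ 2 ^ (l + m) := Nat.choose_le_two_pow _ _
    have h3 : ((l + m).choose m : ℝ) ≤ 2 ^ (l + m) := by exact_mod_cast h2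
    rw [← this]
    push_cast
    rw [mul_assoc]
    gcongr
  refine (Real.rpow_le_rpow (by positivity) h1 ha).trans ?_
  rw [Real.mul_rpow (by positivity) (by positivity), Real.mul_rpow (by positivity) (by positivity)]
  gcongr
  have h4 : (1 : ℝ) ≤ 2 ^ (l + m) := one_le_pow₀ (by norm_num)
  exact Real.rpow_le_self_of_one_le h4 ha1

end FactorialSeries

/-! ### Expectations of local functionals -/

section Covariance

variable {d : ℕ} {P : Measure (Config d)} {ρ : (p : ℕ) → (Fin p → EuclideanSpace ℝ (Fin d)) → ℝ}

theorem volume_forall_mem (A : Set (EuclideanSpace ℝ (Fin d))) (p : ℕ) :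
    volume {u : Fin p → EuclideanSpace ℝ (Fin d) | ∀ i, u i ∈ A} = volume A ^ p := by
  have : {u : Fin p → EuclideanSpace ℝ (Fin d) | ∀ i, u i ∈ A} = Set.univ.pi fun _ => A := by
    ext; simp
  rw [this, volume_pi_pi]
  simp

/-- Integration of a bounded function against a bounded density. -/
theorem setIntegral_mul_density_le {α : Type*} [MeasurableSpace α] {μ : Measure α} {S : Set α}
    (hS : MeasurableSet S) {v : ℝ} (hv : 0 ≤ v) (hvol : μ S ≤ ENNReal.ofReal v) {g r : α → ℝ}
    (hg : Measurable g) (hr : Measurable r) {M R : ℝ} (hM : 0 ≤ M) (hR : 0 ≤ R)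
    (hgM : ∀ x, |g x| ≤ M) (hrR : ∀ᵐ x ∂μ, x ∈ S → |r x| ≤ R) :
    IntegrableOn (fun x => g x * r x) S μ ∧ |∫ x in S, g x * r x ∂μ| ≤ v * (M * R) := by
  have hfin : μ S < ∞ := hvol.trans_lt ENNReal.ofReal_lt_top
  have hb : ∀ᵐ x ∂(μ.restrict S), ‖g x * r x‖ ≤ M * R := by
    rw [ae_restrict_iff' hS]
    filter_upwards [hrR] with x hx hxS
    rw [norm_mul]
    exact mul_le_mul (hgM x) (hx hxS) (abs_nonneg _) hM
  refine ⟨Measure.integrableOn_of_bounded hfin.ne (hg.mul hr).aestronglyMeasurable hb, ?_⟩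
  rw [ae_restrict_iff' hS] at hb
  refine (norm_setIntegral_le_of_norm_le_const_ae' hfin hb).trans ?_
  rw [mul_comm]
  gcongr
  exact ENNReal.toReal_le_of_le_ofReal hv hvol

/-- Uniform bounds on the correlation functions: `ρ^{(p)} ≤ C^p p!^a`, and decay of correlations
between the two parts of a tuple. -/
structure CorrelationBound (ρ : (p : ℕ) → (Fin p → EuclideanSpace ℝ (Fin d)) → ℝ)
    (a a' C c : ℝ) : Prop where
  one_le : 1 ≤ C
  pos : 0 < c
  zero : ∀ u, ρ 0 u = 1
  le : ∀ p : ℕ, ∀ᵐ u, ρ p u ≤ C ^ p * (p ! : ℝ) ^ a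
  split : ∀ l m : ℕ, 1 ≤ l → 1 ≤ m →
    ∀ᵐ v : Fin (l + m) → EuclideanSpace ℝ (Fin d), ∀ δ : ℝ, 0 ≤ δ →
      (∀ i j, δ ≤ dist (v (Fin.castAdd m i)) (v (Fin.natAdd l j))) →
      |ρ (l + m) v - ρ l (fun i => v (Fin.castAdd m i)) * ρ m (fun j => v (Fin.natAdd l j))|
        ≤ C ^ (l + m) * ((l + m)! : ℝ) ^ a * Real.exp (-c * δ ^ a')

theorem IsCorrelationFamily.exists_correlationBound [IsProbabilityMeasure P]
    (hρ : IsCorrelationFamily P ρ) (hstat : IsStationaryProcess P) {a a' : ℝ} (ha : 0 ≤ a)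
    (ha' : 0 < a') (hEDC : ExpDecayCorrelations ρ a a') :
    ∃ C c, CorrelationBound ρ a a' C c := by
  obtain ⟨C₁, h1, hle⟩ := hρ.exists_rho_le hstat ha ha' hEDC
  obtain ⟨C₂, c, h2, hc, hs⟩ := hEDC.split ha'
  have h0 : 0 ≤ C₁ ∧ 0 ≤ C₂ := ⟨by linarith, by linarith⟩
  refine ⟨max C₁ C₂, c, h1.trans (le_max_left _ _), hc, hρ.rho_zero, fun p => ?_,
    fun l m hl hm => ?_⟩
  · filter_upwards [hle p] with u hu
    refine hu.trans ?_
    have := h0.1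
    gcongr
    exact le_max_left _ _
  · filter_upwards [hs l m hl hm] with v hv δ hδ hd
    refine (hv δ hδ hd).trans ?_
    have := h0.2
    gcongr
    exact le_max_right _ _

namespace Config

/-- A functional that depends on the points in `A` only, and grows at most exponentially in their
number. -/
structure IsLocal (F : Config d → ℝ) (A : Set (EuclideanSpace ℝ (Fin d))) (K : ℝ) : Prop where
  measurable : Measurable F
  bounded : Bornology.IsBounded A
  measurableSet : MeasurableSet A
  nonneg : 0 ≤ K
  restrict : ∀ X, F (X.restrict A) = F X
  abs_le : ∀ X, |F X| ≤ K * Real.exp (X.pts A).card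

variable {F : Config d → ℝ} {A : Set (EuclideanSpace ℝ (Fin d))} {K : ℝ}

theorem IsLocal.abs_altSum_le (hF : IsLocal F A K) (q : ℕ)
    (u : Fin q → EuclideanSpace ℝ (Fin d)) :
    |altSum F q u| ≤ K * (2 * Real.exp 1) ^ q := by
  refine (Config.abs_altSum_le (M := K * Real.exp q) fun S hS => ?_).trans_eq ?_
  · refine (hF.abs_le _).trans ?_
    have := hF.nonneg
    gcongr
    refine (Finset.card_le_card fun x hx => ?_).trans hS
    exact ((mem_pts hF.bounded).1 hx).1
  · rw [mul_pow, ← Real.exp_nat_mul, mul_one]; ring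

/-- The terms in the factorial moment expansion of a local functional. -/
noncomputable def expansionTerm (F : Config d → ℝ) (A : Set (EuclideanSpace ℝ (Fin d))) (q : ℕ)
    (X : Config d) : ℝ := (q ! : ℝ)⁻¹ * ∑ u ∈ X.tuples A q, altSum F q u

/-- Their expectations. -/
noncomputable def expectedTerm (ρ : (p : ℕ) → (Fin p → EuclideanSpace ℝ (Fin d)) → ℝ)
    (F : Config d → ℝ) (A : Set (EuclideanSpace ℝ (Fin d))) (q : ℕ) : ℝ :=
  (q ! : ℝ)⁻¹ * ∫ u in {u | ∀ i, u i ∈ A}, altSum F q u * ρ q u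

/-- The argument of `factTerm` collects `2 e` from the alternating sums, `C` from the bound on `ρ`
and `V` from the volume. A further factor `2`, not needed here, makes the same series serve for
pairs of terms in `covariance_le`. -/
theorem expansionTerm_facts (hρ : IsCorrelationFamily P ρ) {a a' C c : ℝ}
    (hb : CorrelationBound ρ a a' C c) (hF : IsLocal F A K) {V : ℝ} (hV : 0 ≤ V)
    (hvol : volume A ≤ ENNReal.ofReal V) (q : ℕ) :
    Integrable (expansionTerm F A q) P ∧
    ∫ X, expansionTerm F A q X ∂P = expectedTerm ρ F A q ∧
    ∫ X, |expansionTerm F A q X| ∂P ≤ K * factTerm a (4 * Real.exp 1 * C * V) q := by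
  have hC := hb.one_le
  have hK := hF.nonneg
  have hmS := measurableSet_forall_mem hF.measurableSet q
  have hvol' : volume {u : Fin q → EuclideanSpace ℝ (Fin d) | ∀ i, u i ∈ A}
      ≤ ENNReal.ofReal (V ^ q) := by
    rw [volume_forall_mem, ENNReal.ofReal_pow hV]
    gcongr
  have hr : ∀ᵐ u, u ∈ {u : Fin q → EuclideanSpace ℝ (Fin d) | ∀ i, u i ∈ A} →
      |ρ q u| ≤ C ^ q * (q ! : ℝ) ^ a := by
    filter_upwards [hb.le q] with u hu _
    rwa [abs_of_nonneg (hρ.nonneg q u)]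
  have h1 := setIntegral_mul_density_le hmS (by positivity) hvol'
    (measurable_altSum hF.measurable q) (hρ.measurable q) (M := K * (2 * Real.exp 1) ^ q)
    (by positivity) (by positivity) (hF.abs_altSum_le q) hr
  have h2 := setIntegral_mul_density_le hmS (by positivity) hvol'
    (measurable_altSum hF.measurable q).abs (hρ.measurable q) (M := K * (2 * Real.exp 1) ^ q)
    (by positivity) (by positivity) (fun u => by rw [abs_abs]; exact hF.abs_altSum_le q u) hr
  obtain ⟨c1, c2, c3⟩ := hρ.integral_sum_tuples hF.bounded hF.measurableSet
    (measurable_altSum hF.measurable q) h1.1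
  refine ⟨c1.const_mul _, ?_, ?_⟩
  · simp only [expansionTerm, expectedTerm]
    rw [integral_const_mul, c2]
  · simp only [expansionTerm]
    simp_rw [abs_mul, abs_inv, Nat.abs_cast]
    rw [integral_const_mul]
    calc (q ! : ℝ)⁻¹ * ∫ X, |∑ u ∈ X.tuples A q, altSum F q u| ∂P
        ≤ (q ! : ℝ)⁻¹ * (V ^ q * (K * (2 * Real.exp 1) ^ q * (C ^ q * (q ! : ℝ) ^ a))) := by
          gcongr
          exact c3.trans ((le_abs_self _).trans h2.2)
      _ = K * factTerm a (2 * Real.exp 1 * C * V) q := by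
          rw [factTerm, Real.rpow_sub_one (by positivity), mul_pow, mul_pow, mul_pow]
          field_simp
          ring
      _ ≤ _ := by
          unfold factTerm
          gcongr
          norm_num

/-- The expansion converges in `L¹`: its terms are dominated by `K` times those of the convergent
series above, so that expectation and summation may be exchanged. -/
theorem IsLocal.integrable (hρ : IsCorrelationFamily P ρ) {a a' C c : ℝ} (ha : a < 1)
    (hb : CorrelationBound ρ a a' C c) (hF : IsLocal F A K) {V : ℝ} (hV : 0 ≤ V)
    (hvol : volume A ≤ ENNReal.ofReal V) :
    Integrable F P ∧ HasSum (expectedTerm ρ F A) (∫ X, F X ∂P) ∧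
      ∫ X, |F X| ∂P ≤ K * ∑' l, factTerm a (4 * Real.exp 1 * C * V) l := by
  have hC := hb.one_le
  have hx : 0 ≤ 4 * Real.exp 1 * C * V := by positivity
  have h := expansionTerm_facts hρ hb hF hV hvol
  have hs : Summable fun q => ∫ X, |expansionTerm F A q X| ∂P :=
    Summable.of_nonneg_of_le (fun q => integral_nonneg fun X => abs_nonneg _) (fun q => (h q).2.2)
      ((summable_factTerm ha hx).mul_left K)
  have hsum : ∀ X, HasSum (fun q => expansionTerm F A q X) (F X) :=
    hasSum_altSum hF.bounded hF.restrict
  have h1 : ∫⁻ X, ‖F X‖ₑ ∂P ≤ ENNReal.ofReal (K * ∑' l, factTerm a (4 * Real.exp 1 * C * V) l) := by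
    calc ∫⁻ X, ‖F X‖ₑ ∂P ≤ ∫⁻ X, ∑' q, ‖expansionTerm F A q X‖ₑ ∂P := by
          refine lintegral_mono fun X => ?_
          rw [← (hsum X).tsum_eq]
          exact enorm_tsum_le_tsum_enorm
      _ = ∑' q, ∫⁻ X, ‖expansionTerm F A q X‖ₑ ∂P :=
          lintegral_tsum fun q => (h q).1.aestronglyMeasurable.enorm
      _ ≤ ∑' q, ENNReal.ofReal (K * factTerm a (4 * Real.exp 1 * C * V) q) := by
          refine ENNReal.tsum_le_tsum fun q => ?_
          rw [← ofReal_integral_norm_eq_lintegral_enorm (h q).1]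
          exact ENNReal.ofReal_le_ofReal (h q).2.2
      _ = _ := by
          rw [← tsum_mul_left, ENNReal.ofReal_tsum_of_nonneg
            (fun q => mul_nonneg hF.nonneg (factTerm_nonneg hx q))
            ((summable_factTerm ha hx).mul_left K)]
  have hi : Integrable F P :=
    ⟨hF.measurable.aestronglyMeasurable, h1.trans_lt ENNReal.ofReal_lt_top⟩
  refine ⟨hi, ?_, ?_⟩
  · have := hasSum_integral_of_summable_integral_norm (fun q => (h q).1) hs
    simp_rw [fun X => (hsum X).tsum_eq, fun q => (h q).2.1] at this
    exact this
  · refine (ENNReal.ofReal_le_ofReal_iff (mul_nonneg hF.nonneg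
      (tsum_nonneg (factTerm_nonneg hx)))).1 ?_
    refine le_trans (le_of_eq ?_) h1
    exact ofReal_integral_norm_eq_lintegral_enorm hi

end Config

end Covariance

/-! ### Covariances of functionals of separated regions -/

section Covariance

variable {d : ℕ} {P : Measure (Config d)} {ρ : (p : ℕ) → (Fin p → EuclideanSpace ℝ (Fin d)) → ℝ}

/-- The pairs of tuples in `A` and in `B`, as tuples. -/
def splitSet (A B : Set (EuclideanSpace ℝ (Fin d))) (l m : ℕ) :
    Set (Fin (l + m) → EuclideanSpace ℝ (Fin d)) :=
  {v | (∀ i, v (Fin.castAdd m i) ∈ A) ∧ ∀ j, v (Fin.natAdd l j) ∈ B}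

theorem splitSet_eq_preimage (A B : Set (EuclideanSpace ℝ (Fin d))) (l m : ℕ) :
    splitSet A B l m = (fun v : Fin (l + m) → EuclideanSpace ℝ (Fin d) =>
      ((fun i => v (Fin.castAdd m i), fun j => v (Fin.natAdd l j)) :
        (Fin l → EuclideanSpace ℝ (Fin d)) × (Fin m → EuclideanSpace ℝ (Fin d)))) ⁻¹'
      ({u | ∀ i, u i ∈ A} ×ˢ {u | ∀ i, u i ∈ B}) := rfl

theorem measurableSet_splitSet {A B : Set (EuclideanSpace ℝ (Fin d))} (hA : MeasurableSet A)
    (hB : MeasurableSet B) (l m : ℕ) : MeasurableSet (splitSet A B l m) := by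
  rw [splitSet_eq_preimage]
  exact (measurePreserving_splitTuple _ l m).measurable
    ((measurableSet_forall_mem hA l).prod (measurableSet_forall_mem hB m))

theorem volume_splitSet_le {A B : Set (EuclideanSpace ℝ (Fin d))} (hA : MeasurableSet A)
    (hB : MeasurableSet B) (l m : ℕ) {V : ℝ} (hV : 0 ≤ V) (hVA : volume A ≤ ENNReal.ofReal V)
    (hVB : volume B ≤ ENNReal.ofReal V) :
    volume (splitSet A B l m) ≤ ENNReal.ofReal (V ^ (l + m)) := by
  rw [splitSet_eq_preimage, (measurePreserving_splitTuple _ l m).measure_preimage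
    ((measurableSet_forall_mem hA l).prod (measurableSet_forall_mem hB m)).nullMeasurableSet,
    Measure.volume_eq_prod, Measure.prod_prod, volume_forall_mem, volume_forall_mem, pow_add,
    ENNReal.ofReal_mul (by positivity), ENNReal.ofReal_pow hV, ENNReal.ofReal_pow hV]
  gcongr

theorem setIntegral_splitSet {A B : Set (EuclideanSpace ℝ (Fin d))} (hA : MeasurableSet A)
    (hB : MeasurableSet B) (l m : ℕ) {g : (Fin l → EuclideanSpace ℝ (Fin d)) → ℝ}
    {h : (Fin m → EuclideanSpace ℝ (Fin d)) → ℝ} (hg : Measurable g) (hh : Measurable h) :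
    ∫ v in splitSet A B l m, g (fun i => v (Fin.castAdd m i)) * h (fun j => v (Fin.natAdd l j))
      = (∫ u in {u | ∀ i, u i ∈ A}, g u) * ∫ u in {u | ∀ i, u i ∈ B}, h u := by
  have hmp := measurePreserving_splitTuple (EuclideanSpace ℝ (Fin d)) l m
  have hm := (measurableSet_forall_mem hA l).prod (measurableSet_forall_mem hB m)
  rw [← setIntegral_prod_mul, ← Measure.volume_eq_prod, ← hmp.map_eq,
    setIntegral_map hm _ hmp.measurable.aemeasurable, splitSet_eq_preimage]
  exact ((hg.comp measurable_fst).mul (hh.comp measurable_snd)).aestronglyMeasurable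

namespace Config

-- Disjointness of `A` and `B` ensures that joining two tuples of distinct points gives again a
-- tuple of distinct points, so a product of two expansions is an expansion in a single process of
-- tuples.
open Classical in
theorem sum_tuples_mul_sum_tuples (X : Config d) {A B : Set (EuclideanSpace ℝ (Fin d))}
    (hA : Bornology.IsBounded A) (hB : Bornology.IsBounded B) (hAB : Disjoint A B) (l m : ℕ)
    (g : (Fin l → EuclideanSpace ℝ (Fin d)) → ℝ) (h : (Fin m → EuclideanSpace ℝ (Fin d)) → ℝ) :
    (∑ u ∈ X.tuples A l, g u) * ∑ w ∈ X.tuples B m, h w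
      = ∑ v ∈ X.tuples (A ∪ B) (l + m), (splitSet A B l m).indicator
        (fun v => g (fun i => v (Fin.castAdd m i)) * h (fun j => v (Fin.natAdd l j))) v := by
  simp_rw [Set.indicator_apply]
  rw [Finset.sum_mul_sum, ← Finset.sum_product', ← Finset.sum_filter]
  refine Finset.sum_nbij' (fun q => Fin.append q.1 q.2)
    (fun v => (fun i => v (Fin.castAdd m i), fun j => v (Fin.natAdd l j))) ?_ ?_ ?_ ?_ ?_
  · rintro ⟨u, w⟩ huw
    rw [Finset.mem_product, mem_tuples hA, mem_tuples hB] at huw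
    obtain ⟨⟨⟨hu1, hu2⟩, hu3⟩, ⟨hw1, hw2⟩, hw3⟩ := huw
    rw [Finset.mem_filter, mem_tuples (hA.union hB)]
    refine ⟨⟨⟨?_, ?_⟩, ?_⟩, ?_⟩
    · rw [Fin.append_injective_iff]
      exact ⟨hu1, hw1, fun i j hij => Set.disjoint_left.1 hAB (hu3 i) (hij ▸ hw3 j)⟩
    · exact Fin.addCases (by simpa using hu2) (by simpa using hw2)
    · exact Fin.addCases (fun i => by simpa using Or.inl (hu3 i))
        (fun j => by simpa using Or.inr (hw3 j))
    · exact ⟨by simpa using hu3, by simpa using hw3⟩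
  · intro v hv
    rw [Finset.mem_filter, mem_tuples (hA.union hB)] at hv
    obtain ⟨⟨⟨hv1, hv2⟩, hv3⟩, hv4, hv5⟩ := hv
    rw [Finset.mem_product, mem_tuples hA, mem_tuples hB]
    exact ⟨⟨⟨hv1.comp (Fin.castAdd_injective l m), fun i => hv2 _⟩, hv4⟩,
      ⟨hv1.comp (Fin.natAdd_injective m l), fun i => hv2 _⟩, hv5⟩
  · rintro ⟨u, w⟩ _
    simp
  · intro v _
    exact Fin.append_castAdd_natAdd
  · rintro ⟨u, w⟩ _
    simp

variable {F G : Config d → ℝ} {A B : Set (EuclideanSpace ℝ (Fin d))} {K L : ℝ}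

/-- The factor `2^(l+m)` from `(l+m)!^a ≤ 2^(l+m) l!^a m!^a` decouples `l` and `m` and accounts for
`4 e` in place of `2 e`. -/
theorem pair_bound {a C V : ℝ} (ha : 0 ≤ a) (ha1 : a ≤ 1) (hC : 0 ≤ C) (hV : 0 ≤ V) (hK : 0 ≤ K)
    (hL : 0 ≤ L) (l m : ℕ) :
    (l ! : ℝ)⁻¹ * (m ! : ℝ)⁻¹ * (V ^ (l + m) * (K * (2 * Real.exp 1) ^ l
      * (L * (2 * Real.exp 1) ^ m) * (C ^ (l + m) * ((l + m)! : ℝ) ^ a)))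
      ≤ K * L * (factTerm a (4 * Real.exp 1 * C * V) l * factTerm a (4 * Real.exp 1 * C * V) m) := by
  calc _ ≤ (l ! : ℝ)⁻¹ * (m ! : ℝ)⁻¹ * (V ^ (l + m) * (K * (2 * Real.exp 1) ^ l
      * (L * (2 * Real.exp 1) ^ m) * (C ^ (l + m) * (2 ^ (l + m) *
        ((l ! : ℝ) ^ a * (m ! : ℝ) ^ a))))) := by
        gcongr
        exact factorial_add_rpow_le ha ha1 l m
    _ = _ := by
        rw [factTerm, factTerm, Real.rpow_sub_one (by positivity),
          Real.rpow_sub_one (by positivity), show (4 : ℝ) = 2 * 2 by norm_num]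
        simp only [mul_pow, pow_add]
        field_simp

/-- The decay hypothesis concerns nonempty groups only; for an empty group the difference is zero
because `ρ 0 = 1`. -/
theorem rho_split_le {a a' C c : ℝ} (hb : CorrelationBound ρ a a' C c) {δ : ℝ}
    (hδ : 0 ≤ δ) (hdist : ∀ x ∈ A, ∀ y ∈ B, δ ≤ dist x y) (l m : ℕ) :
    ∀ᵐ v : Fin (l + m) → EuclideanSpace ℝ (Fin d), v ∈ splitSet A B l m →
      |ρ (l + m) v - ρ l (fun i => v (Fin.castAdd m i)) * ρ m (fun j => v (Fin.natAdd l j))|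
        ≤ C ^ (l + m) * ((l + m)! : ℝ) ^ a * Real.exp (-c * δ ^ a') := by
  have hC := hb.one_le
  have hcast : ∀ {p q : ℕ} (h : p = q) (v : Fin q → EuclideanSpace ℝ (Fin d)),
      ρ p (fun i => v (Fin.cast h i)) = ρ q v := by
    rintro p q rfl v; rfl
  rcases Nat.eq_zero_or_pos l with rfl | hl
  · refine ae_of_all _ fun v _ => ?_
    have h1 := hcast (Nat.zero_add m).symm v
    have h2 : (fun j : Fin m => v (Fin.natAdd 0 j)) = fun j => v (Fin.cast (Nat.zero_add m).symm j) := by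
      funext j; congr 1; ext; simp
    rw [hb.zero, h2, h1, one_mul, sub_self, abs_zero]
    positivity
  rcases Nat.eq_zero_or_pos m with rfl | hm
  · refine ae_of_all _ fun v _ => ?_
    have h2 : ρ (l + 0) v = ρ l (fun i => v (Fin.castAdd 0 i)) := rfl
    rw [hb.zero, h2, mul_one, sub_self, abs_zero]
    positivity
  filter_upwards [hb.split l m hl hm] with v hv hvS
  exact hv δ hδ fun i j => hdist _ (hvS.1 i) _ (hvS.2 j)

/-- Functionals of separated regions are almost uncorrelated. -/
theorem covariance_le (hρ : IsCorrelationFamily P ρ) {a a' C c : ℝ} (ha : 0 ≤ a) (ha1 : a < 1)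
    (hb : CorrelationBound ρ a a' C c) (hF : IsLocal F A K) (hG : IsLocal G B L)
    (hAB : Disjoint A B) {V : ℝ} (hV : 0 ≤ V) (hVA : volume A ≤ ENNReal.ofReal V)
    (hVB : volume B ≤ ENNReal.ofReal V) {δ : ℝ} (hδ : 0 ≤ δ)
    (hdist : ∀ x ∈ A, ∀ y ∈ B, δ ≤ dist x y) :
    |∫ X, F X * G X ∂P - (∫ X, F X ∂P) * ∫ X, G X ∂P| ≤
      K * L * (∑' l, factTerm a (4 * Real.exp 1 * C * V) l) ^ 2 * Real.exp (-c * δ ^ a') := by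
  have hC := hb.one_le
  have hC0 : 0 ≤ C := zero_le_one.trans hC
  have hK := hF.nonneg
  have hL := hG.nonneg
  set x := 4 * Real.exp 1 * C * V with hx_def
  have hx : 0 ≤ x := by positivity
  have hS := measurableSet_splitSet hF.measurableSet hG.measurableSet
  have hvol := fun l m => volume_splitSet_le hF.measurableSet hG.measurableSet l m hV hVA hVB
  let gh : (l m : ℕ) → (Fin (l + m) → EuclideanSpace ℝ (Fin d)) → ℝ := fun l m v =>
    altSum F l (fun i => v (Fin.castAdd m i)) * altSum G m (fun j => v (Fin.natAdd l j))
  have hcast : ∀ l m, Measurable fun v : Fin (l + m) → EuclideanSpace ℝ (Fin d) =>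
      fun i => v (Fin.castAdd m i) := fun l m =>
    measurable_pi_iff.2 fun i => measurable_pi_apply _
  have hnat : ∀ l m, Measurable fun v : Fin (l + m) → EuclideanSpace ℝ (Fin d) =>
      fun j => v (Fin.natAdd l j) := fun l m =>
    measurable_pi_iff.2 fun i => measurable_pi_apply _
  have hgh : ∀ l m, Measurable (gh l m) := fun l m =>
    ((measurable_altSum hF.measurable l).comp (hcast l m)).mul
      ((measurable_altSum hG.measurable m).comp (hnat l m))
  have hghb : ∀ l m v, |gh l m v| ≤ K * (2 * Real.exp 1) ^ l * (L * (2 * Real.exp 1) ^ m) := by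
    intro l m v
    rw [abs_mul]
    exact mul_le_mul (hF.abs_altSum_le _ _) (hG.abs_altSum_le _ _) (abs_nonneg _) (by positivity)
  have hρb : ∀ l m, ∀ᵐ v, v ∈ splitSet A B l m →
      |ρ (l + m) v| ≤ C ^ (l + m) * ((l + m)! : ℝ) ^ a := by
    intro l m
    filter_upwards [hb.le (l + m)] with v hv _
    rwa [abs_of_nonneg (hρ.nonneg _ v)]
  have b1 := fun l m => setIntegral_mul_density_le (hS l m) (by positivity) (hvol l m)
    (hgh l m) (hρ.measurable (l + m)) (by positivity) (by positivity) (hghb l m) (hρb l m)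
  have b2 := fun l m => setIntegral_mul_density_le (hS l m) (by positivity) (hvol l m)
    (hgh l m).abs (hρ.measurable (l + m))
    (M := K * (2 * Real.exp 1) ^ l * (L * (2 * Real.exp 1) ^ m)) (by positivity) (by positivity)
    (fun v => by rw [abs_abs]; exact hghb l m v) (hρb l m)
  have b3 := fun l m => setIntegral_mul_density_le (hS l m) (by positivity) (hvol l m)
    (hgh l m) ((hρ.measurable (l + m)).sub (((hρ.measurable l).comp (hcast l m)).mul
      ((hρ.measurable m).comp (hnat l m)))) (by positivity) (by positivity) (hghb l m)
    (rho_split_le hb hδ hdist l m)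
  have hsub : ∀ l m, {v : Fin (l + m) → EuclideanSpace ℝ (Fin d) | ∀ i, v i ∈ A ∪ B}
      ∩ splitSet A B l m = splitSet A B l m := by
    intro l m
    refine Set.inter_eq_right.2 fun v hv => ?_
    exact Fin.addCases (fun i => Or.inl (hv.1 i)) (fun j => Or.inr (hv.2 j))
  have hind : ∀ l m (k : (Fin (l + m) → EuclideanSpace ℝ (Fin d)) → ℝ),
      (fun v => (splitSet A B l m).indicator k v * ρ (l + m) v)
        = (splitSet A B l m).indicator fun v => k v * ρ (l + m) v := by
    intro l m k
    funext v
    by_cases h : v ∈ splitSet A B l m <;> simp [h]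
  have hT : ∀ q : ℕ × ℕ,
      Integrable (fun X => expansionTerm F A q.1 X * expansionTerm G B q.2 X) P ∧
      ∫ X, expansionTerm F A q.1 X * expansionTerm G B q.2 X ∂P
        = (q.1 ! : ℝ)⁻¹ * (q.2 ! : ℝ)⁻¹ *
          ∫ v in splitSet A B q.1 q.2, gh q.1 q.2 v * ρ (q.1 + q.2) v ∧
      ∫ X, |expansionTerm F A q.1 X * expansionTerm G B q.2 X| ∂P
        ≤ K * L * (factTerm a x q.1 * factTerm a x q.2) := by
    rintro ⟨l, m⟩
    have e : ∀ X, expansionTerm F A l X * expansionTerm G B m X = (l ! : ℝ)⁻¹ * (m ! : ℝ)⁻¹ *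
        ∑ v ∈ X.tuples (A ∪ B) (l + m), (splitSet A B l m).indicator (gh l m) v := by
      intro X
      rw [expansionTerm, expansionTerm, mul_mul_mul_comm,
        sum_tuples_mul_sum_tuples X hF.bounded hG.bounded hAB]
    obtain ⟨c1, c2, c3⟩ := hρ.integral_sum_tuples (hF.bounded.union hG.bounded)
      (hF.measurableSet.union hG.measurableSet) ((hgh l m).indicator (hS l m)) (by
        rw [hind]
        exact ((integrable_indicator_iff (hS l m)).2 (b1 l m).1).integrableOn)
    rw [hind, setIntegral_indicator (hS l m), hsub] at c2
    simp_rw [e, abs_mul, abs_inv, Nat.abs_cast]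
    rw [integral_const_mul, integral_const_mul, c2]
    refine ⟨c1.const_mul _, rfl, le_trans ?_ (pair_bound ha ha1.le hC0 hV hK hL l m)⟩
    gcongr
    have e2 : (fun v => |(splitSet A B l m).indicator (gh l m) v|)
        = (splitSet A B l m).indicator fun v => |gh l m v| := by
      funext v
      by_cases h : v ∈ splitSet A B l m <;> simp [h]
    have e3 := hind l m fun v => |gh l m v|
    rw [← e2] at e3
    rw [e3, setIntegral_indicator (hS l m), hsub] at c3
    exact c3.trans ((le_abs_self _).trans (b2 l m).2)
  have hsw := summable_factTerm ha1 hx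
  have hsw2 : Summable fun q : ℕ × ℕ => factTerm a x q.1 * factTerm a x q.2 :=
    hsw.mul_of_nonneg hsw (factTerm_nonneg hx) (factTerm_nonneg hx)
  have hs : Summable fun q : ℕ × ℕ =>
      ∫ X, |expansionTerm F A q.1 X * expansionTerm G B q.2 X| ∂P :=
    Summable.of_nonneg_of_le (fun q => integral_nonneg fun X => abs_nonneg _)
      (fun q => (hT q).2.2) (hsw2.mul_left _)
  have hprod : ∀ X, ∑' q : ℕ × ℕ, expansionTerm F A q.1 X * expansionTerm G B q.2 X
      = F X * G X := by
    intro X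
    have h1 := hasSum_altSum hF.bounded hF.restrict X
    have h2 := hasSum_altSum hG.bounded hG.restrict X
    rw [← h1.tsum_eq, ← h2.tsum_eq]
    exact (tsum_mul_tsum_of_summable_norm h1.summable.norm h2.summable.norm).symm
  have h1 := hasSum_integral_of_summable_integral_norm (fun q => (hT q).1) hs
  simp_rw [hprod] at h1
  obtain ⟨_, hF2, _⟩ := hF.integrable hρ ha1 hb hV hVA
  obtain ⟨_, hG2, _⟩ := hG.integrable hρ ha1 hb hV hVB
  have h2 : HasSum (fun q : ℕ × ℕ => expectedTerm ρ F A q.1 * expectedTerm ρ G B q.2)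
      ((∫ X, F X ∂P) * ∫ X, G X ∂P) :=
    hF2.mul hG2 (summable_mul_of_summable_norm hF2.summable.norm hG2.summable.norm)
  have h3 := h1.sub h2
  rw [← h3.tsum_eq]
  -- Comparing the two double series term by term leaves an integral against `ρ^(l+m) - ρ^(l)
  -- ρ^(m)`, where every pair of tuples has distance at least `δ`.
  have h4 : ∀ q : ℕ × ℕ, ‖∫ X, expansionTerm F A q.1 X * expansionTerm G B q.2 X ∂P
      - expectedTerm ρ F A q.1 * expectedTerm ρ G B q.2‖
      ≤ K * L * Real.exp (-c * δ ^ a') * (factTerm a x q.1 * factTerm a x q.2) := by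
    rintro ⟨l, m⟩
    have e1 : expectedTerm ρ F A l * expectedTerm ρ G B m = (l ! : ℝ)⁻¹ * (m ! : ℝ)⁻¹ *
        ∫ v in splitSet A B l m, gh l m v * (ρ l (fun i => v (Fin.castAdd m i))
          * ρ m (fun j => v (Fin.natAdd l j))) := by
      rw [expectedTerm, expectedTerm, mul_mul_mul_comm,
        ← setIntegral_splitSet hF.measurableSet hG.measurableSet l m
          (g := fun u => altSum F l u * ρ l u) (h := fun u => altSum G m u * ρ m u)
          ((measurable_altSum hF.measurable l).mul (hρ.measurable l))
          ((measurable_altSum hG.measurable m).mul (hρ.measurable m))]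
      congr 2
      funext v
      simp only [gh]
      ring
    have b4 : IntegrableOn (fun v => gh l m v * (ρ l (fun i => v (Fin.castAdd m i))
          * ρ m (fun j => v (Fin.natAdd l j)))) (splitSet A B l m) := by
      have := (b1 l m).1.sub (b3 l m).1
      refine this.congr (ae_of_all _ fun v => ?_)
      simp only [Pi.sub_apply, Pi.mul_apply, Function.comp_apply]
      ring
    rw [(hT (l, m)).2.1, e1, ← mul_sub, ← integral_sub (b1 l m).1 b4, Real.norm_eq_abs, abs_mul,
      abs_of_nonneg (by positivity : (0 : ℝ) ≤ (l ! : ℝ)⁻¹ * (m ! : ℝ)⁻¹)]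
    have b5 := (b3 l m).2
    simp only [Pi.sub_apply, Pi.mul_apply, Function.comp_apply, mul_sub] at b5
    calc _ ≤ _ := mul_le_mul_of_nonneg_left b5 (by positivity)
      _ = Real.exp (-c * δ ^ a') * ((l ! : ℝ)⁻¹ * (m ! : ℝ)⁻¹ * (V ^ (l + m) *
        (K * (2 * Real.exp 1) ^ l * (L * (2 * Real.exp 1) ^ m) *
          (C ^ (l + m) * ((l + m)! : ℝ) ^ a)))) := by ring
      _ ≤ Real.exp (-c * δ ^ a') * (K * L * (factTerm a x l * factTerm a x m)) := by
        refine mul_le_mul_of_nonneg_left ?_ (Real.exp_pos _).le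
        exact pair_bound ha ha1.le hC0 hV hK hL l m
      _ = _ := by ring
  refine (tsum_of_norm_bounded (hsw2.mul_left _).hasSum h4).trans_eq ?_
  rw [tsum_mul_left, ← tsum_mul_tsum_of_summable_norm hsw.norm hsw.norm]
  ring

end Config

end Covariance

/-! ### Cumulants of set functions -/

section SetFunctions

variable {ι : Type*} [DecidableEq ι]

/-- The partition of `A \ D` obtained by removing a part `D`. -/
def Finpartition.removePart {A : Finset ι} (S : Finpartition A) {D : Finset ι}
    (hD : D ∈ S.parts) : Finpartition (A \ D) where
  parts := S.parts.erase D
  supIndep := S.supIndep.subset (Finset.erase_subset _ _)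
  sup_parts := by
    ext x
    simp only [Finset.mem_sup, Finset.mem_erase, id, Finset.mem_sdiff]
    constructor
    · rintro ⟨B, ⟨hBD, hB⟩, hx⟩
      exact ⟨S.le hB hx, Finset.disjoint_left.1 (S.disjoint hB hD hBD) hx⟩
    · rintro ⟨hxA, hxD⟩
      obtain ⟨B, hB, hx⟩ := S.exists_mem hxA
      exact ⟨B, ⟨fun h => hxD (h ▸ hx), hB⟩, hx⟩
  bot_notMem h := S.bot_notMem (Finset.mem_of_mem_erase h)

open Finset in
/-- A partition with a distinguished part is a part and a partition of the rest. -/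
theorem Finpartition.sum_sum_parts (A : Finset ι) (G : Finset ι → Finset (Finset ι) → ℝ) :
    ∑ S : Finpartition A, ∑ D ∈ S.parts, G D (S.parts.erase D)
      = ∑ D ∈ A.powerset with D.Nonempty, ∑ S : Finpartition (A \ D), G D S.parts := by
  rw [Finset.sum_sigma', Finset.sum_sigma']
  refine Finset.sum_bij' (fun q hq => ⟨q.2, q.1.removePart (mem_sigma.1 hq).2⟩)
    (fun q hq => ⟨q.2.extend (b := q.1) (c := A)
      (nonempty_iff_ne_empty.1 (mem_filter.1 (mem_sigma.1 hq).1).2) sdiff_disjoint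
      (sdiff_sup_cancel (mem_powerset.1 (mem_filter.1 (mem_sigma.1 hq).1).1)), q.1⟩)
    ?_ ?_ ?_ ?_ ?_
  · rintro ⟨S, D⟩ hq
    have hD := (mem_sigma.1 hq).2
    simp only [mem_sigma, mem_filter, mem_powerset, mem_univ, and_true]
    exact ⟨S.le hD, S.nonempty_of_mem_parts hD⟩
  · rintro ⟨D, S⟩ hq
    simp [Finpartition.extend]
  · rintro ⟨S, D⟩ hq
    have hD := (mem_sigma.1 hq).2
    refine Sigma.ext ?_ HEq.rfl
    ext1
    exact insert_erase hD
  · rintro ⟨D, S⟩ hq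
    have hD : D ∉ S.parts := by
      intro h
      obtain ⟨x, hx⟩ := S.nonempty_of_mem_parts h
      exact (mem_sdiff.1 (S.le h hx)).2 hx
    refine Sigma.ext rfl (heq_of_eq ?_)
    ext1
    exact erase_insert hD
  · rintro ⟨S, D⟩ hq
    rfl

/-- The cumulants of a set function. -/
noncomputable def setCumulant (m : Finset ι → ℝ) (A : Finset ι) : ℝ :=
  ∑ S : Finpartition A, (-1 : ℝ) ^ (S.parts.card - 1) * ((S.parts.card - 1)! : ℝ) *
    ∏ B ∈ S.parts, m B

/-- The inverse of a set function with respect to convolution. -/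
noncomputable def setInverse (m : Finset ι → ℝ) (A : Finset ι) : ℝ :=
  ∑ S : Finpartition A, (-1 : ℝ) ^ S.parts.card * (S.parts.card ! : ℝ) * ∏ B ∈ S.parts, m B

variable {m m' : Finset ι → ℝ}

theorem setInverse_empty : setInverse m ∅ = 1 := by
  have : ∀ S : Finpartition (∅ : Finset ι), S.parts = ∅ := fun S =>
    Finset.eq_empty_of_forall_notMem fun B hB => by
      have := S.le hB
      exact S.ne_bot hB (Finset.subset_empty.1 this)
  rw [setInverse, Fintype.sum_eq_single (⊥ : Finpartition (∅ : Finset ι))]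
  · simp
  · intro S hS
    exact (hS (Finpartition.ext ((this S).trans (this _).symm))).elim

-- A partition with `n + 1` parts arises from `n + 1` choices of the distinguished part `D`, which
-- turns the weight `n !` into `(n + 1)!`.
open Finset in
theorem setInverse_eq {A : Finset ι} (hA : A.Nonempty) :
    setInverse m A = -∑ D ∈ A.powerset with D.Nonempty, m D * setInverse m (A \ D) := by
  have h := Finpartition.sum_sum_parts A fun D T =>
    -(m D * ((-1 : ℝ) ^ T.card * (T.card ! : ℝ) * ∏ B ∈ T, m B))
  simp_rw [setInverse, mul_sum, ← sum_neg_distrib]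
  rw [← h]
  refine sum_congr rfl fun S _ => ?_
  have hS : S.parts.Nonempty := S.parts_nonempty hA.ne_empty
  obtain ⟨n, hn⟩ := Nat.exists_eq_succ_of_ne_zero hS.card_pos.ne'
  have h2 : ∀ D ∈ S.parts, -(m D * ((-1 : ℝ) ^ (S.parts.erase D).card *
      ((S.parts.erase D).card ! : ℝ) * ∏ B ∈ S.parts.erase D, m B))
      = (-1 : ℝ) ^ (n + 1) * (n ! : ℝ) * ∏ B ∈ S.parts, m B := by
    intro D hD
    rw [card_erase_of_mem hD, hn, Nat.succ_sub_one, ← mul_prod_erase _ _ hD]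
    ring
  rw [sum_congr rfl h2, sum_const, hn, nsmul_eq_mul, Nat.succ_eq_add_one, Nat.factorial_succ]
  push_cast
  ring

-- The distinguished part is now the one containing `a`, so that each partition is counted once and
-- the weight `(|S| - 1)!` is that of `setInverse` on the rest. Cumulants thus become accessible
-- through the convolution inverse, without sums over partitions.
open Finset in
theorem setCumulant_eq {A : Finset ι} {a : ι} (ha : a ∈ A) :
    setCumulant m A = ∑ D ∈ A.powerset with a ∈ D, m D * setInverse m (A \ D) := by
  have h := Finpartition.sum_sum_parts A fun D T => if a ∈ D then
    m D * ((-1 : ℝ) ^ T.card * (T.card ! : ℝ) * ∏ B ∈ T, m B) else 0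
  have h3 : ∑ D ∈ A.powerset with a ∈ D, m D * setInverse m (A \ D)
      = ∑ D ∈ A.powerset with D.Nonempty, ∑ S : Finpartition (A \ D), if a ∈ D then
    m D * ((-1 : ℝ) ^ S.parts.card * (S.parts.card ! : ℝ) * ∏ B ∈ S.parts, m B) else 0 := by
    rw [sum_filter, sum_filter]
    refine sum_congr rfl fun D _ => ?_
    by_cases haD : a ∈ D
    · have : D.Nonempty := ⟨a, haD⟩
      simp [haD, this, setInverse, mul_sum]
    · simp [haD]
  rw [h3, ← h, setCumulant]
  refine sum_congr rfl fun S _ => ?_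
  have hD := S.part_mem.2 ha
  rw [sum_eq_single (S.part a)]
  · rw [if_pos (S.mem_part_self.2 ha), card_erase_of_mem hD, ← mul_prod_erase _ _ hD]
    ring
  · intro B hB hne
    rw [if_neg]
    intro haB
    exact hne ((S.part_eq_of_mem hB haB).symm)
  · exact fun h => (h hD).elim

open Finset in
theorem sum_mul_setInverse (hm : m ∅ = 1) (A : Finset ι) :
    ∑ D ∈ A.powerset, m D * setInverse m (A \ D) = if A = ∅ then 1 else 0 := by
  split_ifs with hA
  · subst hA
    simp [hm, setInverse_empty]
  · have h1 := setInverse_eq (m := m) (nonempty_iff_ne_empty.2 hA)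
    rw [← sum_filter_add_sum_filter_not _ (fun D : Finset ι => D.Nonempty),
      (by linarith : ∑ D ∈ A.powerset with D.Nonempty, m D * setInverse m (A \ D)
        = -setInverse m A)]
    have : A.powerset.filter (fun D => ¬ D.Nonempty) = {∅} := by
      ext D
      simp only [mem_filter, mem_powerset, not_nonempty_iff_eq_empty, mem_singleton]
      exact ⟨fun h => h.2, fun h => ⟨h ▸ empty_subset _, h⟩⟩
    rw [this, sum_singleton, hm]
    simp

open Finset in
theorem sum_powerset_split (A I : Finset ι) (f : Finset ι → Finset ι → ℝ) :
    ∑ D ∈ A.powerset, f (D ∩ I) (D \ I)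
      = ∑ D₁ ∈ (A ∩ I).powerset, ∑ D₂ ∈ (A \ I).powerset, f D₁ D₂ := by
  rw [← sum_product']
  refine sum_nbij' (fun D => (D ∩ I, D \ I)) (fun q => q.1 ∪ q.2) ?_ ?_ ?_ ?_ ?_
  · intro D hD
    rw [mem_powerset] at hD
    exact mem_product.2 ⟨mem_powerset.2 (inter_subset_inter_right hD),
      mem_powerset.2 (sdiff_subset_sdiff hD le_rfl)⟩
  · rintro ⟨D₁, D₂⟩ hq
    simp only [mem_product, mem_powerset] at hq ⊢
    exact union_subset (hq.1.trans inter_subset_left) (hq.2.trans sdiff_subset)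
  · intro D _
    exact (union_comm _ _).trans (sdiff_union_inter D I)
  · rintro ⟨D₁, D₂⟩ hq
    simp only [mem_product, mem_powerset] at hq
    ext x
    · simp only [mem_inter, mem_union]
      constructor
      · rintro ⟨h | h, hI⟩
        · exact h
        · exact ((mem_sdiff.1 (hq.2 h)).2 hI).elim
      · exact fun h => ⟨Or.inl h, (mem_inter.1 (hq.1 h)).2⟩
    · simp only [mem_sdiff, mem_union]
      constructor
      · rintro ⟨h | h, hI⟩
        · exact (hI (mem_inter.1 (hq.1 h)).2).elim
        · exact h
      · exact fun h => ⟨Or.inr h, (mem_sdiff.1 (hq.2 h)).2⟩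
  · intro D _
    rfl

/-- The product on the right satisfies the recursion that determines the inverse on the left: the
convolution over `A` is the product of the convolutions over `A ∩ I` and `A \ I`, and it vanishes as
soon as one of these sets is nonempty. -/
theorem setInverse_mul (hm : m ∅ = 1) (I : Finset ι) (A : Finset ι) :
    setInverse (fun B => m (B ∩ I) * m (B \ I)) A
      = setInverse m (A ∩ I) * setInverse m (A \ I) := by
  induction A using Finset.strongInduction with
  | H A ih =>
    rcases A.eq_empty_or_nonempty with rfl | hA
    · simp [setInverse_empty]
    have h1 := sum_powerset_split A I fun D₁ D₂ =>
      (m D₁ * setInverse m ((A ∩ I) \ D₁)) * (m D₂ * setInverse m ((A \ I) \ D₂))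
    simp_rw [← Finset.mul_sum, ← Finset.sum_mul] at h1
    rw [sum_mul_setInverse hm, sum_mul_setInverse hm] at h1
    have h0 : (if A ∩ I = ∅ then (1 : ℝ) else 0) * (if A \ I = ∅ then 1 else 0) = 0 := by
      have := Finset.sdiff_union_inter A I
      by_cases h2 : A ∩ I = ∅
      · have h3 : A \ I ≠ ∅ := by
          intro h3
          rw [h2, h3, Finset.empty_union] at this
          exact hA.ne_empty this.symm
        rw [if_neg h3, mul_zero]
      · rw [if_neg h2, zero_mul]
    rw [h0] at h1
    have h4 := setInverse_eq (m := fun B => m (B ∩ I) * m (B \ I)) hA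
    have h5 : ∀ D : Finset ι, (A ∩ I) \ (D ∩ I) = (A \ D) ∩ I ∧ (A \ I) \ (D \ I) = (A \ D) \ I := by
      intro D
      constructor <;> ext x <;> simp only [Finset.mem_sdiff, Finset.mem_inter] <;> tauto
    rw [← Finset.sum_filter_add_sum_filter_not _ (fun D : Finset ι => D.Nonempty)] at h1
    have h6 : A.powerset.filter (fun D => ¬ D.Nonempty) = {∅} := by
      ext D
      simp only [Finset.mem_filter, Finset.mem_powerset, Finset.not_nonempty_iff_eq_empty,
        Finset.mem_singleton]
      exact ⟨fun h => h.2, fun h => ⟨h ▸ Finset.empty_subset _, h⟩⟩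
    rw [h6, Finset.sum_singleton] at h1
    simp only [Finset.empty_inter, Finset.empty_sdiff, hm, one_mul, Finset.sdiff_empty] at h1
    rw [h4, neg_eq_iff_add_eq_zero, ← h1]
    congr 1
    refine Finset.sum_congr rfl fun D hD => ?_
    rw [Finset.mem_filter, Finset.mem_powerset] at hD
    have hlt : A \ D ⊂ A := Finset.sdiff_ssubset hD.1 hD.2
    rw [ih _ hlt, (h5 D).1, (h5 D).2]
    ring

/-- The cumulants of a product are zero. -/
theorem setCumulant_mul (hm : m ∅ = 1) {A I : Finset ι} (h1 : (A ∩ I).Nonempty)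
    (h2 : (A \ I).Nonempty) : setCumulant (fun B => m (B ∩ I) * m (B \ I)) A = 0 := by
  obtain ⟨a, ha⟩ := h1
  rw [setCumulant_eq (Finset.mem_inter.1 ha).1]
  -- The sum factorizes over `A ∩ I` and `A \ I`, and the second factor is the convolution of `m`
  -- with its inverse on a nonempty set, hence zero.
  have h := sum_powerset_split A I fun D₁ D₂ => (if a ∈ D₁ then
      m D₁ * setInverse m ((A ∩ I) \ D₁) else 0) * (m D₂ * setInverse m ((A \ I) \ D₂))
  simp_rw [← Finset.mul_sum, ← Finset.sum_mul] at h
  rw [sum_mul_setInverse hm (A \ I), if_neg h2.ne_empty, mul_zero] at h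
  rw [← h, Finset.sum_filter]
  refine Finset.sum_congr rfl fun D _ => ?_
  have h5 : (A ∩ I) \ (D ∩ I) = (A \ D) ∩ I ∧ (A \ I) \ (D \ I) = (A \ D) \ I := by
    constructor <;> ext x <;> simp only [Finset.mem_sdiff, Finset.mem_inter] <;> tauto
  have h6 : a ∈ D ∩ I ↔ a ∈ D := by
    rw [Finset.mem_inter]; exact ⟨fun h => h.1, fun h => ⟨h, (Finset.mem_inter.1 ha).2⟩⟩
  simp only [h6]
  split_ifs
  · rw [setInverse_mul hm, h5.1, h5.2]; ring
  · simp

end SetFunctions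

/-! ### Quantitative bounds for cumulants of set functions -/

section SetFunctionBounds

variable {ι : Type*} [DecidableEq ι] {m m' : Finset ι → ℝ} {c κ ε : ℝ}

/-- For `κ ≥ 1` one power of the binomial coefficient is absorbed by the quotient of the `κ`-th
powers of factorials. Consequently the class of set functions bounded by `c^|A| |A|!^κ` is stable
under convolution, up to the constant `c`. -/
theorem choose_mul_rpow_le (hκ : 1 ≤ κ) {n j : ℕ} (hj : j ≤ n) :
    (n.choose j : ℝ) * ((j ! : ℝ) ^ κ * ((n - j)! : ℝ) ^ κ) ≤ (n ! : ℝ) ^ κ := by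
  have h1 : ((n.choose j : ℝ) * (j ! * (n - j)!)) = n ! := by
    rw [← mul_assoc]; exact_mod_cast Nat.choose_mul_factorial_mul_factorial hj
  have h2 : (1 : ℝ) ≤ n.choose j := by exact_mod_cast Nat.choose_pos hj
  rw [← Real.mul_rpow (by positivity) (by positivity), ← h1,
    Real.mul_rpow (x := (n.choose j : ℝ)) (by positivity) (by positivity)]
  gcongr
  exact Real.self_le_rpow_of_one_le h2 hκ

-- Letting one factor grow with the larger ratio `q c` leaves a geometric series in `q`; its sum
-- gains the factor `1 / (q - 1)`, which closes the inductions below.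
open Finset in
theorem sum_powerset_factorial_le (hκ : 1 ≤ κ) (hc : 0 ≤ c) {q : ℝ} (hq : 1 < q)
    (A : Finset ι) :
    ∑ D ∈ A.powerset with D.Nonempty, (c ^ D.card * (D.card ! : ℝ) ^ κ) *
      ((q * c) ^ (A \ D).card * ((A \ D).card ! : ℝ) ^ κ) ≤ (q * c) ^ A.card * (A.card ! : ℝ) ^ κ / (q - 1) := by
  set n := A.card
  have h1 : ∑ D ∈ A.powerset with D.Nonempty, (c ^ D.card * (D.card ! : ℝ) ^ κ) *
      ((q * c) ^ (A \ D).card * ((A \ D).card ! : ℝ) ^ κ)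
      = ∑ D ∈ A.powerset, (fun j => if j = 0 then 0 else (c ^ j * (j ! : ℝ) ^ κ) *
        ((q * c) ^ (n - j) * ((n - j)! : ℝ) ^ κ)) D.card := by
    rw [sum_filter]
    refine sum_congr rfl fun D hD => ?_
    rw [card_sdiff_of_subset (mem_powerset.1 hD)]
    by_cases h : D.Nonempty
    · simp [h, h.ne_empty, n]
    · simp [not_nonempty_iff_eq_empty.1 h]
  rw [h1, sum_powerset_apply_card (fun j => if j = 0 then 0 else (c ^ j * (j ! : ℝ) ^ κ) *
    ((q * c) ^ (n - j) * ((n - j)! : ℝ) ^ κ)), sum_range_succ', if_pos rfl, smul_zero, add_zero]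
  have h2 : ∀ j ∈ range n, n.choose (j + 1) • (if j + 1 = 0 then 0 else
      (c ^ (j + 1) * ((j + 1)! : ℝ) ^ κ) *
        ((q * c) ^ (n - (j + 1)) * ((n - (j + 1))! : ℝ) ^ κ))
      ≤ c ^ n * (n ! : ℝ) ^ κ * q ^ (n - 1 - j) := by
    intro j hj
    have hj' : j + 1 ≤ n := by simpa using hj
    rw [if_neg (Nat.succ_ne_zero j), nsmul_eq_mul]
    have h3 := choose_mul_rpow_le hκ hj'
    calc _ = (c ^ (j + 1) * c ^ (n - (j + 1))) * q ^ (n - 1 - j) * ((n.choose (j + 1) : ℝ) *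
          (((j + 1)! : ℝ) ^ κ * ((n - (j + 1))! : ℝ) ^ κ)) := by
            rw [mul_pow, show n - (j + 1) = n - 1 - j by omega]; ring
      _ ≤ (c ^ (j + 1) * c ^ (n - (j + 1))) * q ^ (n - 1 - j) * (n ! : ℝ) ^ κ := by
            gcongr
      _ = _ := by
            rw [← pow_add, Nat.add_sub_cancel' hj']; ring
  refine (sum_le_sum h2).trans ?_
  rw [← mul_sum, sum_range_reflect (fun i => q ^ i) n, geom_sum_eq hq.ne', mul_pow, ← mul_div_assoc]
  have : 0 < q - 1 := by linarith
  refine div_le_div_of_nonneg_right ?_ this.le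
  nlinarith [show 0 ≤ c ^ n * (n ! : ℝ) ^ κ by positivity]

theorem abs_setInverse_le (hκ : 1 ≤ κ) (hc : 0 ≤ c)
    (hm : ∀ A, |m A| ≤ c ^ A.card * (A.card ! : ℝ) ^ κ) (A : Finset ι) :
    |setInverse m A| ≤ (4 * c) ^ A.card * (A.card ! : ℝ) ^ κ := by
  induction A using Finset.strongInduction with
  | H A ih =>
    rcases A.eq_empty_or_nonempty with rfl | hA
    · simp [setInverse_empty]
    rw [setInverse_eq hA, abs_neg]
    refine (Finset.abs_sum_le_sum_abs _ _).trans ((Finset.sum_le_sum fun D hD => ?_).trans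
      ((sum_powerset_factorial_le hκ hc (q := 4) (by norm_num) A).trans ?_))
    · rw [Finset.mem_filter, Finset.mem_powerset] at hD
      rw [abs_mul]
      exact mul_le_mul (hm D) (ih _ (Finset.sdiff_ssubset hD.1 hD.2)) (abs_nonneg _)
        (by positivity)
    · exact div_le_self (by positivity) (by norm_num)

theorem abs_mul_sub_mul_le {x y x' y' X Y e f : ℝ} (hx' : |x'| ≤ X) (hy : |y| ≤ Y)
    (hd : |x - x'| ≤ e) (hd' : |y - y'| ≤ f) : |x * y - x' * y'| ≤ e * Y + X * f := by
  have : x * y - x' * y' = (x - x') * y + x' * (y - y') := by ring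
  rw [this]
  refine (abs_add_le _ _).trans ?_
  rw [abs_mul, abs_mul]
  have := (abs_nonneg _).trans hx'
  have := (abs_nonneg _).trans hd
  gcongr

/-- Both claims are proved together: the second one is the sum in the recursion for the first, and
it also dominates the corresponding sum for the cumulants, which runs only over the `D` containing a
fixed element. -/
theorem abs_setInverse_sub_le (hκ : 1 ≤ κ) (hc : 0 ≤ c) (hε : 0 ≤ ε)
    (hm : ∀ A, |m A| ≤ c ^ A.card * (A.card ! : ℝ) ^ κ)
    (hm' : ∀ A, |m' A| ≤ c ^ A.card * (A.card ! : ℝ) ^ κ)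
    (hd : ∀ A, |m A - m' A| ≤ ε * (c ^ A.card * (A.card ! : ℝ) ^ κ)) (A : Finset ι) :
    |setInverse m A - setInverse m' A| ≤ ε * ((8 * c) ^ A.card * (A.card ! : ℝ) ^ κ) ∧
    ∑ D ∈ A.powerset with D.Nonempty, |m D * setInverse m (A \ D) - m' D * setInverse m' (A \ D)|
      ≤ ε * ((8 * c) ^ A.card * (A.card ! : ℝ) ^ κ) := by
  induction A using Finset.strongInduction with
  | H A ih =>
    have h2 : ∑ D ∈ A.powerset with D.Nonempty,
        |m D * setInverse m (A \ D) - m' D * setInverse m' (A \ D)|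
        ≤ ε * ((8 * c) ^ A.card * (A.card ! : ℝ) ^ κ) := by
      -- The two terms of the telescoped difference of products give `2 ε`, which is compensated by
      -- `1 / (q - 1) = 1 / 7`.
      refine (Finset.sum_le_sum fun D hD => ?_).trans ((Finset.mul_sum _ _ (2 * ε)).symm.trans_le
        ((mul_le_mul_of_nonneg_left
          (sum_powerset_factorial_le hκ hc (q := 8) (by norm_num) A) (by positivity)).trans ?_))
      · rw [Finset.mem_filter, Finset.mem_powerset] at hD
        have h3 := abs_mul_sub_mul_le (hm' D) (abs_setInverse_le hκ hc hm (A \ D)) (hd D)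
          (ih _ (Finset.sdiff_ssubset hD.1 hD.2)).1
        refine h3.trans ?_
        have h4 : (4 * c) ^ (A \ D).card ≤ (8 * c) ^ (A \ D).card := by gcongr; norm_num
        calc _ ≤ ε * (c ^ D.card * (D.card ! : ℝ) ^ κ) *
              ((8 * c) ^ (A \ D).card * ((A \ D).card ! : ℝ) ^ κ)
              + c ^ D.card * (D.card ! : ℝ) ^ κ *
              (ε * ((8 * c) ^ (A \ D).card * ((A \ D).card ! : ℝ) ^ κ)) := by gcongr
          _ = _ := by ring
      · have : 0 ≤ ε * ((8 * c) ^ A.card * (A.card ! : ℝ) ^ κ) := by positivity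
        rw [mul_div_assoc']
        rw [div_le_iff₀ (by norm_num)]
        nlinarith
    refine ⟨?_, h2⟩
    rcases A.eq_empty_or_nonempty with rfl | hA
    · simpa [setInverse_empty] using hε
    rw [setInverse_eq hA, setInverse_eq hA, neg_sub_neg, abs_sub_comm, ← Finset.sum_sub_distrib]
    exact (Finset.abs_sum_le_sum_abs _ _).trans h2

theorem abs_setCumulant_sub_le (hκ : 1 ≤ κ) (hc : 0 ≤ c) (hε : 0 ≤ ε)
    (hm : ∀ A, |m A| ≤ c ^ A.card * (A.card ! : ℝ) ^ κ)
    (hm' : ∀ A, |m' A| ≤ c ^ A.card * (A.card ! : ℝ) ^ κ)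
    (hd : ∀ A, |m A - m' A| ≤ ε * (c ^ A.card * (A.card ! : ℝ) ^ κ)) {A : Finset ι}
    (hA : A.Nonempty) :
    |setCumulant m A - setCumulant m' A| ≤ ε * ((8 * c) ^ A.card * (A.card ! : ℝ) ^ κ) := by
  obtain ⟨a, ha⟩ := hA
  rw [setCumulant_eq ha, setCumulant_eq ha, ← Finset.sum_sub_distrib]
  refine (Finset.abs_sum_le_sum_abs _ _).trans (le_trans ?_
    (abs_setInverse_sub_le hκ hc hε hm hm' hd A).2)
  refine Finset.sum_le_sum_of_subset_of_nonneg (fun D hD => ?_) fun D _ _ => abs_nonneg _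
  rw [Finset.mem_filter] at hD ⊢
  exact ⟨hD.1, a, hD.2⟩

theorem abs_setCumulant_le (hκ : 1 ≤ κ) (hc : 0 ≤ c)
    (hm : ∀ A, |m A| ≤ c ^ A.card * (A.card ! : ℝ) ^ κ) {A : Finset ι}
    (hA : A.Nonempty) :
    |setCumulant m A| ≤ (8 * c) ^ A.card * (A.card ! : ℝ) ^ κ := by
  obtain ⟨a, ha⟩ := hA
  rw [setCumulant_eq ha]
  refine (Finset.abs_sum_le_sum_abs _ _).trans ?_
  refine le_trans (Finset.sum_le_sum_of_subset_of_nonneg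
    (t := A.powerset.filter (fun D => D.Nonempty)) (fun D hD => ?_)
    fun D _ _ => abs_nonneg _) ?_
  · rw [Finset.mem_filter] at hD ⊢
    exact ⟨hD.1, a, hD.2⟩
  refine (Finset.sum_le_sum fun D _ => ?_).trans
    ((sum_powerset_factorial_le hκ hc (q := 8) (by norm_num) A).trans ?_)
  · rw [abs_mul]
    refine mul_le_mul (hm D) ((abs_setInverse_le hκ hc hm (A \ D)).trans ?_) (abs_nonneg _)
      (by positivity)
    gcongr
    norm_num
  · exact div_le_self (by positivity) (by norm_num)

/-- The cumulants of a set function that almost factorizes are small. -/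
theorem abs_setCumulant_le_of_split (hκ : 1 ≤ κ) (hc : 0 ≤ c) (hε : 0 ≤ ε) (h1 : m ∅ = 1)
    (hm : ∀ A, |m A| ≤ c ^ A.card * (A.card ! : ℝ) ^ κ) {I A : Finset ι}
    (hd : ∀ A, |m A - m (A ∩ I) * m (A \ I)| ≤ ε * (c ^ A.card * (A.card ! : ℝ) ^ κ))
    (hA1 : (A ∩ I).Nonempty) (hA2 : (A \ I).Nonempty) :
    |setCumulant m A| ≤ ε * ((8 * c) ^ A.card * (A.card ! : ℝ) ^ κ) := by
  -- The factorized set function obeys the same bound as `m` because `i! j! ≤ (i + j)!`; it has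
  -- cumulant zero, so the cumulant of `m` is only its deviation from it.
  have hm' : ∀ A, |m (A ∩ I) * m (A \ I)| ≤ c ^ A.card * (A.card ! : ℝ) ^ κ := by
    intro A
    have hcard : A.card = (A ∩ I).card + (A \ I).card := (Finset.card_inter_add_card_sdiff A I).symm
    have h2 : ((A ∩ I).card ! * (A \ I).card ! : ℝ) ≤ A.card ! := by
      rw [hcard]
      exact_mod_cast Nat.le_of_dvd (Nat.factorial_pos _) (Nat.factorial_mul_factorial_dvd_factorial_add _ _)
    rw [abs_mul]
    calc _ ≤ (c ^ (A ∩ I).card * ((A ∩ I).card ! : ℝ) ^ κ) *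
          (c ^ (A \ I).card * ((A \ I).card ! : ℝ) ^ κ) := by
          gcongr
          · exact hm _
          · exact hm _
      _ = c ^ A.card * ((A ∩ I).card ! * (A \ I).card ! : ℝ) ^ κ := by
          rw [Real.mul_rpow (by positivity) (by positivity), hcard, pow_add]; ring
      _ ≤ _ := by gcongr
  have h := abs_setCumulant_sub_le hκ hc hε hm hm' hd (hA1.mono Finset.inter_subset_left)
  rwa [setCumulant_mul h1 hA1 hA2, sub_zero] at h

end SetFunctionBounds

/-! ### Multilinearity of cumulants -/

section Multilinearity

-- A product over the parts of a partition and then over the elements of each part is a product over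
-- all indices, each seeing the part it belongs to.
open Finset in
theorem Finpartition.prod_parts_prod {ι : Type*} [DecidableEq ι] [Fintype ι]
    (S : Finpartition (univ : Finset ι)) (g : {B // B ∈ S.parts} → ι → ℝ) :
    ∏ B : {B // B ∈ S.parts}, ∏ i ∈ B.1, g B i
      = ∏ i, g ⟨S.part i, S.part_mem.2 (mem_univ i)⟩ i := by
  rw [← prod_fiberwise univ fun i => (⟨S.part i, S.part_mem.2 (mem_univ i)⟩ : {B // B ∈ S.parts})]
  refine prod_congr rfl fun B _ => ?_
  have hB : ∀ i, i ∈ B.1 ↔ (⟨S.part i, S.part_mem.2 (mem_univ i)⟩ : {B // B ∈ S.parts}) = B := by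
    intro i
    rw [Subtype.ext_iff]
    constructor
    · exact fun h => S.part_eq_of_mem B.2 h
    · rintro h
      rw [← h]
      exact S.mem_part_self.2 (mem_univ i)
  have hf : B.1 = univ.filter fun i =>
      (⟨S.part i, S.part_mem.2 (mem_univ i)⟩ : {B // B ∈ S.parts}) = B := by
    ext i; simp [hB i]
  conv_lhs => rw [hf]
  refine prod_congr rfl fun i hi => ?_
  rw [(mem_filter.1 hi).2]

variable {Ω Z : Type*} [MeasurableSpace Ω] {P : Measure Ω} [IsProbabilityMeasure P]

open Finset in
/-- The cumulants of a sum are sums of joint cumulants. -/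
theorem kthCumulant_sum (Zs : Finset Z) (Y : Z → Ω → ℝ) (k : ℕ)
    (hY : ∀ (z : Fin k → Z) (A : Finset (Fin k)), Integrable (fun ω => ∏ i ∈ A, Y (z i) ω) P) :
    kthCumulant P (fun ω => ∑ z ∈ Zs, Y z ω) k
      = ∑ z ∈ Fintype.piFinset fun _ : Fin k => Zs,
        setCumulant (fun A => ∫ ω, ∏ i ∈ A, Y (z i) ω ∂P) univ := by
  simp_rw [kthCumulant, setCumulant]
  rw [sum_comm]
  refine sum_congr rfl fun S _ => ?_
  rw [← mul_sum]
  congr 1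
  -- A product of expectations is one expectation over independent copies, one for each part; under
  -- this integral the product of sums can be expanded.
  have h1 : ∀ z : Fin k → Z, ∏ B ∈ S.parts, ∫ ω, ∏ i ∈ B, Y (z i) ω ∂P
      = ∫ ω : {B // B ∈ S.parts} → Ω, ∏ B, ∏ i ∈ B.1, Y (z i) (ω B) ∂(Measure.pi fun _ => P) := by
    intro z
    rw [← prod_coe_sort]
    exact (integral_fintype_prod_eq_prod (𝕜 := ℝ)
      (fun (B : {B // B ∈ S.parts}) ω => ∏ i ∈ B.1, Y (z i) ω)).symm
  have h2 : ∏ B ∈ S.parts, ∫ ω, (∑ z ∈ Zs, Y z ω) ^ B.card ∂P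
      = ∫ ω : {B // B ∈ S.parts} → Ω, ∏ B, (∑ z ∈ Zs, Y z (ω B)) ^ B.1.card
        ∂(Measure.pi fun _ => P) := by
    rw [← prod_coe_sort]
    exact (integral_fintype_prod_eq_prod (𝕜 := ℝ)
      (fun (B : {B // B ∈ S.parts}) ω => (∑ z ∈ Zs, Y z ω) ^ B.1.card)).symm
  simp_rw [h1]
  rw [h2, ← integral_finsetSum]
  · refine integral_congr_ae (ae_of_all _ fun ω => ?_)
    simp only
    have h3 : ∀ z : Fin k → Z, ∏ B : {B // B ∈ S.parts}, ∏ i ∈ B.1, Y (z i) (ω B)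
        = ∏ i, Y (z i) (ω ⟨S.part i, S.part_mem.2 (mem_univ i)⟩) := fun z =>
      S.prod_parts_prod fun B i => Y (z i) (ω B)
    have h4 := S.prod_parts_prod fun B _ => ∑ z ∈ Zs, Y z (ω B)
    simp_rw [prod_const] at h4
    simp_rw [h3]
    rw [h4, prod_univ_sum]
  · intro z _
    exact Integrable.fintype_prod (μ := fun _ => P)
      (f := fun (B : {B // B ∈ S.parts}) ω => ∏ i ∈ B.1, Y (z i) ω) fun B => hY z B.1

end Multilinearity

/-! ### Summation over tuples of lattice points -/

section LatticeSums

variable {d k : ℕ}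

/-- The graph joining the indices of lattice points at distance at most `s`. -/
def nearGraph (s : ℕ) (z : Fin k → Fin d → ℤ) : SimpleGraph (Fin k) where
  Adj i j := i ≠ j ∧ ∀ e, |z i e - z j e| ≤ s
  symm := ⟨fun i j h => ⟨h.1.symm, fun e => by rw [abs_sub_comm]; exact h.2 e⟩⟩
  loopless := ⟨fun i h => h.1 rfl⟩

open Classical in
/-- A neighbour that is closer to the first index. -/
noncomputable def nearParent [NeZero k] (s : ℕ) (z : Fin k → Fin d → ℤ) (i : Fin k) : Fin k :=
  if h : ∃ j, (nearGraph s z).Adj j i ∧ (nearGraph s z).dist 0 j < (nearGraph s z).dist 0 i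
  then h.choose else i

theorem abs_sub_nearParent_le [NeZero k] (s : ℕ) (z : Fin k → Fin d → ℤ) (i : Fin k) (e : Fin d) :
    |z i e - z (nearParent s z i) e| ≤ s := by
  unfold nearParent
  split_ifs with h
  · rw [abs_sub_comm]
    exact h.choose_spec.1.2 e
  · simp

/-- In a connected graph the predecessor on a shortest path to the index `0` is such a neighbour;
the fallback in the definition of `nearParent` is therefore not met except at the root. -/
theorem dist_nearParent_lt [NeZero k] {s : ℕ} {z : Fin k → Fin d → ℤ}
    (hz : (nearGraph s z).Connected) {i : Fin k} (hi : i ≠ 0) :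
    (nearGraph s z).dist 0 (nearParent s z i) < (nearGraph s z).dist 0 i := by
  have h : ∃ j, (nearGraph s z).Adj j i ∧
      (nearGraph s z).dist 0 j < (nearGraph s z).dist 0 i := by
    obtain ⟨p, hp⟩ := hz.exists_walk_length_eq_dist i 0
    cases p with
    | nil => exact (hi rfl).elim
    | cons hadj q =>
      refine ⟨_, hadj.symm, ?_⟩
      rw [SimpleGraph.dist_comm, SimpleGraph.dist_comm (u := 0), ← hp, SimpleGraph.Walk.length_cons]
      exact Nat.lt_succ_of_le (SimpleGraph.dist_le q)
  unfold nearParent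
  rw [dif_pos h]
  exact h.choose_spec.2

-- A connected tuple is determined by the position of its first point, the parent map of a tree of
-- shortest paths, and the displacement of each point from its parent. There are at most `k^k`
-- parent maps and `(2s+1)^d` displacements for each index.
open Finset Classical in
theorem card_connected_le [NeZero k] (Z : Finset (Fin d → ℤ)) (s : ℕ) :
    #{z ∈ Fintype.piFinset fun _ : Fin k => Z | (nearGraph s z).Connected}
      ≤ #Z * (k ^ k * (2 * s + 1) ^ (d * k)) := by
  have hcard : #(Z ×ˢ ((univ : Finset (Fin k → Fin k)) ×ˢ
      Fintype.piFinset fun _ : Fin k => Fintype.piFinset fun _ : Fin d => Icc (-(s : ℤ)) s))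
      = #Z * (k ^ k * (2 * s + 1) ^ (d * k)) := by
    simp only [card_product, card_univ, Fintype.card_pi, prod_const, Fintype.card_fin,
      Fintype.card_piFinset, Int.card_Icc]
    rw [← pow_mul]
    congr 4
    omega
  rw [← hcard]
  refine card_le_card_of_injOn (fun z => (z 0, nearParent s z, fun i e =>
    z i e - z (nearParent s z i) e)) ?_ ?_
  · intro z hz
    rw [mem_coe, mem_filter, Fintype.mem_piFinset] at hz
    simp only [coe_product, Set.mem_prod, mem_coe, mem_univ, true_and, Fintype.mem_piFinset,
      mem_Icc]
    exact ⟨hz.1 0, fun i e => abs_le.1 (abs_sub_nearParent_le s z i e)⟩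
  · intro z hz z' _ heq
    simp only [Prod.mk.injEq] at heq
    obtain ⟨h0, hp, hw⟩ := heq
    rw [mem_coe, mem_filter] at hz
    -- Positions are recovered from the code by induction on the graph distance to the root.
    have key : ∀ n i, (nearGraph s z).dist 0 i = n → z i = z' i := by
      intro n
      induction n using Nat.strong_induction_on with
      | _ n ih =>
        intro i hi
        by_cases hi0 : i = 0
        · rw [hi0, h0]
        · have h1 := dist_nearParent_lt hz.2 hi0
          have h2 := ih _ (hi ▸ h1) _ rfl
          funext e
          have h3 := congrFun (congrFun hw i) e
          simp only [← hp, h2] at h3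
          linarith
    funext i
    exact key _ i rfl

theorem sum_inv_sq_le (M : ℕ) : ∑ s ∈ Finset.range M, 1 / ((1 : ℝ) + s) ^ 2 ≤ 2 := by
  have h : ∀ M : ℕ, ∑ s ∈ Finset.range (M + 1), 1 / ((1 : ℝ) + s) ^ 2 ≤ 2 - 1 / (1 + (M : ℝ)) := by
    intro M
    induction M with
    | zero => norm_num
    | succ M ih =>
      rw [Finset.sum_range_succ]
      have h1 : 1 / ((1 : ℝ) + (M + 1 : ℕ)) ^ 2 ≤ 1 / (1 + (M : ℝ)) - 1 / (1 + ((M + 1 : ℕ) : ℝ)) := by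
        push_cast
        rw [div_sub_div _ _ (by positivity) (by positivity),
          div_le_div_iff₀ (by positivity) (by positivity)]
        nlinarith [(Nat.cast_nonneg M : (0 : ℝ) ≤ M)]
      linarith
  refine le_trans (Finset.sum_le_sum_of_subset_of_nonneg
    (Finset.range_mono (Nat.le_succ M)) fun i _ _ => by positivity) ((h M).trans ?_)
  have : (0 : ℝ) ≤ 1 / (1 + (M : ℝ)) := by positivity
  linarith

open Classical in
/-- Summation over the lattice of a function that decays in the separation of its arguments. -/
theorem sum_lattice_le [NeZero k] (Z : Finset (Fin d → ℤ)) (w : (Fin k → Fin d → ℤ) → ℝ) {M : ℝ}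
    (hM : 0 ≤ M) (h0 : ∀ z, w z ≤ M)
    (hw : ∀ z, ∀ s : ℕ, 1 ≤ s → ∀ I : Finset (Fin k), I.Nonempty → Iᶜ.Nonempty →
      (∀ i ∈ I, ∀ j ∉ I, ∃ e, (s : ℤ) ≤ |z i e - z j e|) →
        w z ≤ M / ((1 : ℝ) + s) ^ (d * k + 2)) :
    ∑ z ∈ Fintype.piFinset fun _ : Fin k => Z, w z
      ≤ Z.card * ((k : ℝ) ^ k * (2 ^ (d * k) * (2 * M))) := by
  have hex : ∀ z : Fin k → Fin d → ℤ, ∃ s, (nearGraph s z).Connected := by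
    intro z
    refine ⟨∑ i, ∑ j, ∑ e, (z i e - z j e).natAbs, ⟨fun i j => ?_⟩⟩
    by_cases hij : i = j
    · rw [hij]
    · refine SimpleGraph.Adj.reachable ⟨hij, fun e => ?_⟩
      rw [Int.abs_eq_natAbs]
      norm_cast
      refine le_trans ?_ (Finset.single_le_sum (f := fun i => ∑ j, ∑ e, (z i e - z j e).natAbs)
        (fun _ _ => Nat.zero_le _) (Finset.mem_univ i))
      refine le_trans ?_ (Finset.single_le_sum (f := fun j => ∑ e, (z i e - z j e).natAbs)
        (fun _ _ => Nat.zero_le _) (Finset.mem_univ j))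
      exact Finset.single_le_sum (f := fun e => (z i e - z j e).natAbs)
        (fun _ _ => Nat.zero_le _) (Finset.mem_univ e)
  -- The scale of `z` is the least `s` at which its points are connected. At scale `sc z - 1` the
  -- component of the index `0` is a proper subset, separated from the rest by at least `sc z`.
  let sc : (Fin k → Fin d → ℤ) → ℕ := fun z => Nat.find (hex z)
  have hsc : ∀ z, w z ≤ M / ((1 : ℝ) + sc z) ^ (d * k + 2) := by
    intro z
    rcases Nat.eq_zero_or_pos (sc z) with h | h
    · rw [h]; simpa using h0 z
    · have hnc : ¬ (nearGraph (sc z - 1) z).Connected :=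
        Nat.find_min (hex z) (Nat.sub_lt h one_pos)
      set G := nearGraph (sc z - 1) z with hG
      refine hw z (sc z) h (Finset.univ.filter fun i => G.Reachable 0 i) ⟨0, by simp⟩ ?_ ?_
      · by_contra hne
        rw [Finset.not_nonempty_iff_eq_empty, Finset.compl_eq_empty_iff] at hne
        refine hnc ⟨fun i j => ?_⟩
        have h1 : ∀ i, G.Reachable 0 i := fun i => by
          have := hne ▸ Finset.mem_univ i
          exact (Finset.mem_filter.1 this).2
        exact (h1 i).symm.trans (h1 j)
      · intro i hi j hj
        by_contra! hlt
        simp only [Finset.mem_filter, Finset.mem_univ, true_and] at hi hj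
        refine hj (hi.trans (SimpleGraph.Adj.reachable ⟨?_, fun e => ?_⟩))
        · rintro rfl; exact hj hi
        · have := hlt e
          push_cast [Nat.cast_sub h]
          omega
  set N := (Fintype.piFinset fun _ : Fin k => Z).sup sc + 1
  calc ∑ z ∈ Fintype.piFinset fun _ : Fin k => Z, w z
      ≤ ∑ z ∈ Fintype.piFinset fun _ : Fin k => Z, M / ((1 : ℝ) + sc z) ^ (d * k + 2) :=
        Finset.sum_le_sum fun z _ => hsc z
    _ = ∑ s ∈ Finset.range N, ∑ z ∈ Fintype.piFinset fun _ : Fin k => Z with sc z = s,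
          M / ((1 : ℝ) + sc z) ^ (d * k + 2) := by
        rw [Finset.sum_fiberwise_of_maps_to]
        intro z hz
        exact Finset.mem_range.2 (Nat.lt_succ_of_le (Finset.le_sup hz))
    -- The count `(2s+1)^(dk)` of tuples of scale `s` uses up `(1+s)^(dk)` of the decay; the
    -- remaining two powers make the sum over `s` converge.
    _ ≤ ∑ s ∈ Finset.range N, (Z.card * ((k : ℝ) ^ k * (2 ^ (d * k) * M))) *
          (1 / ((1 : ℝ) + s) ^ 2) := by
        refine Finset.sum_le_sum fun s _ => ?_
        have h1 : ∑ z ∈ Fintype.piFinset fun _ : Fin k => Z with sc z = s,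
            M / ((1 : ℝ) + sc z) ^ (d * k + 2)
            = ((Fintype.piFinset fun _ : Fin k => Z).filter fun z => sc z = s).card *
              (M / ((1 : ℝ) + s) ^ (d * k + 2)) := by
          rw [Finset.sum_congr rfl fun z hz => by rw [(Finset.mem_filter.1 hz).2],
            Finset.sum_const, nsmul_eq_mul]
        have h2 : (((Fintype.piFinset fun _ : Fin k => Z).filter fun z => sc z = s).card : ℝ)
            ≤ Z.card * ((k : ℝ) ^ k * (2 * s + 1) ^ (d * k)) := by
          refine le_trans ?_ (le_of_le_of_eq (Nat.cast_le.2 (card_connected_le (k := k) Z s))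
            (by push_cast; rfl))
          refine Nat.cast_le.2 (Finset.card_le_card fun z hz => ?_)
          rw [Finset.mem_filter] at hz ⊢
          exact ⟨hz.1, hz.2 ▸ Nat.find_spec (hex z)⟩
        rw [h1]
        have h3 : ((2 : ℝ) * s + 1) ^ (d * k) ≤ 2 ^ (d * k) * (1 + s) ^ (d * k) := by
          rw [← mul_pow]
          gcongr
          linarith
        calc _ ≤ (Z.card * ((k : ℝ) ^ k * (2 ^ (d * k) * (1 + s) ^ (d * k)))) *
              (M / ((1 : ℝ) + s) ^ (d * k + 2)) := by
              gcongr
              exact h2.trans (by gcongr)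
          _ = _ := by
              rw [pow_add]
              field_simp
    _ ≤ (Z.card * ((k : ℝ) ^ k * (2 ^ (d * k) * M))) * 2 := by
        rw [← Finset.mul_sum]
        gcongr
        exact sum_inv_sq_le N
    _ = _ := by ring

end LatticeSums

/-! ### Cumulants of clustering families on the lattice -/

section CumulantBound

variable {Ω : Type*} [MeasurableSpace Ω] {P : Measure Ω} [IsProbabilityMeasure P] {d k : ℕ}

/-- Cumulants of a sum of random variables that are indexed by lattice points, and whose mixed
moments almost factorize when the indices split into two distant groups. -/
theorem abs_kthCumulant_sum_le (hk : 1 ≤ k) (Zs : Finset (Fin d → ℤ))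
    (Y : (Fin d → ℤ) → Ω → ℝ) {c κ M : ℝ} (hκ : 1 ≤ κ) (hc : 0 ≤ c) (hM : 1 ≤ M)
    (hY : ∀ (z : Fin k → Fin d → ℤ) (A : Finset (Fin k)),
      Integrable (fun ω => ∏ i ∈ A, Y (z i) ω) P)
    (hm : ∀ (z : Fin k → Fin d → ℤ) (A : Finset (Fin k)),
      |∫ ω, ∏ i ∈ A, Y (z i) ω ∂P| ≤ c ^ A.card * (A.card ! : ℝ) ^ κ)
    (hs : ∀ (z : Fin k → Fin d → ℤ) (s : ℕ), 1 ≤ s → ∀ I : Finset (Fin k),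
      (∀ i ∈ I, ∀ j ∉ I, ∃ e, (s : ℤ) ≤ |z i e - z j e|) → ∀ A : Finset (Fin k),
      |∫ ω, ∏ i ∈ A, Y (z i) ω ∂P
          - (∫ ω, ∏ i ∈ A ∩ I, Y (z i) ω ∂P) * ∫ ω, ∏ i ∈ A \ I, Y (z i) ω ∂P|
        ≤ M / ((1 : ℝ) + s) ^ (d * k + 2) * (c ^ A.card * (A.card ! : ℝ) ^ κ)) :
    |kthCumulant P (fun ω => ∑ z ∈ Zs, Y z ω) k|
      ≤ Zs.card * ((k : ℝ) ^ k * (2 ^ (d * k) * (2 * (M * ((8 * c) ^ k * (k ! : ℝ) ^ κ))))) := by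
  classical
  have : NeZero k := ⟨by omega⟩
  have hu : (Finset.univ : Finset (Fin k)).Nonempty := ⟨0, Finset.mem_univ _⟩
  rw [kthCumulant_sum Zs Y k hY]
  refine (Finset.abs_sum_le_sum_abs _ _).trans
    (sum_lattice_le Zs _ (by positivity) (fun z => ?_) fun z s hs1 I hI hIc hsep => ?_)
  · have h := abs_setCumulant_le hκ hc (hm z) hu
    rw [Finset.card_univ, Fintype.card_fin] at h
    exact h.trans (le_mul_of_one_le_left (by positivity) hM)
  · have h := abs_setCumulant_le_of_split (m := fun A => ∫ ω, ∏ i ∈ A, Y (z i) ω ∂P) hκ hc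
      (by positivity) (by simp) (hm z) (hs z s hs1 I hsep) (A := Finset.univ)
      (by simpa using hI) (by simpa [Finset.compl_eq_univ_sdiff] using hIc)
    rw [Finset.card_univ, Fintype.card_fin] at h
    exact h.trans_eq (by ring)

end CumulantBound

/-! ### Truncation of the score -/

section Stabilization

variable {d : ℕ} {ξ : EuclideanSpace ℝ (Fin d) → Config d → ℝ}

theorem Config.restrict_restrict_of_subset (X : Config d)
    {s t : Set (EuclideanSpace ℝ (Fin d))} (h : s ⊆ t) :
    (X.restrict t).restrict s = X.restrict s := by
  ext x
  simp only [Config.restrict, Set.mem_inter_iff]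
  exact ⟨fun hx => ⟨hx.1.1, hx.2⟩, fun hx => ⟨⟨hx.1, h hx.2⟩, hx.2⟩⟩

theorem Config.restrict_comm (X : Config d) (s t : Set (EuclideanSpace ℝ (Fin d))) :
    (X.restrict t).restrict s = (X.restrict s).restrict t := by
  ext x
  simp only [Config.restrict, Set.mem_inter_iff]
  tauto

theorem StabilizesAt.eq_restrict {x : EuclideanSpace ℝ (Fin d)} {X : Config d} {r : ℝ≥0}
    (h : StabilizesAt ξ x X r) : ξ x X = ξ x (X.restrict (Metric.closedBall x r)) := by
  rw [← h X]
  congr 1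
  ext y
  simp only [Config.union, Config.restrict, Set.inter_union_compl]

theorem stabilizesAt_restrict_iff {x : EuclideanSpace ℝ (Fin d)} {X : Config d} {r' : ℝ≥0}
    {r : ℝ} (h : (r' : ℝ) ≤ r) :
    StabilizesAt ξ x (X.restrict (Metric.closedBall x r)) r' ↔ StabilizesAt ξ x X r' := by
  rw [StabilizesAt, StabilizesAt,
    X.restrict_restrict_of_subset (Metric.closedBall_subset_closedBall h)]

/-- The infimum need not be attained, so truncation uses the strict inequality: it provides an
actual stabilization radius `r' < r`. -/
theorem stabRadius_lt_iff {x : EuclideanSpace ℝ (Fin d)} {X : Config d} {r : ℝ} :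
    stabRadius ξ x X < ENNReal.ofReal r ↔ ∃ r' : ℝ≥0, StabilizesAt ξ x X r' ∧ (r' : ℝ) < r := by
  simp only [stabRadius, iInf_lt_iff, exists_prop]
  refine exists_congr fun r' => and_congr_right fun _ => ?_
  rw [← ENNReal.ofReal_coe_nnreal, ENNReal.ofReal_lt_ofReal_iff']
  exact ⟨fun h => h.1, fun h => ⟨h, r'.2.trans_lt h⟩⟩

open Classical in
/-- The score, cut off at large values and at large radii of stabilization. -/
noncomputable def truncScore (ξ : EuclideanSpace ℝ (Fin d) → Config d → ℝ) (r T : ℝ)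
    (x : EuclideanSpace ℝ (Fin d)) (X : Config d) : ℝ :=
  if stabRadius ξ x X < ENNReal.ofReal r ∧ |ξ x X| ≤ T then ξ x X else 0

theorem abs_truncScore_le {r T : ℝ} (hT : 0 ≤ T) (x : EuclideanSpace ℝ (Fin d)) (X : Config d) :
    |truncScore ξ r T x X| ≤ T := by
  unfold truncScore
  split_ifs with h
  · exact h.2
  · simpa using hT

theorem abs_truncScore_le_abs {r T : ℝ} (x : EuclideanSpace ℝ (Fin d)) (X : Config d) :
    |truncScore ξ r T x X| ≤ |ξ x X| := by
  unfold truncScore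
  split_ifs with h
  · exact le_rfl
  · simp

/-- Stabilization at some `r' < r` is a property of the configuration in `B_r(x)`, and it also makes
the value of the score a function of that configuration. Truncation thus turns a stabilizing score
into one of finite range `r`. -/
theorem truncScore_restrict {r T : ℝ} (x : EuclideanSpace ℝ (Fin d)) (X : Config d) :
    truncScore ξ r T x (X.restrict (Metric.closedBall x r)) = truncScore ξ r T x X := by
  have h1 : stabRadius ξ x (X.restrict (Metric.closedBall x r)) < ENNReal.ofReal r
      ↔ stabRadius ξ x X < ENNReal.ofReal r := by
    rw [stabRadius_lt_iff, stabRadius_lt_iff]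
    exact exists_congr fun r' => ⟨fun h => ⟨(stabilizesAt_restrict_iff h.2.le).1 h.1, h.2⟩,
      fun h => ⟨(stabilizesAt_restrict_iff h.2.le).2 h.1, h.2⟩⟩
  by_cases h : stabRadius ξ x X < ENNReal.ofReal r
  · obtain ⟨r', hr', hlt⟩ := stabRadius_lt_iff.1 h
    have h2 := hr'.eq_restrict
    have h3 := ((stabilizesAt_restrict_iff hlt.le).2 hr').eq_restrict
    rw [X.restrict_restrict_of_subset (Metric.closedBall_subset_closedBall hlt.le)] at h3
    simp only [truncScore, h1, h3, ← h2]
  · simp only [truncScore, h1, h, false_and, if_false]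

theorem measurable_truncScore (hξ : Measurable (Function.uncurry ξ))
    (hR : Measurable (Function.uncurry (stabRadius ξ))) (r T : ℝ) :
    Measurable (Function.uncurry (truncScore ξ r T)) := by
  refine Measurable.ite ?_ hξ measurable_const
  exact (measurableSet_lt hR measurable_const).inter (measurableSet_le hξ.abs measurable_const)

end Stabilization

/-! ### Sums of scores in unit cubes as local functionals -/

section CubeSums

variable {d : ℕ}

/-- The sum of a score over the points in a unit cube. -/
noncomputable def cubeSum (W : Set (EuclideanSpace ℝ (Fin d))) (z : Fin d → ℤ)
    (h : EuclideanSpace ℝ (Fin d) → Config d → ℝ) (X : Config d) : ℝ :=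
  ∑ x ∈ X.pts (unitCube z ∩ W), h x (X.restrict W)

variable {W : Set (EuclideanSpace ℝ (Fin d))} {h : EuclideanSpace ℝ (Fin d) → Config d → ℝ}

theorem isBounded_unitCube_inter (z : Fin d → ℤ) (W : Set (EuclideanSpace ℝ (Fin d))) :
    Bornology.IsBounded (unitCube z ∩ W) := (isBounded_unitCube z).subset Set.inter_subset_left

theorem measurable_uncurry_restrict (hW : MeasurableSet W) {β : Type*} [MeasurableSpace β]
    {h : EuclideanSpace ℝ (Fin d) → Config d → β}
    (hh : Measurable (Function.uncurry h)) :
    Measurable (Function.uncurry fun x (X : Config d) => h x (X.restrict W)) :=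
  hh.comp (measurable_fst.prodMk ((Config.measurable_restrict hW).comp measurable_snd))

theorem measurable_cubeSum (hW : MeasurableSet W) (hh : Measurable (Function.uncurry h))
    (z : Fin d → ℤ) : Measurable (cubeSum W z h) :=
  Config.measurable_sum_pts (isBounded_unitCube_inter z W) ((measurableSet_unitCube z).inter hW)
    (g := fun X x => h x (X.restrict W))
    ((measurable_uncurry_restrict hW hh).comp measurable_swap)

theorem cubeSum_restrict {r : ℝ} (hr : 0 ≤ r) {A : Set (EuclideanSpace ℝ (Fin d))} {z : Fin d → ℤ}
    (hA : enlargedCube z r ⊆ A)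
    (hloc : ∀ x X, h x (X.restrict (Metric.closedBall x r)) = h x X) (X : Config d) :
    cubeSum W z h (X.restrict A) = cubeSum W z h X := by
  have hp : (X.restrict A).pts (unitCube z ∩ W) = X.pts (unitCube z ∩ W) := by
    ext x
    rw [Config.mem_pts (isBounded_unitCube_inter z W), Config.mem_pts (isBounded_unitCube_inter z W)]
    exact ⟨fun hx => ⟨hx.1.1, hx.2⟩,
      fun hx => ⟨⟨hx.1, hA (unitCube_subset_enlargedCube z hr hx.2.1)⟩, hx.2⟩⟩
  rw [cubeSum, cubeSum, hp]
  refine Finset.sum_congr rfl fun x hx => ?_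
  rw [Config.mem_pts (isBounded_unitCube_inter z W)] at hx
  rw [← hloc x ((X.restrict A).restrict W), ← hloc x (X.restrict W),
    (X.restrict A).restrict_comm (Metric.closedBall x r) W,
    X.restrict_restrict_of_subset ((closedBall_subset_enlargedCube hx.2.1).trans hA),
    X.restrict_comm (Metric.closedBall x r) W]

theorem abs_cubeSum_le {M : ℝ} (hM : ∀ x X, |h x X| ≤ M) (z : Fin d → ℤ) (X : Config d) :
    |cubeSum W z h X| ≤ M * (X.pts (unitCube z ∩ W)).card := by
  refine (Finset.abs_sum_le_sum_abs _ _).trans ((Finset.sum_le_sum fun x _ => hM x _).trans_eq ?_)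
  rw [Finset.sum_const, nsmul_eq_mul, mul_comm]

theorem isLocal_prod_cubeSum {ι : Type*} (hW : MeasurableSet W)
    (hh : Measurable (Function.uncurry h)) {r : ℝ} (hr : 0 ≤ r)
    (hloc : ∀ x X, h x (X.restrict (Metric.closedBall x r)) = h x X) {M : ℝ} (hM0 : 0 ≤ M)
    (hM : ∀ x X, |h x X| ≤ M) (z : ι → Fin d → ℤ) (I : Finset ι) :
    Config.IsLocal (fun X => ∏ i ∈ I, cubeSum W (z i) h X) (⋃ i ∈ I, enlargedCube (z i) r)
      (M ^ I.card * (I.card ! : ℝ)) where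
  measurable := Finset.measurable_prod _ fun i _ => measurable_cubeSum hW hh (z i)
  bounded := (Bornology.isBounded_biUnion_finset I).2 fun i _ => isBounded_enlargedCube _ _
  measurableSet := I.measurableSet_biUnion fun i _ => measurableSet_enlargedCube _ _
  nonneg := by positivity
  restrict X := Finset.prod_congr rfl fun i hi => cubeSum_restrict hr
    (Set.subset_biUnion_of_mem (u := fun i => enlargedCube (z i) r) (Finset.mem_coe.2 hi)) hloc X
  abs_le X := by
    have hb : Bornology.IsBounded (⋃ i ∈ I, enlargedCube (z i) r) :=
      (Bornology.isBounded_biUnion_finset I).2 fun i _ => isBounded_enlargedCube _ _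
    set N := (X.pts (⋃ i ∈ I, enlargedCube (z i) r)).card
    rw [Finset.abs_prod]
    calc ∏ i ∈ I, |cubeSum W (z i) h X| ≤ ∏ _i ∈ I, M * (N : ℝ) := by
          refine Finset.prod_le_prod (fun i _ => abs_nonneg _) fun i hi => ?_
          refine (abs_cubeSum_le hM (z i) X).trans ?_
          gcongr
          refine Finset.card_le_card fun x hx => ?_
          rw [Config.mem_pts (isBounded_unitCube_inter _ W)] at hx
          rw [Config.mem_pts hb]
          exact ⟨hx.1, Set.mem_biUnion (Finset.mem_coe.2 hi)
            (unitCube_subset_enlargedCube _ hr hx.2.1)⟩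
      _ = M ^ I.card * (N : ℝ) ^ I.card := by rw [Finset.prod_const, mul_pow]
      -- The inequality `N^j ≤ j! exp N` trades the power of the number of points for a factorial
      -- and an exponential, as `IsLocal` requires.
      _ ≤ M ^ I.card * (I.card ! * Real.exp N) := by
          gcongr
          have := Real.pow_div_factorial_le_exp (N : ℝ) (by positivity) I.card
          rw [div_le_iff₀ (by positivity)] at this
          linarith
      _ = _ := by ring

theorem volume_iUnion_enlargedCube_le {ι : Type*} (z : ι → Fin d → ℤ) (I : Finset ι) {r : ℝ}
    (hr : 0 ≤ r) :
    volume (⋃ i ∈ I, enlargedCube (z i) r) ≤ ENNReal.ofReal (I.card * (1 + 2 * r) ^ d) := by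
  refine (measure_biUnion_finset_le I _).trans ?_
  simp_rw [volume_enlargedCube _ hr]
  rw [Finset.sum_const, nsmul_eq_mul, ENNReal.ofReal_mul (by positivity), ENNReal.ofReal_natCast]

theorem dist_enlargedCube_ge {z w : Fin d → ℤ} {s : ℕ} {r : ℝ}
    (h : ∃ e, (s : ℤ) ≤ |z e - w e|) {x y : EuclideanSpace ℝ (Fin d)}
    (hx : x ∈ enlargedCube z r) (hy : y ∈ enlargedCube w r) : (s : ℝ) - 1 - 2 * r ≤ dist x y := by
  obtain ⟨e, he⟩ := h
  have h1 : |x e - y e| ≤ dist x y := by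
    have := PiLp.norm_apply_le (x - y) e
    rw [Real.norm_eq_abs] at this
    exact this.trans (by rw [dist_eq_norm])
  have h2 : (s : ℝ) ≤ |(z e : ℝ) - w e| := by exact_mod_cast he
  have h3 := hx e
  have h4 := hy e
  rw [Set.mem_Icc] at h3 h4
  refine le_trans ?_ h1
  rcases le_abs.1 h2 with h5 | h5
  · exact le_trans (by linarith) (le_abs_self _)
  · exact le_trans (by linarith) (neg_le_abs _)

end CubeSums

/-! ### Expectations through one-point Palm distributions -/

section PalmBounds

variable {d : ℕ} {P : Measure (Config d)}
  {ρ : (p : ℕ) → (Fin p → EuclideanSpace ℝ (Fin d)) → ℝ}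
  {Q : (p : ℕ) → Kernel (Fin p → EuclideanSpace ℝ (Fin d)) (Config d)}

theorem integrable_and_integral_le_of_lintegral_le {Ω : Type*} [MeasurableSpace Ω]
    {μ : Measure Ω} {f : Ω → ℝ} (hf : Measurable f) (h0 : ∀ ω, 0 ≤ f ω) {M : ℝ} (hM : 0 ≤ M)
    (h : ∫⁻ ω, ENNReal.ofReal (f ω) ∂μ ≤ ENNReal.ofReal M) :
    Integrable f μ ∧ ∫ ω, f ω ∂μ ≤ M := by
  refine ⟨⟨hf.aestronglyMeasurable, ?_⟩, ?_⟩
  · rw [hasFiniteIntegral_iff_ofReal (Filter.Eventually.of_forall h0)]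
    exact h.trans_lt ENNReal.ofReal_lt_top
  · rw [integral_eq_lintegral_of_nonneg_ae (Filter.Eventually.of_forall h0)
      hf.aestronglyMeasurable]
    exact ENNReal.toReal_le_of_le_ofReal hM h

/-- The refined Campbell formula with one point, `ρ^(1) ≤ C` and `volume A ≤ 1`. Where `ρ^(1)`
vanishes nothing is known about the Palm distribution, but the integrand vanishes too. -/
theorem IsPalmFamily.lintegral_sum_pts_le (hQ : IsPalmFamily P ρ Q) {a a' C c : ℝ}
    (hb : CorrelationBound ρ a a' C c) {A : Set (EuclideanSpace ℝ (Fin d))}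
    (hA : Bornology.IsBounded A) (hAm : MeasurableSet A) (hA1 : volume A ≤ 1)
    {g : EuclideanSpace ℝ (Fin d) → Config d → ℝ≥0∞} (hg : Measurable (Function.uncurry g))
    {M : ℝ} (hM0 : 0 ≤ M)
    (hM : ∀ᵐ u : Fin 1 → EuclideanSpace ℝ (Fin d), u 0 ∈ A → 0 < ρ 1 u →
      ∫⁻ X, g (u 0) X ∂(Q 1 u) ≤ ENNReal.ofReal M) :
    ∫⁻ X, ∑ x ∈ X.pts A, g x X ∂P ≤ ENNReal.ofReal (M * C) := by
  have h1 : ∀ X : Config d, ∑ x ∈ X.pts A, g x X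
      = ∑' u : X.distinctTuples 1, A.indicator (fun x => g x X) (u.1 0) := by
    intro X
    rw [Config.tsum_distinctTuples_one X (A.indicator fun x => g x X),
      Config.tsum_carrier_indicator X hA]
  simp_rw [h1]
  have hgm : Measurable (Function.uncurry fun (u : Fin 1 → EuclideanSpace ℝ (Fin d))
      (X : Config d) => A.indicator (fun x => g x X) (u 0)) := by
    have : (Function.uncurry fun (u : Fin 1 → EuclideanSpace ℝ (Fin d))
        (X : Config d) => A.indicator (fun x => g x X) (u 0))
        = ((fun q : (Fin 1 → EuclideanSpace ℝ (Fin d)) × Config d => q.1 0) ⁻¹' A).indicator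
          (fun q => g (q.1 0) q.2) := by
      ext q
      by_cases hq : q.1 0 ∈ A
      · have hq' : q ∈ (fun q : (Fin 1 → EuclideanSpace ℝ (Fin d)) × Config d => q.1 0) ⁻¹' A := hq
        simp only [Function.uncurry_def, Set.indicator_of_mem hq, Set.indicator_of_mem hq']
      · have hq' : q ∉ (fun q : (Fin 1 → EuclideanSpace ℝ (Fin d)) × Config d => q.1 0) ⁻¹' A := hq
        simp only [Function.uncurry_def, Set.indicator_of_notMem hq, Set.indicator_of_notMem hq']
    rw [this]
    refine Measurable.indicator ?_ (((measurable_pi_apply 0).comp measurable_fst) hAm)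
    exact hg.comp (f := fun q : (Fin 1 → EuclideanSpace ℝ (Fin d)) × Config d => (q.1 0, q.2))
      (((measurable_pi_apply 0).comp measurable_fst).prodMk measurable_snd)
  rw [hQ.refined_campbell 1 _ hgm]
  have hS : MeasurableSet {u : Fin 1 → EuclideanSpace ℝ (Fin d) | ∀ i, u i ∈ A} :=
    measurableSet_forall_mem hAm 1
  calc ∫⁻ u, (∫⁻ X, A.indicator (fun x => g x X) (u 0) ∂(Q 1 u)) * ENNReal.ofReal (ρ 1 u)
      ≤ ∫⁻ u, {u : Fin 1 → EuclideanSpace ℝ (Fin d) | ∀ i, u i ∈ A}.indicator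
          (fun _ => ENNReal.ofReal (M * C)) u := by
        refine lintegral_mono_ae ?_
        filter_upwards [hM, hb.le 1] with u hu hu'
        by_cases huA : u 0 ∈ A
        · have : u ∈ {u : Fin 1 → EuclideanSpace ℝ (Fin d) | ∀ i, u i ∈ A} := fun i => by
            rw [Subsingleton.elim i 0]; exact huA
          rw [Set.indicator_of_mem this]
          simp only [Set.indicator_of_mem huA]
          rcases le_or_gt (ρ 1 u) 0 with h0 | h0
          · rw [ENNReal.ofReal_of_nonpos h0, mul_zero]
            exact zero_le
          · rw [ENNReal.ofReal_mul hM0]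
            refine mul_le_mul' (hu huA h0) (ENNReal.ofReal_le_ofReal ?_)
            simpa using hu'
        · simp [Set.indicator_of_notMem huA]
    _ = ENNReal.ofReal (M * C) * volume A := by
        rw [lintegral_indicator hS, setLIntegral_const, volume_forall_mem, pow_one]
    _ ≤ ENNReal.ofReal (M * C) := mul_le_of_le_one_right' hA1

theorem volume_unitCube_inter_le (z : Fin d → ℤ) (W : Set (EuclideanSpace ℝ (Fin d))) :
    volume (unitCube z ∩ W) ≤ 1 := by
  refine (measure_mono (Set.inter_subset_left.trans
    (unitCube_subset_enlargedCube z le_rfl))).trans ?_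
  rw [volume_enlargedCube z le_rfl]
  simp

/-- The exponential of the number of points is itself a local functional with `K = 1`, so that its
moment is controlled by the factorial moment expansion. -/
theorem IsCorrelationFamily.integral_exp_card_pts_le (hρ : IsCorrelationFamily P ρ)
    [IsProbabilityMeasure P] {a a' C c : ℝ} (ha : a < 1)
    (hb : CorrelationBound ρ a a' C c) {A : Set (EuclideanSpace ℝ (Fin d))}
    (hA : Bornology.IsBounded A) (hAm : MeasurableSet A) (hA1 : volume A ≤ 1) :
    Integrable (fun X : Config d => Real.exp (X.pts A).card) P ∧
      ∫ X, Real.exp (X.pts A).card ∂P ≤ ∑' l, factTerm a (4 * Real.exp 1 * C) l := by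
  have hF : Config.IsLocal (fun X : Config d => Real.exp (X.pts A).card) A 1 :=
    { measurable := by
        have : Measurable fun X : Config d => ∑ x ∈ X.pts A, (1 : ℝ) :=
          Config.measurable_sum_pts hA hAm (g := fun _ _ => 1) measurable_const
        simpa using this.exp
      bounded := hA
      measurableSet := hAm
      nonneg := zero_le_one
      restrict := fun X => by
        have : (X.restrict A).pts A = X.pts A := by
          ext x
          rw [Config.mem_pts hA, Config.mem_pts hA]
          exact ⟨fun h => ⟨h.1.1, h.2⟩, fun h => ⟨⟨h.1, h.2⟩, h.2⟩⟩
        simp only [this]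
      abs_le := fun X => by rw [Real.abs_exp, one_mul] }
  obtain ⟨h1, -, h3⟩ := hF.integrable (P := P) hρ ha hb (V := 1) zero_le_one (by simpa using hA1)
  refine ⟨h1, ?_⟩
  simpa [Real.abs_exp] using h3

end PalmBounds

/-! ### Moment bounds for random sums and products -/

section Moments

/-- The power mean inequality, followed by the weighted inequality between arithmetic and geometric
mean. The number of terms and their sizes are separated without any independence, at the price of
the doubled exponent; the weight `t` is free. -/
theorem Finset.sum_pow_le_half {ι : Type*} (s : Finset ι) {f : ι → ℝ} (hf : ∀ i ∈ s, 0 ≤ f i)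
    {m : ℕ} (hm : 1 ≤ m) {t : ℝ} (ht : 0 < t) :
    (∑ i ∈ s, f i) ^ m
      ≤ (t * (s.card : ℝ) ^ (2 * m) + t⁻¹ * ∑ i ∈ s, f i ^ (2 * m)) / 2 := by
  obtain ⟨n, rfl⟩ : ∃ n, m = n + 1 := ⟨m - 1, by omega⟩
  rcases s.eq_empty_or_nonempty with rfl | hs
  · simp
  have hc : (1 : ℝ) ≤ s.card := by exact_mod_cast hs.card_pos
  have h1 := pow_sum_div_card_le_sum_pow hf n
  rw [div_le_iff₀ (by positivity)] at h1
  have h2 : ∀ i ∈ s, f i ^ (n + 1) * (s.card : ℝ) ^ n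
      ≤ (t * ((s.card : ℝ) ^ n) ^ 2 + t⁻¹ * f i ^ (2 * (n + 1))) / 2 := by
    intro i _
    have h3 : 0 ≤ t⁻¹ * (t * (s.card : ℝ) ^ n - f i ^ (n + 1)) ^ 2 := by positivity
    have h4 : t⁻¹ * (t * (s.card : ℝ) ^ n - f i ^ (n + 1)) ^ 2
        = t * ((s.card : ℝ) ^ n) ^ 2 - 2 * (f i ^ (n + 1) * (s.card : ℝ) ^ n)
          + t⁻¹ * f i ^ (2 * (n + 1)) := by
      field_simp
      ring
    linarith
  refine h1.trans ?_
  rw [Finset.sum_mul]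
  refine (Finset.sum_le_sum h2).trans ?_
  rw [← Finset.sum_div, Finset.sum_add_distrib, Finset.sum_const, ← Finset.mul_sum, nsmul_eq_mul]
  have h5 : (s.card : ℝ) * (t * ((s.card : ℝ) ^ n) ^ 2) ≤ t * (s.card : ℝ) ^ (2 * (n + 1)) := by
    have : (s.card : ℝ) ^ (2 * (n + 1)) = s.card * (s.card * ((s.card : ℝ) ^ n) ^ 2) := by ring
    rw [this]
    have h6 : (s.card : ℝ) * (1 * ((s.card : ℝ) ^ n) ^ 2) ≤ s.card * (s.card * ((s.card : ℝ) ^ n) ^ 2) := by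
      gcongr
    calc _ = t * ((s.card : ℝ) * (1 * ((s.card : ℝ) ^ n) ^ 2)) := by ring
      _ ≤ _ := by gcongr
  gcongr

theorem factorial_two_mul_le (m : ℕ) : ((2 * m)! : ℝ) ≤ 4 ^ m * (m ! : ℝ) ^ 2 := by
  have h1 : (2 * m).choose m * m ! * (2 * m - m)! = (2 * m)! :=
    Nat.choose_mul_factorial_mul_factorial (by omega)
  have h2 : (2 * m).choose m ≤ 4 ^ m := by
    calc (2 * m).choose m ≤ 2 ^ (2 * m) := Nat.choose_le_two_pow _ _
      _ = 4 ^ m := by rw [pow_mul]; norm_num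
  rw [show 2 * m - m = m by omega] at h1
  rw [← h1]
  push_cast
  have h3 : ((2 * m).choose m : ℝ) ≤ 4 ^ m := by exact_mod_cast h2
  calc _ ≤ (4 : ℝ) ^ m * (m !) * (m !) := by gcongr
    _ = _ := by ring

theorem factorial_two_mul_rpow_le (m : ℕ) {κ : ℝ} (hκ : 0 ≤ κ) :
    ((2 * m)! : ℝ) ^ κ ≤ (4 ^ κ) ^ m * ((m ! : ℝ) ^ κ) ^ 2 := by
  calc ((2 * m)! : ℝ) ^ κ ≤ (4 ^ m * (m ! : ℝ) ^ 2) ^ κ := by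
        gcongr
        exact factorial_two_mul_le m
    _ = _ := by
        rw [Real.mul_rpow (by positivity) (by positivity), ← Real.rpow_natCast,
          ← Real.rpow_natCast, ← Real.rpow_mul (by positivity), ← Real.rpow_mul (by positivity),
          ← Real.rpow_natCast, ← Real.rpow_natCast, ← Real.rpow_mul (by positivity),
          ← Real.rpow_mul (by positivity), mul_comm κ, mul_comm κ]

variable {Ω : Type*} [MeasurableSpace Ω] {P : Measure Ω}

theorem integral_pow_le_of_half {U : Ω → ℝ} (hU : Measurable U) (hU0 : ∀ ω, 0 ≤ U ω)
    {N : Ω → ℕ} {S : ℕ → Ω → ℝ}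
    (hUS : ∀ m : ℕ, 1 ≤ m → ∀ t : ℝ, 0 < t → ∀ ω,
      U ω ^ m ≤ (t * (N ω : ℝ) ^ (2 * m) + t⁻¹ * S (2 * m) ω) / 2)
    {L C β : ℝ} (hL : 1 ≤ L) (hC : 1 ≤ C) (hβ : 0 ≤ β)
    (hN : Integrable (fun ω => Real.exp (N ω)) P) (hNL : ∫ ω, Real.exp (N ω) ∂P ≤ L)
    (hS : ∀ m, 1 ≤ m → Integrable (S m) P ∧ ∫ ω, S m ω ∂P ≤ C ^ m * (m ! : ℝ) ^ β)
    {m : ℕ} (hm : 1 ≤ m) :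
    Integrable (fun ω => U ω ^ m) P ∧
      ∫ ω, U ω ^ m ∂P ≤ (L * C ^ 2 * 2 ^ (1 + β)) ^ m * (m ! : ℝ) ^ (1 + β) := by
  obtain ⟨hSi, hSl⟩ := hS (2 * m) (by omega)
  have hf : (0 : ℝ) < (2 * m)! := by positivity
  -- This weight balances the two terms, `t (2m)! = t⁻¹ (2m)!^β = (2m)!^((1+β)/2)`, and the latter
  -- is at most `C^m m!^(1+β)`.
  set t : ℝ := ((2 * m)! : ℝ) ^ ((β - 1) / 2) with ht
  have ht0 : 0 < t := by positivity
  have hle : ∀ ω, U ω ^ m ≤ (t * ((2 * m)! * Real.exp (N ω)) + t⁻¹ * S (2 * m) ω) / 2 := by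
    intro ω
    refine (hUS m hm t ht0 ω).trans ?_
    have h1 := Real.pow_div_factorial_le_exp (N ω : ℝ) (by positivity) (2 * m)
    rw [div_le_iff₀ hf] at h1
    have h2 : (N ω : ℝ) ^ (2 * m) ≤ (2 * m)! * Real.exp (N ω) := by linarith
    gcongr
  have hi : Integrable (fun ω => (t * ((2 * m)! * Real.exp (N ω)) + t⁻¹ * S (2 * m) ω) / 2) P :=
    (((hN.const_mul _).const_mul _).add (hSi.const_mul _)).div_const _
  have hint : Integrable (fun ω => U ω ^ m) P := by
    refine hi.mono' (hU.pow_const m).aestronglyMeasurable (Filter.Eventually.of_forall fun ω => ?_)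
    rw [Real.norm_of_nonneg (pow_nonneg (hU0 ω) m)]
    exact hle ω
  refine ⟨hint, (integral_mono hint hi hle).trans ?_⟩
  rw [integral_div, integral_add ((hN.const_mul _).const_mul _) (hSi.const_mul _),
    integral_const_mul, integral_const_mul, integral_const_mul]
  have e1 : t * (2 * m)! = ((2 * m)! : ℝ) ^ ((1 + β) / 2) := by
    rw [ht, ← Real.rpow_add_one hf.ne']
    congr 1; ring
  have e2 : t⁻¹ * ((2 * m)! : ℝ) ^ β = ((2 * m)! : ℝ) ^ ((1 + β) / 2) := by
    rw [ht, ← Real.rpow_neg hf.le, ← Real.rpow_add hf]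
    congr 1; ring
  have e3 : ((2 * m)! : ℝ) ^ ((1 + β) / 2) ≤ (2 ^ (1 + β)) ^ m * (m ! : ℝ) ^ (1 + β) := by
    refine (factorial_two_mul_rpow_le m (by linarith)).trans_eq ?_
    congr 1
    · congr 1
      rw [show (4 : ℝ) = 2 ^ (2 : ℝ) by norm_num, ← Real.rpow_mul (by norm_num)]
      congr 1; ring
    · rw [← Real.rpow_natCast, ← Real.rpow_mul (by positivity)]
      congr 1; push_cast; ring
  have hLC : L + C ^ (2 * m) ≤ 2 * (L ^ m * (C ^ 2) ^ m) := by
    have h1 : L ≤ L ^ m := le_self_pow₀ hL (by omega)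
    have h2 : 1 ≤ C ^ (2 * m) := one_le_pow₀ hC
    have h3 : 1 ≤ L ^ m := one_le_pow₀ hL
    rw [← pow_mul]
    nlinarith
  calc (t * (((2 * m)! : ℝ) * ∫ ω, Real.exp (N ω) ∂P) + t⁻¹ * ∫ ω, S (2 * m) ω ∂P) / 2
      ≤ (t * (((2 * m)! : ℝ) * L) + t⁻¹ * (C ^ (2 * m) * ((2 * m)! : ℝ) ^ β)) / 2 := by
        gcongr
    _ = (L + C ^ (2 * m)) / 2 * ((2 * m)! : ℝ) ^ ((1 + β) / 2) := by
        calc _ = ((t * (2 * m)!) * L + C ^ (2 * m) * (t⁻¹ * ((2 * m)! : ℝ) ^ β)) / 2 := by ring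
          _ = _ := by rw [e1, e2]; ring
    _ ≤ (L ^ m * (C ^ 2) ^ m) * ((2 ^ (1 + β)) ^ m * (m ! : ℝ) ^ (1 + β)) := by
        gcongr
        linarith
    _ = _ := by rw [mul_pow, mul_pow]; ring

theorem Finset.prod_le_sum_pow {ι : Type*} {I : Finset ι} (hI : I.Nonempty) {y : ι → ℝ}
    (hy : ∀ i, 0 ≤ y i) : ∏ i ∈ I, y i ≤ ∑ i ∈ I, y i ^ I.card := by
  obtain ⟨j, hj, hmax⟩ := I.exists_max_image y hI
  calc ∏ i ∈ I, y i ≤ ∏ _i ∈ I, y j := Finset.prod_le_prod (fun i _ => hy i) hmax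
    _ = y j ^ I.card := by rw [Finset.prod_const]
    _ ≤ _ := Finset.single_le_sum (f := fun i => y i ^ I.card)
        (fun i _ => pow_nonneg (hy i) _) hj

/-- Moment bounds for products and squares of products. -/
theorem integral_prod_le_of_integral_pow_le [IsProbabilityMeasure P] {ι : Type*} {U : ι → Ω → ℝ}
    (hU : ∀ i, Measurable (U i)) (hU0 : ∀ i ω, 0 ≤ U i ω) {c κ : ℝ} (hc : 1 ≤ c) (hκ : 0 ≤ κ)
    (h : ∀ i m, 1 ≤ m → Integrable (fun ω => U i ω ^ m) P ∧
      ∫ ω, U i ω ^ m ∂P ≤ c ^ m * (m ! : ℝ) ^ κ) (I : Finset ι) :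
    Integrable (fun ω => ∏ i ∈ I, U i ω) P ∧ Integrable (fun ω => (∏ i ∈ I, U i ω) ^ 2) P ∧
      ∫ ω, (∏ i ∈ I, U i ω) ^ 2 ∂P ≤ ((2 * 4 ^ κ * c) ^ I.card * (I.card ! : ℝ) ^ κ) ^ 2 := by
  have hm : Measurable fun ω => ∏ i ∈ I, U i ω := Finset.measurable_prod _ fun i _ => hU i
  have key : Integrable (fun ω => (∏ i ∈ I, U i ω) ^ 2) P ∧
      ∫ ω, (∏ i ∈ I, U i ω) ^ 2 ∂P ≤ ((2 * 4 ^ κ * c) ^ I.card * (I.card ! : ℝ) ^ κ) ^ 2 := by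
    rcases I.eq_empty_or_nonempty with rfl | hI
    · simp
    have hcard : 1 ≤ I.card := hI.card_pos
    -- Bounding a product by the sum of the powers of its factors replaces Hölder's inequality; the
    -- cost is a factor `#I`.
    have hle : ∀ ω, (∏ i ∈ I, U i ω) ^ 2 ≤ ∑ i ∈ I, U i ω ^ (2 * I.card) := by
      intro ω
      rw [← Finset.prod_pow]
      refine (Finset.prod_le_sum_pow hI fun i => sq_nonneg _).trans_eq ?_
      simp_rw [pow_mul]
    have hi : Integrable (fun ω => ∑ i ∈ I, U i ω ^ (2 * I.card)) P :=
      integrable_finsetSum _ fun i _ => (h i _ (by omega)).1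
    have hint : Integrable (fun ω => (∏ i ∈ I, U i ω) ^ 2) P := by
      refine hi.mono' (hm.pow_const 2).aestronglyMeasurable (Filter.Eventually.of_forall fun ω => ?_)
      rw [Real.norm_of_nonneg (sq_nonneg _)]
      exact hle ω
    refine ⟨hint, (integral_mono hint hi hle).trans ?_⟩
    rw [integral_finsetSum _ fun i _ => (h i _ (by omega)).1]
    calc ∑ i ∈ I, ∫ ω, U i ω ^ (2 * I.card) ∂P
        ≤ ∑ _i ∈ I, c ^ (2 * I.card) * ((2 * I.card)! : ℝ) ^ κ :=
          Finset.sum_le_sum fun i _ => (h i _ (by omega)).2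
      _ = I.card * (c ^ (2 * I.card) * ((2 * I.card)! : ℝ) ^ κ) := by
          rw [Finset.sum_const, nsmul_eq_mul]
      _ ≤ (2 ^ 2) ^ I.card * (c ^ (2 * I.card) * ((4 ^ κ) ^ I.card
            * ((I.card ! : ℝ) ^ κ) ^ 2)) := by
          gcongr
          · have : I.card ≤ (2 ^ 2) ^ I.card :=
              (Nat.lt_pow_self (by norm_num)).le
            exact_mod_cast this
          · exact factorial_two_mul_rpow_le _ hκ
      _ ≤ (2 ^ 2) ^ I.card * (c ^ (2 * I.card) * (((4 ^ κ) ^ I.card) ^ 2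
            * ((I.card ! : ℝ) ^ κ) ^ 2)) := by
          gcongr
          exact le_self_pow₀ (one_le_pow₀ (Real.one_le_rpow (by norm_num) hκ)) two_ne_zero
      _ = _ := by
          rw [← pow_mul (2 : ℝ) 2 I.card, mul_pow, mul_pow, mul_pow, mul_pow]
          ring
  refine ⟨?_, key⟩
  refine ((integrable_const (1 : ℝ)).add key.1).mono' hm.aestronglyMeasurable
    (Filter.Eventually.of_forall fun ω => ?_)
  have h0 : 0 ≤ ∏ i ∈ I, U i ω := Finset.prod_nonneg fun i _ => hU0 i ω
  rw [Real.norm_of_nonneg h0, Pi.add_apply]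
  nlinarith [sq_nonneg (∏ i ∈ I, U i ω - 1)]

end Moments

/-! ### Comparison of mixed moments with truncated ones -/

section Truncation

variable {Ω : Type*} [MeasurableSpace Ω] {P : Measure Ω}

theorem Finset.abs_prod_le_pow_mul_prod {ι : Type*} (A : Finset ι) {y v : ι → ℝ} {F : ℝ}
    (h : ∀ i, |y i| ≤ F * v i) : |∏ i ∈ A, y i| ≤ F ^ A.card * ∏ i ∈ A, v i := by
  rw [Finset.abs_prod, ← Finset.prod_const, ← Finset.prod_mul_distrib]
  exact Finset.prod_le_prod (fun i _ => abs_nonneg _) fun i _ => h i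

theorem integrable_prod_of_abs_le {ι : Type*} {Y U : ι → Ω → ℝ} (hY : ∀ i, Measurable (Y i))
    {F : ℝ} (hYU : ∀ i ω, |Y i ω| ≤ F * U i ω) {A : Finset ι}
    (hU : Integrable (fun ω => ∏ i ∈ A, U i ω) P) : Integrable (fun ω => ∏ i ∈ A, Y i ω) P :=
  (hU.const_mul (F ^ A.card)).mono' (Finset.measurable_prod _ fun i _ => hY i).aestronglyMeasurable
    (Filter.Eventually.of_forall fun ω => Finset.abs_prod_le_pow_mul_prod A fun i => hYU i ω)

theorem integral_le_of_integral_sq_le [IsProbabilityMeasure P] {V : Ω → ℝ} (hV : Integrable V P)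
    (hV2 : Integrable (fun ω => V ω ^ 2) P) {u : ℝ} (hu : 0 < u)
    (h : ∫ ω, V ω ^ 2 ∂P ≤ u ^ 2) : ∫ ω, V ω ∂P ≤ u := by
  have hle : ∀ ω, V ω ≤ (2 * u)⁻¹ * V ω ^ 2 + u / 2 := by
    intro ω
    have h1 : 0 ≤ (2 * u)⁻¹ * (V ω - u) ^ 2 := by positivity
    have h2 : (2 * u)⁻¹ * (V ω - u) ^ 2 = (2 * u)⁻¹ * V ω ^ 2 - V ω + u / 2 := by
      field_simp
      ring
    linarith
  refine (integral_mono hV ((hV2.const_mul _).add (integrable_const _)) hle).trans ?_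
  simp only [Pi.add_apply]
  rw [integral_add (hV2.const_mul _) (integrable_const _), integral_const_mul]
  simp only [integral_const, probReal_univ, one_smul]
  have : (2 * u)⁻¹ * ∫ ω, V ω ^ 2 ∂P ≤ (2 * u)⁻¹ * u ^ 2 := by gcongr
  have h3 : (2 * u)⁻¹ * u ^ 2 = u / 2 := by field_simp
  linarith

/-- The products differ only on the union `B` of the exceptional events, by at most `2 F^|A| V` with
`V = ∏ U i`. There `2 V ≤ t V² + t⁻¹`, so that second moments of `V` and the probability of `B`
suffice, as in the Cauchy–Schwarz inequality; `t = p / u` is the optimal weight. -/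
theorem abs_integral_prod_sub_le [IsProbabilityMeasure P] {ι : Type*} {Y Y' U : ι → Ω → ℝ}
    (hY : ∀ i, Measurable (Y i)) (hY' : ∀ i, Measurable (Y' i)) {F : ℝ}
    (hYU : ∀ i ω, |Y i ω| ≤ F * U i ω) (hYU' : ∀ i ω, |Y' i ω| ≤ F * U i ω) (hF : 0 ≤ F)
    {b : ι → Set Ω} (hb : ∀ i, MeasurableSet (b i)) (hYb : ∀ i, ∀ ω ∉ b i, Y i ω = Y' i ω)
    {q p u : ℝ} (hq : ∀ i, P.real (b i) ≤ q) (hp : 0 < p) (hu : 0 < u) {A : Finset ι}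
    (hU : Integrable (fun ω => ∏ i ∈ A, U i ω) P)
    (hU2 : Integrable (fun ω => (∏ i ∈ A, U i ω) ^ 2) P)
    (hUu : ∫ ω, (∏ i ∈ A, U i ω) ^ 2 ∂P ≤ u ^ 2) (hqp : A.card * q ≤ p ^ 2) :
    |∫ ω, ∏ i ∈ A, Y i ω ∂P - ∫ ω, ∏ i ∈ A, Y' i ω ∂P| ≤ 2 * p * (F ^ A.card * u) := by
  set B : Set Ω := ⋃ i ∈ A, b i with hB
  have hBm : MeasurableSet B := A.measurableSet_biUnion fun i _ => hb i
  have hBp : P.real B ≤ p ^ 2 := by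
    refine (measureReal_biUnion_finset_le A b).trans (((Finset.sum_le_sum fun i _ => hq i)).trans ?_)
    rwa [Finset.sum_const, nsmul_eq_mul]
  set t := p / u with ht
  have ht0 : 0 < t := by positivity
  have hi : Integrable (fun ω => F ^ A.card * (t * (∏ i ∈ A, U i ω) ^ 2
      + t⁻¹ * B.indicator (fun _ => 1) ω)) P :=
    ((hU2.const_mul _).add (((integrable_const 1).indicator hBm).const_mul _)).const_mul _
  have hle : ∀ ω, |∏ i ∈ A, Y i ω - ∏ i ∈ A, Y' i ω| ≤ F ^ A.card * (t * (∏ i ∈ A, U i ω) ^ 2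
      + t⁻¹ * B.indicator (fun _ => 1) ω) := by
    intro ω
    by_cases hω : ω ∈ B
    · have h1 := Finset.abs_prod_le_pow_mul_prod A (fun i => hYU i ω)
      have h2 := Finset.abs_prod_le_pow_mul_prod A (fun i => hYU' i ω)
      have h3 := abs_sub (∏ i ∈ A, Y i ω) (∏ i ∈ A, Y' i ω)
      rw [Set.indicator_of_mem hω]
      set V := ∏ i ∈ A, U i ω
      have h4 : 0 ≤ t⁻¹ * (t * V - 1) ^ 2 := by positivity
      have h5 : t⁻¹ * (t * V - 1) ^ 2 = t * V ^ 2 + t⁻¹ * 1 - 2 * V := by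
        field_simp
        ring
      have h6 : F ^ A.card * (2 * V) ≤ F ^ A.card * (t * V ^ 2 + t⁻¹ * 1) := by
        gcongr
        linarith
      linarith
    · have : ∏ i ∈ A, Y i ω = ∏ i ∈ A, Y' i ω := by
        refine Finset.prod_congr rfl fun i hi => hYb i ω fun h => hω ?_
        exact Set.mem_biUnion (Finset.mem_coe.2 hi) h
      rw [this, sub_self, abs_zero, Set.indicator_of_notMem hω]
      positivity
  rw [← integral_sub (integrable_prod_of_abs_le hY hYU hU) (integrable_prod_of_abs_le hY' hYU' hU)]
  refine (abs_integral_le_integral_abs).trans ((integral_mono ((integrable_prod_of_abs_le hY hYU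
    hU).sub (integrable_prod_of_abs_le hY' hYU' hU)).abs hi hle).trans ?_)
  rw [integral_const_mul, integral_add (hU2.const_mul _)
    (((integrable_const 1).indicator hBm).const_mul _), integral_const_mul, integral_const_mul,
    integral_indicator_const _ hBm, smul_eq_mul, mul_one]
  calc F ^ A.card * (t * ∫ ω, (∏ i ∈ A, U i ω) ^ 2 ∂P + t⁻¹ * P.real B)
      ≤ F ^ A.card * (t * u ^ 2 + t⁻¹ * p ^ 2) := by gcongr
    _ = _ := by rw [ht]; field_simp; ring

open Finset in
theorem pow_mul_factorial_rpow_mul_le {ι : Type*} [DecidableEq ι] {c κ : ℝ} (hc : 0 ≤ c)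
    (hκ : 0 ≤ κ) (A I : Finset ι) :
    (c ^ (A ∩ I).card * ((A ∩ I).card ! : ℝ) ^ κ) * (c ^ (A \ I).card * ((A \ I).card ! : ℝ) ^ κ)
      ≤ c ^ A.card * (A.card ! : ℝ) ^ κ := by
  have h1 : (A ∩ I).card + (A \ I).card = A.card := card_inter_add_card_sdiff A I
  have h2 : ((A ∩ I).card ! : ℝ) * ((A \ I).card ! : ℝ) ≤ (A.card ! : ℝ) := by
    rw [← h1]
    exact_mod_cast Nat.le_of_dvd (Nat.factorial_pos _) (Nat.factorial_mul_factorial_dvd_factorial_add _ _)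
  calc _ = c ^ A.card * (((A ∩ I).card ! : ℝ) * ((A \ I).card ! : ℝ)) ^ κ := by
        rw [Real.mul_rpow (by positivity) (by positivity), ← h1, pow_add]; ring
    _ ≤ _ := by gcongr

-- The passage from `m` to `m'` and back costs `2 p` for `m A` and `2 p` for each of the two
-- factors.
open Finset in
theorem abs_sub_mul_le_of_approx {ι : Type*} [DecidableEq ι] {m m' : Finset ι → ℝ} {c κ p : ℝ}
    (hc : 0 ≤ c) (hκ : 0 ≤ κ) (hp : 0 ≤ p) (hm : ∀ A, |m A| ≤ c ^ A.card * (A.card ! : ℝ) ^ κ)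
    (hm' : ∀ A, |m' A| ≤ c ^ A.card * (A.card ! : ℝ) ^ κ)
    (hd : ∀ A, |m A - m' A| ≤ 2 * p * (c ^ A.card * (A.card ! : ℝ) ^ κ)) (A I : Finset ι) {ε : ℝ}
    (hε : |m' A - m' (A ∩ I) * m' (A \ I)| ≤ ε) :
    |m A - m (A ∩ I) * m (A \ I)| ≤ 6 * p * (c ^ A.card * (A.card ! : ℝ) ^ κ) + ε := by
  have hmul := pow_mul_factorial_rpow_mul_le hc hκ A I
  set M := c ^ A.card * (A.card ! : ℝ) ^ κ
  have h1 : |m' (A ∩ I) * (m' (A \ I) - m (A \ I))| ≤ 2 * p * M := by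
    rw [abs_mul, abs_sub_comm]
    calc _ ≤ _ := mul_le_mul (hm' (A ∩ I)) (hd (A \ I)) (abs_nonneg _) (by positivity)
      _ = 2 * p * ((c ^ (A ∩ I).card * ((A ∩ I).card ! : ℝ) ^ κ)
          * (c ^ (A \ I).card * ((A \ I).card ! : ℝ) ^ κ)) := by ring
      _ ≤ _ := by gcongr
  have h2 : |(m' (A ∩ I) - m (A ∩ I)) * m (A \ I)| ≤ 2 * p * M := by
    rw [abs_mul, abs_sub_comm]
    calc _ ≤ _ := mul_le_mul (hd (A ∩ I)) (hm (A \ I)) (abs_nonneg _) (by positivity)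
      _ = 2 * p * ((c ^ (A ∩ I).card * ((A ∩ I).card ! : ℝ) ^ κ)
          * (c ^ (A \ I).card * ((A \ I).card ! : ℝ) ^ κ)) := by ring
      _ ≤ _ := by gcongr
  have h3 : m A - m (A ∩ I) * m (A \ I) = (m A - m' A) + (m' A - m' (A ∩ I) * m' (A \ I))
      + m' (A ∩ I) * (m' (A \ I) - m (A \ I)) + (m' (A ∩ I) - m (A ∩ I)) * m (A \ I) := by ring
  rw [h3]
  refine (abs_add_le _ _).trans ((add_le_add ((abs_add_le _ _).trans (add_le_add
    ((abs_add_le _ _).trans (add_le_add (hd A) hε)) h1)) h2).trans_eq ?_)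
  ring

end Truncation

/-! ### The event that truncation matters -/

section BadEvent

variable {d : ℕ} {ξ : EuclideanSpace ℝ (Fin d) → Config d → ℝ}

/-- An upper bound for the indicator of the event that the truncation affects the scores in a
unit cube. -/
noncomputable def truncDefect (W : Set (EuclideanSpace ℝ (Fin d)))
    (ξ : EuclideanSpace ℝ (Fin d) → Config d → ℝ) (r T : ℝ) (N m : ℕ) (z : Fin d → ℤ)
    (X : Config d) : ℝ≥0∞ :=
  ∑ x ∈ X.pts (unitCube z ∩ W), (stabRadius ξ x (X.restrict W) ^ N * ENNReal.ofReal (r⁻¹ ^ N)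
    + ‖ξ x (X.restrict W)‖ₑ ^ m * ENNReal.ofReal (T⁻¹ ^ m))

variable {W : Set (EuclideanSpace ℝ (Fin d))}

/-- A single point whose score is affected contributes at least `1` to the sum, through the `N`-th
power of the radius or the `m`-th power of the score. -/
theorem truncScore_eq_of_truncDefect_lt {r T : ℝ} (hr : 0 < r) (hT : 0 < T) {N m : ℕ}
    {z : Fin d → ℤ} {X : Config d} (h : truncDefect W ξ r T N m z X < 1)
    {x : EuclideanSpace ℝ (Fin d)} (hx : x ∈ X.pts (unitCube z ∩ W)) :
    truncScore ξ r T x (X.restrict W) = ξ x (X.restrict W) := by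
  have h1 := (Finset.single_le_sum (f := fun x => stabRadius ξ x (X.restrict W) ^ N
    * ENNReal.ofReal (r⁻¹ ^ N) + ‖ξ x (X.restrict W)‖ₑ ^ m * ENNReal.ofReal (T⁻¹ ^ m))
    (fun i _ => zero_le) hx).trans_lt h
  have h2 : stabRadius ξ x (X.restrict W) < ENNReal.ofReal r := by
    by_contra hle
    rw [not_lt] at hle
    refine h1.not_ge ?_
    calc (1 : ℝ≥0∞) = ENNReal.ofReal r ^ N * ENNReal.ofReal (r⁻¹ ^ N) := by
          rw [← ENNReal.ofReal_pow hr.le, ← ENNReal.ofReal_mul (by positivity), ← mul_pow,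
            mul_inv_cancel₀ hr.ne', one_pow, ENNReal.ofReal_one]
      _ ≤ stabRadius ξ x (X.restrict W) ^ N * ENNReal.ofReal (r⁻¹ ^ N) := by gcongr
      _ ≤ _ := le_self_add
  have h3 : |ξ x (X.restrict W)| ≤ T := by
    by_contra hle
    rw [not_le] at hle
    refine h1.not_ge ?_
    have h4 : ENNReal.ofReal T ≤ ‖ξ x (X.restrict W)‖ₑ := by
      rw [← ofReal_norm, Real.norm_eq_abs]
      exact ENNReal.ofReal_le_ofReal hle.le
    calc (1 : ℝ≥0∞) = ENNReal.ofReal T ^ m * ENNReal.ofReal (T⁻¹ ^ m) := by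
          rw [← ENNReal.ofReal_pow hT.le, ← ENNReal.ofReal_mul (by positivity), ← mul_pow,
            mul_inv_cancel₀ hT.ne', one_pow, ENNReal.ofReal_one]
      _ ≤ ‖ξ x (X.restrict W)‖ₑ ^ m * ENNReal.ofReal (T⁻¹ ^ m) := by gcongr
      _ ≤ _ := le_add_self
  exact if_pos ⟨h2, h3⟩

end BadEvent

section BadEventProbability

variable {d : ℕ} {P : Measure (Config d)}
  {ρ : (p : ℕ) → (Fin p → EuclideanSpace ℝ (Fin d)) → ℝ}
  {Q : (p : ℕ) → Kernel (Fin p → EuclideanSpace ℝ (Fin d)) (Config d)}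
  {ξ : EuclideanSpace ℝ (Fin d) → Config d → ℝ} {W : Set (EuclideanSpace ℝ (Fin d))}

theorem Config.measurable_sum_pts_ennreal {A : Set (EuclideanSpace ℝ (Fin d))}
    (hA : Bornology.IsBounded A) (hAm : MeasurableSet A)
    {g : EuclideanSpace ℝ (Fin d) → Config d → ℝ≥0∞} (hg : Measurable (Function.uncurry g)) :
    Measurable fun X : Config d => ∑ x ∈ X.pts A, g x X := by
  have h1 : ∀ X : Config d, ∑ x ∈ X.pts A, g x X
      = ∑' x : X.carrier, A.indicator (fun x => g x X) x :=
    fun X => (Config.tsum_carrier_indicator X hA _).symm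
  simp_rw [h1]
  refine measurable_tsum_carrier measurable_id
    (g := fun (X : Config d) x => A.indicator (fun x => g x X) x) ?_
  have : (Function.uncurry fun (X : Config d) x => A.indicator (fun x => g x X) x)
      = (Prod.snd ⁻¹' A).indicator (fun q : Config d × EuclideanSpace ℝ (Fin d) => g q.2 q.1) := by
    ext q
    by_cases hq : q.2 ∈ A
    · have hq' : q ∈ (Prod.snd ⁻¹' A : Set (Config d × EuclideanSpace ℝ (Fin d))) := hq
      simp only [Function.uncurry_def, Set.indicator_of_mem hq, Set.indicator_of_mem hq']
    · have hq' : q ∉ (Prod.snd ⁻¹' A : Set (Config d × EuclideanSpace ℝ (Fin d))) := hq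
      simp only [Function.uncurry_def, Set.indicator_of_notMem hq, Set.indicator_of_notMem hq']
  rw [this]
  exact (hg.comp measurable_swap).indicator (measurable_snd hAm)

theorem measurable_truncDefect (hW : MeasurableSet W) (hξ : Measurable (Function.uncurry ξ))
    (hR : Measurable (Function.uncurry (stabRadius ξ))) (r T : ℝ) (N m : ℕ) (z : Fin d → ℤ) :
    Measurable (truncDefect W ξ r T N m z) := by
  have h1 := measurable_uncurry_restrict hW hR
  have h2 := measurable_uncurry_restrict hW hξ
  refine Config.measurable_sum_pts_ennreal (isBounded_unitCube_inter z W)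
    ((measurableSet_unitCube z).inter hW) ?_
  exact ((h1.pow_const N).mul_const _).add ((h2.enorm.pow_const m).mul_const _)

/-- Markov's inequality for the nonnegative sum `truncDefect`, whose expectation is computed by the
Campbell formula. -/
theorem IsPalmFamily.measureReal_truncDefect_le [IsProbabilityMeasure P] (hQ : IsPalmFamily P ρ Q)
    {a a' C c : ℝ}
    (hb : CorrelationBound ρ a a' C c) (hW : MeasurableSet W)
    (hξ : Measurable (Function.uncurry ξ)) (hR : Measurable (Function.uncurry (stabRadius ξ)))
    {r T : ℝ} (hr : 0 < r) (hT : 0 < T) {N m : ℕ} {M₁ M₂ : ℝ} (hM₁ : 0 ≤ M₁) (hM₂ : 0 ≤ M₂)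
    (h₁ : ∀ᵐ u : Fin 1 → EuclideanSpace ℝ (Fin d), u 0 ∈ W → 0 < ρ 1 u →
      ∫⁻ X, stabRadius ξ (u 0) (X.restrict W) ^ N ∂(Q 1 u) ≤ ENNReal.ofReal M₁)
    (h₂ : ∀ᵐ u : Fin 1 → EuclideanSpace ℝ (Fin d), u 0 ∈ W → 0 < ρ 1 u →
      ∫⁻ X, ‖ξ (u 0) (X.restrict W)‖ₑ ^ m ∂(Q 1 u) ≤ ENNReal.ofReal M₂) (z : Fin d → ℤ) :
    P.real {X | 1 ≤ truncDefect W ξ r T N m z X} ≤ (M₁ * r⁻¹ ^ N + M₂ * T⁻¹ ^ m) * C := by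
  have hC := hb.one_le
  have m1 := measurable_uncurry_restrict hW hR
  have m2 := measurable_uncurry_restrict hW hξ
  have key : ∫⁻ X, truncDefect W ξ r T N m z X ∂P
      ≤ ENNReal.ofReal ((M₁ * r⁻¹ ^ N + M₂ * T⁻¹ ^ m) * C) := by
    refine hQ.lintegral_sum_pts_le (g := fun x X => stabRadius ξ x (X.restrict W) ^ N
      * ENNReal.ofReal (r⁻¹ ^ N) + ‖ξ x (X.restrict W)‖ₑ ^ m * ENNReal.ofReal (T⁻¹ ^ m))
      hb (isBounded_unitCube_inter z W)
      ((measurableSet_unitCube z).inter hW) (volume_unitCube_inter_le z W)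
      (((m1.pow_const N).mul_const _).add ((m2.enorm.pow_const m).mul_const _)) (by positivity) ?_
    filter_upwards [h₁, h₂] with u hu1 hu2 huA hu0
    have m1' : Measurable fun X : Config d => stabRadius ξ (u 0) (X.restrict W) :=
      m1.comp measurable_prodMk_left
    rw [lintegral_add_left ((m1'.pow_const N).mul_const _), lintegral_mul_const' _ _ (by simp),
      lintegral_mul_const' _ _ (by simp), ENNReal.ofReal_add (by positivity) (by positivity),
      ENNReal.ofReal_mul hM₁, ENNReal.ofReal_mul hM₂]
    gcongr
    · exact hu1 huA.2 hu0
    · exact hu2 huA.2 hu0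
  refine ENNReal.toReal_le_of_le_ofReal (by positivity) (le_trans ?_ key)
  simpa using mul_meas_ge_le_lintegral (μ := P)
    (measurable_truncDefect hW hξ hR r T N m z) 1

end BadEventProbability

/-! ### Clustering of the cube sums at given truncation levels -/

section ClusterBounds

variable {d : ℕ} {P : Measure (Config d)}
  {ρ : (p : ℕ) → (Fin p → EuclideanSpace ℝ (Fin d)) → ℝ}
  {Q : (p : ℕ) → Kernel (Fin p → EuclideanSpace ℝ (Fin d)) (Config d)}
  {ξ : EuclideanSpace ℝ (Fin d) → Config d → ℝ} {W : Set (EuclideanSpace ℝ (Fin d))}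

theorem cubeSum_abs_nonneg (z : Fin d → ℤ) (X : Config d) :
    0 ≤ cubeSum W z (fun x X => |ξ x X|) X := Finset.sum_nonneg fun _ _ => abs_nonneg _

theorem abs_cubeSum_mul_le {h : EuclideanSpace ℝ (Fin d) → Config d → ℝ}
    (hh : ∀ x X, |h x X| ≤ |ξ x X|) {g : EuclideanSpace ℝ (Fin d) → ℝ} {F : ℝ}
    (hg : ∀ x, |g x| ≤ F) (z : Fin d → ℤ) (X : Config d) :
    |cubeSum W z (fun x X => h x X * g x) X| ≤ F * cubeSum W z (fun x X => |ξ x X|) X := by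
  rw [cubeSum, cubeSum, Finset.mul_sum]
  refine (Finset.abs_sum_le_sum_abs _ _).trans (Finset.sum_le_sum fun x _ => ?_)
  rw [abs_mul, mul_comm]
  exact mul_le_mul (hg x) (hh x _) (abs_nonneg _) ((abs_nonneg _).trans (hg x))

/-- Moments of the sums of absolute scores in unit cubes. -/
theorem IsPalmFamily.integral_cubeSum_pow_le [IsProbabilityMeasure P] (hρ : IsCorrelationFamily P ρ)
    (hQ : IsPalmFamily P ρ Q) {a a' C c : ℝ} (ha1 : a < 1)
    (hb : CorrelationBound ρ a a' C c) (hW : MeasurableSet W)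
    (hξ : Measurable (Function.uncurry ξ)) {C₀ β : ℝ} (hC₀ : 1 ≤ C₀) (hβ : 0 ≤ β)
    (hMG : ∀ m : ℕ, 1 ≤ m → ∀ᵐ u : Fin 1 → EuclideanSpace ℝ (Fin d), u 0 ∈ W → 0 < ρ 1 u →
      ∫⁻ X, ‖ξ (u 0) (X.restrict W)‖ₑ ^ m ∂(Q 1 u) ≤ ENNReal.ofReal (C₀ ^ m * (m ! : ℝ) ^ β))
    (z : Fin d → ℤ) {m : ℕ} (hm : 1 ≤ m) :
    Integrable (fun X => cubeSum W z (fun x X => |ξ x X|) X ^ m) P ∧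
      ∫ X, cubeSum W z (fun x X => |ξ x X|) X ^ m ∂P
        ≤ (max 1 (∑' l, factTerm a (4 * Real.exp 1 * C) l) * (C₀ * C) ^ 2 * 2 ^ (1 + β)) ^ m
          * (m ! : ℝ) ^ (1 + β) := by
  have hC := hb.one_le
  have hA := isBounded_unitCube_inter z W
  have hAm := (measurableSet_unitCube z).inter hW
  have m2 := measurable_uncurry_restrict hW hξ
  obtain ⟨hN, hNL⟩ := hρ.integral_exp_card_pts_le ha1 hb hA hAm (volume_unitCube_inter_le z W)
  refine integral_pow_le_of_half (measurable_cubeSum (h := fun x X => |ξ x X|) hW hξ.abs z)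
    (cubeSum_abs_nonneg z)
    (N := fun X => (X.pts (unitCube z ∩ W)).card)
    (S := fun m X => ∑ x ∈ X.pts (unitCube z ∩ W), |ξ x (X.restrict W)| ^ m)
    (fun m hm t ht X => Finset.sum_pow_le_half _ (fun x _ => abs_nonneg _) hm ht)
    (le_max_left _ _) (one_le_mul_of_one_le_of_one_le hC₀ hC) hβ hN (hNL.trans (le_max_right _ _))
    (fun m hm => ?_) hm
  have hSm : Measurable fun X : Config d =>
      ∑ x ∈ X.pts (unitCube z ∩ W), |ξ x (X.restrict W)| ^ m :=
    Config.measurable_sum_pts hA hAm (g := fun X x => |ξ x (X.restrict W)| ^ m)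
      ((m2.abs.pow_const m).comp measurable_swap)
  have key := hQ.lintegral_sum_pts_le (g := fun x X => ‖ξ x (X.restrict W)‖ₑ ^ m) hb hA hAm (volume_unitCube_inter_le z W)
    (m2.enorm.pow_const m) (M := C₀ ^ m * (m ! : ℝ) ^ β) (by positivity)
    ((hMG m hm).mono fun u hu h1 h2 => hu h1.2 h2)
  have h1 := integrable_and_integral_le_of_lintegral_le hSm
    (fun X => Finset.sum_nonneg fun x _ => by positivity) (M := C₀ ^ m * (m ! : ℝ) ^ β * C)
    (by positivity) (by
      refine le_trans (le_of_eq ?_) key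
      refine lintegral_congr fun X => ?_
      rw [ENNReal.ofReal_sum_of_nonneg fun x _ => by positivity]
      refine Finset.sum_congr rfl fun x _ => ?_
      rw [ENNReal.ofReal_pow (abs_nonneg _), ← Real.norm_eq_abs, ofReal_norm])
  refine ⟨h1.1, h1.2.trans ?_⟩
  rw [mul_pow]
  have : C ≤ C ^ m := le_self_pow₀ hC (by omega)
  calc C₀ ^ m * (m ! : ℝ) ^ β * C ≤ C₀ ^ m * (m ! : ℝ) ^ β * C ^ m := by gcongr
    _ = _ := by ring

theorem tsum_factTerm_sq_le {a x : ℝ} (ha : a < 1) (hx : 0 ≤ x) :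
    (∑' l, factTerm a x l) ^ 2
      ≤ 4 * Real.exp (2 * (1 - a) * (2 ^ (1 / (1 - a)) * x ^ (1 / (1 - a)))) := by
  have h0 : 0 ≤ ∑' l, factTerm a x l := tsum_nonneg fun l => factTerm_nonneg hx l
  calc (∑' l, factTerm a x l) ^ 2 ≤ (2 * Real.exp ((1 - a) * (2 ^ (1 / (1 - a))
        * x ^ (1 / (1 - a))))) ^ 2 := by gcongr; exact tsum_factTerm_le ha hx
    _ = _ := by
        rw [mul_pow, ← Real.exp_nat_mul]
        norm_num
        ring_nf

/-- Moment bounds and clustering of the sums of scores in unit cubes, at a fixed truncation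
level. -/
theorem exists_cluster_bounds [IsProbabilityMeasure P] (hρ : IsCorrelationFamily P ρ)
    (hQ : IsPalmFamily P ρ Q) (hξ : Measurable (Function.uncurry ξ))
    (hR : Measurable (Function.uncurry (stabRadius ξ))) {a a' C c : ℝ} (ha : 0 ≤ a) (ha1 : a < 1)
    (hb : CorrelationBound ρ a a' C c) {b β : ℝ} (hβ : 0 ≤ β)
    (hST : StabilizationCond ρ Q ξ b) (hMG : MomentGrowthCond ρ Q ξ β)
    (hWm : ∀ n, MeasurableSet (obsWindow d n)) :
    ∃ u C₁ c₂ : ℝ, 1 ≤ u ∧ 1 ≤ C₁ ∧ 0 ≤ c₂ ∧ ∀ n : ℕ, 1 ≤ n →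
      ∀ (g : EuclideanSpace ℝ (Fin d) → ℝ) (F : ℝ), Measurable g → (∀ x, |g x| ≤ F) →
      ∀ (k : ℕ) (z : Fin k → Fin d → ℤ),
        (∀ A : Finset (Fin k), Integrable (fun X => ∏ i ∈ A,
          cubeSum (obsWindow d n) (z i) (fun x X => ξ x X * g x) X) P ∧
          |∫ X, ∏ i ∈ A, cubeSum (obsWindow d n) (z i) (fun x X => ξ x X * g x) X ∂P|
            ≤ (F * u) ^ A.card * (A.card ! : ℝ) ^ (1 + β)) ∧
        ∀ (s N m : ℕ) (r T p : ℝ) (I : Finset (Fin k)), 1 ≤ N → 1 ≤ m → 0 < r → 0 < T → 0 < p →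
          (∀ i ∈ I, ∀ j ∉ I, ∃ e, (s : ℤ) ≤ |z i e - z j e|) → 0 < (s : ℝ) - 1 - 2 * r →
          k * (C₁ * (C₁ ^ N * (N ! : ℝ) ^ b * r⁻¹ ^ N + C₁ ^ m * (m ! : ℝ) ^ β * T⁻¹ ^ m))
            ≤ p ^ 2 →
          ∀ A : Finset (Fin k),
            |∫ X, ∏ i ∈ A, cubeSum (obsWindow d n) (z i) (fun x X => ξ x X * g x) X ∂P
              - (∫ X, ∏ i ∈ A ∩ I,
                  cubeSum (obsWindow d n) (z i) (fun x X => ξ x X * g x) X ∂P)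
                * ∫ X, ∏ i ∈ A \ I,
                  cubeSum (obsWindow d n) (z i) (fun x X => ξ x X * g x) X ∂P|
              ≤ 6 * p * ((F * u) ^ A.card * (A.card ! : ℝ) ^ (1 + β))
                + (F * T) ^ A.card * (A.card ! : ℝ) * (4 * Real.exp
                  (c₂ * (k * (1 + 2 * r) ^ d) ^ (1 / (1 - a)) - c * (s - 1 - 2 * r) ^ a')) := by
  obtain ⟨C₂, hC₂, hST⟩ := hST
  obtain ⟨C₃, hC₃, hMG⟩ := hMG
  have hC := hb.one_le
  have hC20 : 0 ≤ C₂ := by linarith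
  have hC30 : 0 ≤ C₃ := by linarith
  have hκ : 0 ≤ 1 + β := by linarith
  -- Joint moments are reduced to powers of a single cube sum, so the hypotheses on the scores enter
  -- only through the Palm distributions at one point.
  have hST' : ∀ n N : ℕ, 1 ≤ n → 1 ≤ N → ∀ᵐ u : Fin 1 → EuclideanSpace ℝ (Fin d),
      u 0 ∈ obsWindow d n → 0 < ρ 1 u → ∫⁻ X, stabRadius ξ (u 0) (X.restrict (obsWindow d n)) ^ N
        ∂(Q 1 u) ≤ ENNReal.ofReal (C₂ ^ N * (N ! : ℝ) ^ b) := fun n N hn hN =>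
    (hST 1 n N le_rfl hn hN).mono fun u hu h1 h2 =>
      hu (fun i => by rwa [Subsingleton.elim i 0]) h2 0
  have hMG' : ∀ n m : ℕ, 1 ≤ n → 1 ≤ m → ∀ᵐ u : Fin 1 → EuclideanSpace ℝ (Fin d),
      u 0 ∈ obsWindow d n → 0 < ρ 1 u → ∫⁻ X, ‖ξ (u 0) (X.restrict (obsWindow d n))‖ₑ ^ m
        ∂(Q 1 u) ≤ ENNReal.ofReal (C₃ ^ m * (m ! : ℝ) ^ β) := fun n m hn hm =>
    (hMG 1 n m le_rfl hm hn).mono fun u hu h1 h2 =>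
      hu (fun i => by rwa [Subsingleton.elim i 0]) h2 0
  set L := max 1 (∑' l, factTerm a (4 * Real.exp 1 * C) l)
  have hL : 1 ≤ L := le_max_left _ _
  set v := L * (C₃ * C) ^ 2 * 2 ^ (1 + β) with hv
  have hv1 : 1 ≤ v := by
    have h1 : 1 ≤ (C₃ * C) ^ 2 := one_le_pow₀ (one_le_mul_of_one_le_of_one_le hC₃ hC)
    have h2 : (1 : ℝ) ≤ 2 ^ (1 + β) := Real.one_le_rpow (by norm_num) hκ
    exact one_le_mul_of_one_le_of_one_le (one_le_mul_of_one_le_of_one_le hL h1) h2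
  set u := 2 * 4 ^ (1 + β) * v with hu
  have hu1 : 1 ≤ u := by
    have h2 : (1 : ℝ) ≤ 4 ^ (1 + β) := Real.one_le_rpow (by norm_num) hκ
    exact one_le_mul_of_one_le_of_one_le (one_le_mul_of_one_le_of_one_le (by norm_num) h2) hv1
  have hu0 : 0 < u := by linarith
  set C₁ := max C (max C₂ C₃) with hC₁
  have hC1 : C ≤ C₁ := le_max_left _ _
  have hC2 : C₂ ≤ C₁ := (le_max_left _ _).trans (le_max_right _ _)
  have hC3 : C₃ ≤ C₁ := (le_max_right _ _).trans (le_max_right _ _)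
  refine ⟨u, C₁, 2 * (1 - a) * (2 ^ (1 / (1 - a)) * (4 * Real.exp 1 * C) ^ (1 / (1 - a))),
    hu1, hC.trans hC1, ?_, ?_⟩
  · have : 0 < 1 - a := by linarith
    positivity
  intro n hn g F hg hgF k z
  have hF : 0 ≤ F := (abs_nonneg _).trans (hgF 0)
  set W := obsWindow d n with hW
  have hWm : MeasurableSet W := hWm n
  set Y : Fin k → Config d → ℝ := fun i => cubeSum W (z i) fun x X => ξ x X * g x with hY
  set U : Fin k → Config d → ℝ := fun i => cubeSum W (z i) fun x X => |ξ x X| with hU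
  have hUm : ∀ i, Measurable (U i) := fun i =>
    measurable_cubeSum (h := fun x X => |ξ x X|) hWm hξ.abs (z i)
  have hYm : ∀ i, Measurable (Y i) := fun i =>
    measurable_cubeSum (h := fun x X => ξ x X * g x) hWm (hξ.mul (hg.comp measurable_fst)) (z i)
  have hYU : ∀ i X, |Y i X| ≤ F * U i X := fun i X =>
    abs_cubeSum_mul_le (fun _ _ => le_rfl) hgF (z i) X
  have hUA := fun A : Finset (Fin k) => integral_prod_le_of_integral_pow_le hUm
    (fun i => cubeSum_abs_nonneg (z i)) hv1 hκ
    (fun i m hm => hQ.integral_cubeSum_pow_le hρ ha1 hb hWm hξ hC₃ hβ (fun m hm => hMG' n m hn hm)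
      (z i) hm) A
  have hm : ∀ (V : Fin k → Config d → ℝ), (∀ i X, |V i X| ≤ F * U i X) → (∀ i, Measurable (V i)) →
      ∀ A : Finset (Fin k), |∫ X, ∏ i ∈ A, V i X ∂P|
        ≤ (F * u) ^ A.card * (A.card ! : ℝ) ^ (1 + β) := by
    intro V hV hVm A
    obtain ⟨h1, h2, h3⟩ := hUA A
    have h4 := integral_le_of_integral_sq_le h1 h2 (by positivity) h3
    refine abs_integral_le_integral_abs.trans ((integral_mono
      (integrable_prod_of_abs_le hVm hV h1).abs (h1.const_mul (F ^ A.card))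
      fun X => Finset.abs_prod_le_pow_mul_prod A fun i => hV i X).trans ?_)
    rw [integral_const_mul, mul_pow, mul_assoc]
    gcongr
  refine ⟨fun A => ⟨integrable_prod_of_abs_le hYm hYU (hUA A).1, hm Y hYU hYm A⟩, ?_⟩
  intro s N m r T p I hN hm1 hr hT hp hsep hs hqp
  -- The truncated sums share the majorant `F * U i` with the original ones, hence also their moment
  -- bounds; the covariance estimate is applied to them.
  set Y' : Fin k → Config d → ℝ := fun i => cubeSum W (z i) fun x X => truncScore ξ r T x X * g x
    with hY'
  have htm : Measurable (Function.uncurry fun x X => truncScore ξ r T x X * g x) :=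
    (measurable_truncScore hξ hR r T).mul (hg.comp measurable_fst)
  have hYm' : ∀ i, Measurable (Y' i) := fun i => measurable_cubeSum hWm htm (z i)
  have hYU' : ∀ i X, |Y' i X| ≤ F * U i X := fun i X =>
    abs_cubeSum_mul_le (fun x X => abs_truncScore_le_abs x X) hgF (z i) X
  have hd : ∀ A : Finset (Fin k), |∫ X, ∏ i ∈ A, Y i X ∂P - ∫ X, ∏ i ∈ A, Y' i X ∂P|
      ≤ 2 * p * ((F * u) ^ A.card * (A.card ! : ℝ) ^ (1 + β)) := by
    intro A
    obtain ⟨h1, h2, h3⟩ := hUA A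
    rw [mul_pow, mul_assoc (F ^ A.card)]
    have hC10 : 0 ≤ C₁ := by linarith
    refine abs_integral_prod_sub_le hYm hYm' hYU hYU' hF
      (b := fun i => {X | 1 ≤ truncDefect W ξ r T N m (z i) X})
      (fun i => measurableSet_le measurable_const (measurable_truncDefect hWm hξ hR r T N m (z i)))
      (fun i X hX => ?_)
      (fun i => hQ.measureReal_truncDefect_le hb hWm hξ hR hr hT (by positivity) (by positivity)
        (hST' n N hn hN) (hMG' n m hn hm1) (z i)) hp (by positivity) h1 h2 h3 ?_
    · rw [Set.mem_ofPred_eq, not_le] at hX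
      refine Finset.sum_congr rfl fun x hx => ?_
      simp only [truncScore_eq_of_truncDefect_lt hr hT hX hx]
    · refine le_trans ?_ hqp
      have hAk : (A.card : ℝ) ≤ k := by
        have := Finset.card_le_univ A
        rw [Fintype.card_fin] at this
        exact_mod_cast this
      rw [mul_comm _ C]
      gcongr
  intro A
  refine abs_sub_mul_le_of_approx (m := fun A => ∫ X, ∏ i ∈ A, Y i X ∂P)
    (m' := fun A => ∫ X, ∏ i ∈ A, Y' i X ∂P) (by positivity) hκ hp.le (hm Y hYU hYm)
    (hm Y' hYU' hYm') hd A I ?_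
  have hM : ∀ x X, |truncScore ξ r T x X * g x| ≤ F * T := by
    intro x X
    rw [abs_mul, mul_comm]
    exact mul_le_mul (hgF x) (abs_truncScore_le hT.le x X) (abs_nonneg _) hF
  have hloc := fun J : Finset (Fin k) => isLocal_prod_cubeSum hWm htm hr.le
    (fun x X => by rw [truncScore_restrict]) (by positivity) hM z J
  have hvol : ∀ J : Finset (Fin k), volume (⋃ i ∈ J, enlargedCube (z i) r)
      ≤ ENNReal.ofReal (k * (1 + 2 * r) ^ d) := by
    intro J
    refine (volume_iUnion_enlargedCube_le z J hr.le).trans (ENNReal.ofReal_le_ofReal ?_)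
    have hAk : (J.card : ℝ) ≤ k := by
      have := Finset.card_le_univ J
      rw [Fintype.card_fin] at this
      exact_mod_cast this
    gcongr
  have hdist : ∀ x ∈ ⋃ i ∈ A ∩ I, enlargedCube (z i) r, ∀ y ∈ ⋃ i ∈ A \ I, enlargedCube (z i) r,
      (s : ℝ) - 1 - 2 * r ≤ dist x y := by
    intro x hx y hy
    simp only [Set.mem_iUnion] at hx hy
    obtain ⟨i, hi, hx⟩ := hx
    obtain ⟨j, hj, hy⟩ := hy
    exact dist_enlargedCube_ge (hsep i (Finset.mem_inter.1 hi).2 j (Finset.mem_sdiff.1 hj).2) hx hy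
  have hdisj : Disjoint (⋃ i ∈ A ∩ I, enlargedCube (z i) r) (⋃ i ∈ A \ I, enlargedCube (z i) r) := by
    refine Set.disjoint_left.2 fun x hx hy => ?_
    have := hdist x hx x hy
    rw [dist_self] at this
    linarith
  -- The regions of the two groups are unions of enlarged cubes at distance at least `s - 1 - 2r >
  -- 0`, each of volume at most `k (1+2r)^d`.
  have hcov := Config.covariance_le hρ ha ha1 hb (hloc (A ∩ I)) (hloc (A \ I)) hdisj
    (V := k * (1 + 2 * r) ^ d) (by positivity) (hvol _) (hvol _) hs.le hdist
  have hprod : (fun X => ∏ i ∈ A, Y' i X)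
      = fun X => (∏ i ∈ A ∩ I, Y' i X) * ∏ i ∈ A \ I, Y' i X :=
    funext fun X => (Finset.prod_inter_mul_prod_sdiff A I _).symm
  rw [hprod]
  refine hcov.trans ?_
  have h1 : (A ∩ I).card + (A \ I).card = A.card := Finset.card_inter_add_card_sdiff A I
  have h2 : ((A ∩ I).card ! : ℝ) * ((A \ I).card ! : ℝ) ≤ (A.card ! : ℝ) := by
    rw [← h1]
    exact_mod_cast Nat.le_of_dvd (Nat.factorial_pos _)
      (Nat.factorial_mul_factorial_dvd_factorial_add _ _)
  have h3 := tsum_factTerm_sq_le (a := a) (x := 4 * Real.exp 1 * C * (k * (1 + 2 * r) ^ d)) ha1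
    (by positivity)
  rw [Real.mul_rpow (by positivity) (by positivity)] at h3
  calc _ = (F * T) ^ A.card * (((A ∩ I).card ! : ℝ) * ((A \ I).card ! : ℝ))
        * ((∑' l, factTerm a (4 * Real.exp 1 * C * (k * (1 + 2 * r) ^ d)) l) ^ 2
          * Real.exp (-c * (s - 1 - 2 * r) ^ a')) := by rw [← h1, pow_add]; ring
    _ ≤ (F * T) ^ A.card * (A.card ! : ℝ) * (4 * Real.exp (2 * (1 - a) * (2 ^ (1 / (1 - a))
          * ((4 * Real.exp 1 * C) ^ (1 / (1 - a)) * (k * (1 + 2 * r) ^ d) ^ (1 / (1 - a)))))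
          * Real.exp (-c * (s - 1 - 2 * r) ^ a')) := by gcongr
    _ = _ := by
        rw [mul_assoc 4, ← Real.exp_add]
        congr 3
        ring

end ClusterBounds

/-! ### Growth of powers and factorials in `k` -/

section Growth

theorem natCast_rpow_le_pow {δ : ℝ} (hδ : 0 ≤ δ) (k : ℕ) : (k : ℝ) ^ δ ≤ ((2 : ℝ) ^ δ) ^ k := by
  have h1 : (k : ℝ) ≤ 2 ^ k := by exact_mod_cast (Nat.lt_two_pow_self (n := k)).le
  calc (k : ℝ) ^ δ ≤ ((2 : ℝ) ^ k) ^ δ := by gcongr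
    _ = ((2 : ℝ) ^ δ) ^ k := by
        rw [← Real.rpow_natCast, ← Real.rpow_natCast, ← Real.rpow_mul (by norm_num),
          ← Real.rpow_mul (by norm_num), mul_comm]

/-- Bookkeeping device: powers of bounded quantities with exponents linear in `k` are absorbed in `C
^ k`, uniformly in `x` and `t`. -/
theorem exists_rpow_le_pow (A : ℝ) {α δ : ℝ} (hα : 0 ≤ α) (hδ : 0 ≤ δ) :
    ∃ C : ℝ, 1 ≤ C ∧ ∀ k : ℕ, 1 ≤ k → ∀ x t : ℝ, 0 ≤ x → x ≤ A → 0 ≤ t → t ≤ α * k + δ →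
      x ^ t ≤ C ^ k := by
  refine ⟨max 1 A ^ (α + δ), Real.one_le_rpow (le_max_left _ _) (by positivity),
    fun k hk x t hx hxA ht htk => ?_⟩
  have hk' : (1 : ℝ) ≤ k := by exact_mod_cast hk
  calc x ^ t ≤ max 1 A ^ t := by gcongr; exact hxA.trans (le_max_right _ _)
    _ ≤ max 1 A ^ ((α + δ) * k) := by
        refine Real.rpow_le_rpow_of_exponent_le (le_max_left _ _) (htk.trans ?_)
        nlinarith
    _ = _ := by rw [Real.rpow_mul (by positivity), Real.rpow_natCast]

/-- For a base of order `k`, only the slope `α` of the exponent is relevant; the bounded part `δ`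
contributes `k^δ ≤ (2^δ)^k`. -/
theorem exists_rpow_le_pow_mul (A : ℝ) {α δ : ℝ} (hα : 0 ≤ α) (hδ : 0 ≤ δ) :
    ∃ C : ℝ, 1 ≤ C ∧ ∀ k : ℕ, 1 ≤ k → ∀ x t : ℝ, 0 ≤ x → x ≤ A * k → 0 ≤ t → t ≤ α * k + δ →
      x ^ t ≤ C ^ k * ((k : ℝ) ^ k) ^ α := by
  obtain ⟨C, hC, h⟩ := exists_rpow_le_pow (max 1 A) hα hδ
  refine ⟨C * 2 ^ δ, one_le_mul_of_one_le_of_one_le hC (Real.one_le_rpow (by norm_num) hδ),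
    fun k hk x t hx hxA ht htk => ?_⟩
  have hk' : (1 : ℝ) ≤ k := by exact_mod_cast hk
  have hA : 1 ≤ max 1 A := le_max_left _ _
  calc x ^ t ≤ (max 1 A * k) ^ t := by gcongr; exact hxA.trans (by gcongr; exact le_max_right _ _)
    _ ≤ (max 1 A * k) ^ (α * k + δ) :=
        Real.rpow_le_rpow_of_exponent_le (one_le_mul_of_one_le_of_one_le hA hk') htk
    _ = max 1 A ^ (α * k + δ) * ((k : ℝ) ^ δ * (k : ℝ) ^ (α * k)) := by
        rw [Real.mul_rpow (by positivity) (by positivity), Real.rpow_add (by positivity) (_ * _) δ,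
          mul_comm ((k : ℝ) ^ δ), Real.rpow_add (by positivity) (_ * _) δ]
    _ ≤ C ^ k * (((2 : ℝ) ^ δ) ^ k * (k : ℝ) ^ (α * k)) := by
        gcongr
        · exact h k hk _ _ (by positivity) le_rfl (by positivity) le_rfl
        · exact natCast_rpow_le_pow hδ k
    _ = _ := by
        rw [mul_pow, mul_comm α, Real.rpow_mul (by positivity), Real.rpow_natCast]
        ring

/-- From `1 + v ≤ exp v` with `v = c y / w`, raised to the power `w`. -/
theorem rpow_le_mul_exp {y w c : ℝ} (hy : 0 ≤ y) (hw : 0 < w) (hc : 0 < c) :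
    y ^ w ≤ (w / c) ^ w * Real.exp (c * y) := by
  have h1 : y ≤ w / c * Real.exp (c * y / w) := by
    have h2 := Real.add_one_le_exp (c * y / w)
    calc y = w / c * (c * y / w) := by field_simp
      _ ≤ _ := by gcongr; linarith
  calc y ^ w ≤ (w / c * Real.exp (c * y / w)) ^ w := by gcongr
    _ = _ := by
        rw [Real.mul_rpow (by positivity) (by positivity), ← Real.exp_mul]
        congr 2
        field_simp

/-- A stretched exponential beats the power `dk + 2` of `s` up to `(w/c)^w` with `w = (dk + 2)/a'`,
which is of order `C^k k^(dk/a')`. -/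
theorem exists_exp_neg_le (d : ℕ) {c a' : ℝ} (hc : 0 < c) (ha' : 0 < a') :
    ∃ C : ℝ, 1 ≤ C ∧ ∀ k s : ℕ, 1 ≤ k → 1 ≤ s →
      Real.exp (-c * (s : ℝ) ^ a') ≤ C ^ k * ((k : ℝ) ^ k) ^ (d / a') / (1 + s) ^ (d * k + 2) := by
  obtain ⟨C, hC, h⟩ := exists_rpow_le_pow_mul (((d : ℝ) + 2) / a' / c) (α := d / a') (δ := 2 / a')
    (by positivity) (by positivity)
  obtain ⟨C', hC', h'⟩ := exists_rpow_le_pow 2 (α := d) (δ := 2) (by positivity) (by positivity)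
  refine ⟨C' * C, one_le_mul_of_one_le_of_one_le hC' hC, fun k s hk hs => ?_⟩
  have hk' : (1 : ℝ) ≤ k := by exact_mod_cast hk
  have hs' : (1 : ℝ) ≤ s := by exact_mod_cast hs
  rw [le_div_iff₀ (by positivity)]
  set w : ℝ := ((d * k + 2 : ℕ) : ℝ) / a' with hw
  have hw0 : 0 < w := by rw [hw]; positivity
  have h1 : (s : ℝ) ^ (d * k + 2) ≤ C ^ k * ((k : ℝ) ^ k) ^ (d / a') * Real.exp (c * s ^ a') := by
    calc (s : ℝ) ^ (d * k + 2) = ((s : ℝ) ^ a') ^ w := by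
          rw [← Real.rpow_mul (by positivity), hw, mul_div_cancel₀ _ ha'.ne', Real.rpow_natCast]
      _ ≤ (w / c) ^ w * Real.exp (c * s ^ a') := rpow_le_mul_exp (by positivity) hw0 hc
      _ ≤ _ := by
          gcongr
          refine h k hk _ _ (by positivity) ?_ hw0.le ?_
          · rw [hw, div_mul_eq_mul_div, div_mul_eq_mul_div]
            gcongr
            push_cast
            nlinarith
          · rw [hw]
            push_cast
            rw [add_div, mul_div_right_comm]
  have h2 : (2 : ℝ) ^ (d * k + 2) ≤ C' ^ k := by
    rw [← Real.rpow_natCast]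
    exact h' k hk 2 _ (by norm_num) le_rfl (by positivity) (by push_cast; rfl)
  calc Real.exp (-c * (s : ℝ) ^ a') * (1 + s) ^ (d * k + 2)
      ≤ Real.exp (-c * (s : ℝ) ^ a') * (2 * s) ^ (d * k + 2) := by gcongr; linarith
    _ ≤ Real.exp (-c * (s : ℝ) ^ a') * (C' ^ k * (C ^ k * ((k : ℝ) ^ k) ^ (d / a')
          * Real.exp (c * s ^ a'))) := by
        rw [mul_pow]
        gcongr
    _ = C' ^ k * C ^ k * ((k : ℝ) ^ k) ^ (d / a')
          * (Real.exp (-c * (s : ℝ) ^ a') * Real.exp (c * s ^ a')) := by ring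
    _ = _ := by rw [← Real.exp_add, mul_pow]; simp

theorem factorial_rpow_le {b : ℝ} (hb : 0 ≤ b) (N : ℕ) : (N ! : ℝ) ^ b ≤ (N : ℝ) ^ (b * N) := by
  calc (N ! : ℝ) ^ b ≤ ((N : ℝ) ^ N) ^ b := by
        gcongr
        exact_mod_cast Nat.factorial_le_pow N
    _ = _ := by rw [← Real.rpow_natCast, ← Real.rpow_mul (by positivity), mul_comm]

/-- Markov bound for the stabilization radius at a level proportional to the distance. -/
theorem exists_markov_linear_le (d : ℕ) {b C₁ : ℝ} (hb : 0 ≤ b) (hC₁ : 1 ≤ C₁) :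
    ∃ C : ℝ, 1 ≤ C ∧ ∀ k s : ℕ, 1 ≤ k → 1 ≤ s → ∃ N : ℕ, 1 ≤ N ∧
      C₁ ^ N * (N ! : ℝ) ^ b * ((s : ℝ) / 8)⁻¹ ^ N
        ≤ (C ^ k * ((k : ℝ) ^ k) ^ (b * d) / (1 + s) ^ (d * k + 2)) ^ 2 := by
  obtain ⟨C, hC, h⟩ := exists_rpow_le_pow_mul (2 * (d + 2)) (α := 2 * (b * d)) (δ := 4 * b)
    (by positivity) (by positivity)
  obtain ⟨C', hC', h'⟩ := exists_rpow_le_pow (C₁ * 16) (α := 2 * d) (δ := 4) (by positivity)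
    (by positivity)
  refine ⟨C' * C, one_le_mul_of_one_le_of_one_le hC' hC, fun k s hk hs =>
    ⟨2 * (d * k + 2), by omega, ?_⟩⟩
  have hk' : (1 : ℝ) ≤ k := by exact_mod_cast hk
  have hs' : (1 : ℝ) ≤ s := by exact_mod_cast hs
  -- The moment order is twice the required power of `s`, because the probability enters the error
  -- through its square root; then `N!^b` has the order `C^k (k^k)^(2bd)`.
  set N := 2 * (d * k + 2) with hN
  have hNr : (N : ℝ) = 2 * (d * k + 2) := by rw [hN]; push_cast; ring
  have h1 : (N ! : ℝ) ^ b ≤ C ^ k * ((k : ℝ) ^ k) ^ (2 * (b * d)) := by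
    refine (factorial_rpow_le hb N).trans (h k hk _ _ (by positivity) ?_ (by positivity) ?_)
    · rw [hNr]; nlinarith
    · rw [hNr]; apply le_of_eq; ring
  have h2 : ((s : ℝ) / 8)⁻¹ ≤ 16 / (1 + s) := by
    rw [inv_div, div_le_div_iff₀ (by positivity) (by positivity)]
    linarith
  have h3 : (C₁ * 16) ^ N ≤ C' ^ k := by
    rw [← Real.rpow_natCast]
    exact h' k hk _ _ (by positivity) le_rfl (by positivity) (by rw [hNr]; apply le_of_eq; ring)
  have hC1 : C' ^ k ≤ (C' ^ k) ^ 2 := le_self_pow₀ (one_le_pow₀ hC') two_ne_zero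
  have hC2 : C ^ k ≤ (C ^ k) ^ 2 := le_self_pow₀ (one_le_pow₀ hC) two_ne_zero
  calc C₁ ^ N * (N ! : ℝ) ^ b * ((s : ℝ) / 8)⁻¹ ^ N
      ≤ C₁ ^ N * (C ^ k * ((k : ℝ) ^ k) ^ (2 * (b * d))) * (16 / (1 + s)) ^ N := by gcongr
    _ = (C₁ * 16) ^ N * C ^ k * ((k : ℝ) ^ k) ^ (2 * (b * d)) / ((1 + s) ^ (d * k + 2)) ^ 2 := by
        rw [div_pow, mul_pow C₁, ← pow_mul (1 + (s : ℝ)), hN, mul_comm 2 (d * k + 2)]; ring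
    _ ≤ (C' ^ k) ^ 2 * (C ^ k) ^ 2 * ((k : ℝ) ^ k) ^ (2 * (b * d))
          / ((1 + s) ^ (d * k + 2)) ^ 2 := by
        gcongr
        exact h3.trans hC1
    _ = _ := by
        rw [mul_comm 2 (b * (d : ℝ)), Real.rpow_mul (by positivity) _ 2, Real.rpow_two, div_pow,
          mul_pow, mul_pow, mul_pow]

/-- Markov bound for the stabilization radius at a level growing like a power of the distance. -/
theorem exists_markov_rpow_le {d : ℕ} (hd : 1 ≤ d) {b C₁ D ε : ℝ} (hb : 0 ≤ b) (hC₁ : 1 ≤ C₁)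
    (hD : 0 < D) (hε : 0 < ε) :
    ∃ C : ℝ, 1 ≤ C ∧ ∀ k s : ℕ, 1 ≤ k → 1 ≤ s →
      1 ≤ ε * (s : ℝ) ^ (1 / D) * (k : ℝ) ^ (-(1 / (d : ℝ))) → ∃ N : ℕ, 1 ≤ N ∧
      C₁ ^ N * (N ! : ℝ) ^ b * (ε * (s : ℝ) ^ (1 / D) * (k : ℝ) ^ (-(1 / (d : ℝ))))⁻¹ ^ N
        ≤ (C ^ k * ((k : ℝ) ^ k) ^ (b * d * D + D) / (1 + s) ^ (d * k + 2)) ^ 2 := by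
  have hd0 : (0 : ℝ) < d := by exact_mod_cast hd
  obtain ⟨C, hC, h⟩ := exists_rpow_le_pow_mul (2 * D * (d + 2) + 1) (α := 2 * (b * d * D))
    (δ := b * (4 * D + 1)) (by positivity) (by positivity)
  obtain ⟨C', hC', h'⟩ := exists_rpow_le_pow C₁ (α := 2 * D * d) (δ := 4 * D + 1)
    (by positivity) (by positivity)
  obtain ⟨C'', hC'', h''⟩ := exists_rpow_le_pow_mul 1 (α := 2 * D) (δ := 4 * D / d)
    (by positivity) (by positivity)
  obtain ⟨B, hB, hB'⟩ := exists_rpow_le_pow ε⁻¹ (α := 2 * D * d) (δ := 4 * D)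
    (by positivity) (by positivity)
  obtain ⟨B', hB1, hB2⟩ := exists_rpow_le_pow 2 (α := 2 * d) (δ := 4) (by positivity)
    (by positivity)
  set c := C * C' * C'' * B * B' with hc
  have hc1 : 1 ≤ c := one_le_mul_of_one_le_of_one_le (one_le_mul_of_one_le_of_one_le
    (one_le_mul_of_one_le_of_one_le (one_le_mul_of_one_le_of_one_le hC hC') hC'') hB) hB1
  refine ⟨c, hc1, fun k s hk hs hr =>
    ⟨⌈2 * D * (d * k + 2)⌉₊, Nat.one_le_iff_ne_zero.2 (Nat.ceil_pos.2 (by positivity)).ne', ?_⟩⟩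
  have hk' : (1 : ℝ) ≤ k := by exact_mod_cast hk
  have hs' : (1 : ℝ) ≤ s := by exact_mod_cast hs
  -- With the level `ε s^(1/D) k^(-1/d)`, the moment of order `t` yields `s^(-2(dk+2))`. The factor
  -- `k^(t/d)` and the factorial `N!^b` account for the two summands of the exponent `bdD + D`, up
  -- to the factor `2` that disappears with the square root.
  set t : ℝ := 2 * D * (d * k + 2) with ht
  set N := ⌈t⌉₊ with hN
  set r : ℝ := ε * (s : ℝ) ^ (1 / D) * (k : ℝ) ^ (-(1 / (d : ℝ))) with hr_def
  have ht0 : 0 ≤ t := by positivity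
  have hNt : (N : ℝ) ≤ t + 1 := (Nat.ceil_lt_add_one ht0).le
  have htN : t ≤ N := Nat.le_ceil t
  have h1 : (N ! : ℝ) ^ b ≤ C ^ k * ((k : ℝ) ^ k) ^ (2 * (b * d * D)) := by
    refine (factorial_rpow_le hb N).trans (h k hk _ _ (by positivity) ?_ (by positivity) ?_)
    · refine hNt.trans ?_
      rw [ht]
      nlinarith
    · refine (mul_le_mul_of_nonneg_left hNt hb).trans_eq ?_
      rw [ht]; ring
  have h2 : C₁ ^ N ≤ C' ^ k := by
    rw [← Real.rpow_natCast]
    refine h' k hk _ _ (by positivity) le_rfl (by positivity) (hNt.trans_eq ?_)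
    rw [ht]; ring
  have h3 : r⁻¹ ^ N ≤ B ^ k * (C'' ^ k * ((k : ℝ) ^ k) ^ (2 * D)) * B' ^ k
      / ((1 + s) ^ (d * k + 2)) ^ 2 := by
    have e1 : r⁻¹ ^ N ≤ r⁻¹ ^ t := by
      rw [← Real.rpow_natCast]
      -- Rounding the order up to `N` is harmless because the level is at least `1`.
      exact Real.rpow_le_rpow_of_exponent_ge (by positivity) (inv_le_one_of_one_le₀ hr) htN
    have e2 : r⁻¹ ^ t = ε⁻¹ ^ t * (k : ℝ) ^ (2 * D * k + 4 * D / d)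
        * ((s : ℝ)⁻¹ ^ (d * k + 2)) ^ 2 := by
      rw [hr_def, mul_inv, mul_inv, Real.rpow_neg (by positivity), inv_inv,
        Real.mul_rpow (by positivity) (by positivity),
        Real.mul_rpow (by positivity) (by positivity), ← Real.rpow_mul (by positivity) (1 / _),
        ← Real.inv_rpow (by positivity) (1 / D),
        ← Real.rpow_mul (by positivity) (1 / D), ← pow_mul, ← Real.rpow_natCast _ ((d * k + 2) * 2)]
      have e3 : 1 / (d : ℝ) * t = 2 * D * k + 4 * D / d := by
        rw [ht]; field_simp; ring
      have e4 : 1 / D * t = ((d * k + 2) * 2 : ℕ) := by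
        rw [ht]; push_cast; field_simp
      rw [e3, e4]
      ring
    have e5 : (s : ℝ)⁻¹ ≤ 2 / (1 + s) := by
      rw [inv_eq_one_div, div_le_div_iff₀ (by positivity) (by positivity)]
      linarith
    have e6 : ((2 : ℝ) ^ (d * k + 2)) ^ 2 ≤ B' ^ k := by
      rw [← pow_mul, ← Real.rpow_natCast]
      refine hB2 k hk 2 _ (by norm_num) le_rfl (by positivity) (le_of_eq ?_)
      push_cast; ring
    calc r⁻¹ ^ N ≤ ε⁻¹ ^ t * (k : ℝ) ^ (2 * D * k + 4 * D / d)
          * ((s : ℝ)⁻¹ ^ (d * k + 2)) ^ 2 := e1.trans_eq e2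
      _ ≤ B ^ k * (C'' ^ k * ((k : ℝ) ^ k) ^ (2 * D)) * ((2 / (1 + s)) ^ (d * k + 2)) ^ 2 := by
          gcongr
          · exact hB' k hk _ _ (by positivity) le_rfl ht0 (by rw [ht]; apply le_of_eq; ring)
          · exact h'' k hk _ _ (by positivity) (by rw [one_mul]) (by positivity) le_rfl
      _ = B ^ k * (C'' ^ k * ((k : ℝ) ^ k) ^ (2 * D)) * ((2 : ℝ) ^ (d * k + 2)) ^ 2
            / ((1 + s) ^ (d * k + 2)) ^ 2 := by rw [div_pow, div_pow]; ring
      _ ≤ _ := by gcongr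
  calc C₁ ^ N * (N ! : ℝ) ^ b * r⁻¹ ^ N
      ≤ C' ^ k * (C ^ k * ((k : ℝ) ^ k) ^ (2 * (b * d * D)))
        * (B ^ k * (C'' ^ k * ((k : ℝ) ^ k) ^ (2 * D)) * B' ^ k
          / ((1 + s) ^ (d * k + 2)) ^ 2) := by gcongr
    _ = c ^ k * ((k : ℝ) ^ k) ^ ((b * d * D + D) * 2) / ((1 + s) ^ (d * k + 2)) ^ 2 := by
        rw [show (b * d * D + D) * 2 = 2 * (b * d * D) + 2 * D by ring,
          Real.rpow_add (by positivity), hc, mul_pow, mul_pow, mul_pow, mul_pow]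
        ring
    _ ≤ (c ^ k) ^ 2 * ((k : ℝ) ^ k) ^ ((b * d * D + D) * 2) / ((1 + s) ^ (d * k + 2)) ^ 2 := by
        gcongr
        exact le_self_pow₀ (one_le_pow₀ hc1) two_ne_zero
    _ = _ := by
        rw [Real.rpow_mul (by positivity), Real.rpow_two, div_pow (c ^ k * _), mul_pow (c ^ k)]

end Growth

/-! ### Choice of the truncation levels -/

section Parameters

/-- Powers of the truncation level of the scores are controlled by factorials. -/
theorem natCeil_rpow_mul_le {β l y : ℝ} (hβ : 0 ≤ β) (hl : 0 < l) (hy : 0 ≤ y) (j : ℕ) :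
    ((⌈y⌉₊ : ℝ) ^ β) ^ j ≤ ((l⁻¹ ^ β) ^ j * (j ! : ℝ) ^ β) * Real.exp (β * l * (y + 1)) := by
  have h1 : (⌈y⌉₊ : ℝ) ≤ y + 1 := (Nat.ceil_lt_add_one hy).le
  -- From `v^j ≤ j! exp v` with `v = l (y + 1)`: a small `l` makes the exponential loss negligible
  -- at the price of the constant `l⁻¹ ^ j`.
  have h2 : (⌈y⌉₊ : ℝ) ^ j ≤ l⁻¹ ^ j * (j ! * Real.exp (l * (y + 1))) := by
    have h3 := Real.pow_div_factorial_le_exp (l * (y + 1)) (by positivity) j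
    rw [div_le_iff₀ (by positivity)] at h3
    calc (⌈y⌉₊ : ℝ) ^ j ≤ (y + 1) ^ j := by gcongr
      _ = l⁻¹ ^ j * (l * (y + 1)) ^ j := by rw [← mul_pow]; congr 1; field_simp
      _ ≤ _ := by gcongr; linarith
  calc ((⌈y⌉₊ : ℝ) ^ β) ^ j = ((⌈y⌉₊ : ℝ) ^ j) ^ β := by
        rw [← Real.rpow_natCast, ← Real.rpow_natCast, ← Real.rpow_mul (by positivity),
          ← Real.rpow_mul (by positivity), mul_comm]
    _ ≤ (l⁻¹ ^ j * (j ! * Real.exp (l * (y + 1)))) ^ β := by gcongr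
    _ = _ := by
        rw [Real.mul_rpow (by positivity) (by positivity),
          Real.mul_rpow (by positivity) (by positivity), ← Real.exp_mul, ← Real.rpow_natCast,
          ← Real.rpow_natCast, ← Real.rpow_mul (by positivity), ← Real.rpow_mul (by positivity),
          mul_comm β (j : ℝ), show l * (y + 1) * β = β * l * (y + 1) by ring]
        ring

theorem exists_one_le_mul_rpow {A q : ℝ} (hA : 0 < A) (hq : 0 < q) :
    ∃ K : ℝ, 1 ≤ K ∧ ∀ x : ℝ, K ≤ x → 1 ≤ A * x ^ q := by
  refine ⟨max 1 ((A⁻¹) ^ (1 / q)), le_max_left _ _, fun x hx => ?_⟩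
  have h1 : (A⁻¹) ^ (1 / q) ≤ x := (le_max_right _ _).trans hx
  have h2 : A⁻¹ ≤ x ^ q := by
    calc A⁻¹ = ((A⁻¹) ^ (1 / q)) ^ q := by
          rw [← Real.rpow_mul (by positivity), one_div, inv_mul_cancel₀ hq.ne', Real.rpow_one]
      _ ≤ _ := by gcongr
  calc (1 : ℝ) = A * A⁻¹ := (mul_inv_cancel₀ hA.ne').symm
    _ ≤ _ := by gcongr

set_option maxHeartbeats 1000000 in
/-- The choice of the truncation levels: either the distance is so small that trivial bounds
suffice, or there are truncation levels for which all error terms are small. -/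
theorem exists_truncation_levels {d : ℕ} (hd : 1 ≤ d) {a' θ b β C₁ c c₂ G : ℝ} (ha' : 0 < a')
    (hθ : 1 ≤ θ) (hb : 0 ≤ b) (hβ : 0 ≤ β) (hC₁ : 1 ≤ C₁) (hc : 0 < c) (hc₂ : 0 ≤ c₂)
    (hG₁ : b * d ≤ G) (hG₂ : b * d * (d * θ / a') + d * θ / a' ≤ G) :
    ∃ C c₀ : ℝ, 1 ≤ C ∧ 1 ≤ c₀ ∧ ∀ k s : ℕ, 1 ≤ k → 1 ≤ s →
      ((1 + s : ℝ) ^ (d * k + 2) ≤ C ^ k * ((k : ℝ) ^ k) ^ G) ∨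
      ∃ (N m : ℕ) (r T p : ℝ), 1 ≤ N ∧ 1 ≤ m ∧ 0 < r ∧ 0 < T ∧ 0 < p ∧
        0 < (s : ℝ) - 1 - 2 * r ∧
        k * (C₁ * (C₁ ^ N * (N ! : ℝ) ^ b * r⁻¹ ^ N + C₁ ^ m * (m ! : ℝ) ^ β * T⁻¹ ^ m)) ≤ p ^ 2 ∧
        6 * p ≤ C ^ k * ((k : ℝ) ^ k) ^ G / (1 + s) ^ (d * k + 2) ∧
        ∀ j : ℕ, T ^ j * (4 * Real.exp
            (c₂ * (k * (1 + 2 * r) ^ d) ^ θ - c * (s - 1 - 2 * r) ^ a'))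
          ≤ C ^ k * ((k : ℝ) ^ k) ^ G / (1 + s) ^ (d * k + 2) * (c₀ ^ j * (j ! : ℝ) ^ β) := by
  have hd0 : (0 : ℝ) < d := by exact_mod_cast hd
  set D : ℝ := d * θ / a' with hD
  have hD0 : 0 < D := by positivity
  -- A quarter of the decay rate that remains after `s - 1 - 2r` is replaced by `s / 2`. Two
  -- quarters pay for the volume term, one for the powers of `T`, and one is left.
  set c₄ : ℝ := c * (1 / 2) ^ a' / 4 with hc₄
  have hc40 : 0 < c₄ := by positivity
  -- `ε` is chosen such that `c₂ (k (3 r)^d)^θ ≤ 2 c₄ s^a'`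
  obtain ⟨ε, hε, hε1⟩ : ∃ ε : ℝ, 0 < ε ∧ c₂ * (3 ^ d * ε ^ d) ^ θ ≤ 2 * c₄ := by
    obtain ⟨K, hK, hK'⟩ := exists_one_le_mul_rpow (A := 2 * c₄ / ((c₂ + 1) * (3 ^ d) ^ θ))
      (q := d * θ) (by positivity) (by positivity)
    refine ⟨K⁻¹, by positivity, ?_⟩
    have h1 := hK' K le_rfl
    rw [Real.mul_rpow (by positivity) (by positivity), ← Real.rpow_natCast K⁻¹,
      ← Real.rpow_mul (by positivity), Real.inv_rpow (by positivity)]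
    rw [div_mul_eq_mul_div, le_div_iff₀ (by positivity), one_mul] at h1
    rw [← mul_assoc, ← div_eq_mul_inv, div_le_iff₀ (by positivity)]
    refine le_trans ?_ h1
    gcongr
    linarith
  -- This `K` ensures that the second candidate for `r` is at least `1` once `s ≥ K k^(D/d)`.
  obtain ⟨K, hK, hK'⟩ := exists_one_le_mul_rpow (A := ε) (q := 1 / D) hε (by positivity)
  obtain ⟨E₁, hE₁, hE₁'⟩ := exists_markov_linear_le d hb hC₁
  obtain ⟨E₂, hE₂, hE₂'⟩ := exists_markov_rpow_le hd hb hC₁ hD0 hε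
  obtain ⟨E₃, hE₃, hE₃'⟩ := exists_exp_neg_le d (c := 1 / 2) (by norm_num) ha'
  obtain ⟨E₄, hE₄, hE₄'⟩ := exists_exp_neg_le d hc40 ha'
  obtain ⟨B₁, hB₁, hB₁'⟩ := exists_rpow_le_pow (K + 8) (α := d) (δ := 2) (by positivity)
    (by positivity)
  obtain ⟨B₂, hB₂, hB₂'⟩ := exists_rpow_le_pow_mul 1 (α := D) (δ := 2 * D / d) hD0.le
    (by positivity)
  set E := E₁ * E₂ * E₃ with hE
  have hE1 : E₁ ≤ E := by
    rw [hE, mul_assoc]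
    exact le_mul_of_one_le_right (by positivity) (one_le_mul_of_one_le_of_one_le hE₂ hE₃)
  have hE2 : E₂ ≤ E := by
    rw [hE, mul_right_comm]
    exact le_mul_of_one_le_left (by positivity) (one_le_mul_of_one_le_of_one_le hE₁ hE₃)
  have hE3 : E₃ ≤ E :=
    le_mul_of_one_le_left (by positivity) (one_le_mul_of_one_le_of_one_le hE₁ hE₂)
  set C := max (B₁ * B₂) (max (24 * C₁ * E) (4 * Real.exp c₄ * E₄)) with hC
  have hCB : B₁ * B₂ ≤ C := le_max_left _ _
  have hCE : 24 * C₁ * E ≤ C := (le_max_left _ _).trans (le_max_right _ _)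
  have hCE₄ : 4 * Real.exp c₄ * E₄ ≤ C := (le_max_right _ _).trans (le_max_right _ _)
  have hC1 : 1 ≤ C := (one_le_mul_of_one_le_of_one_le hB₁ hB₂).trans hCB
  set l : ℝ := c₄ / (β + 1) with hl
  have hl0 : 0 < l := by positivity
  have hβl : β * l ≤ c₄ := by
    rw [hl, mul_div_assoc', div_le_iff₀ (by positivity)]
    nlinarith
  have hDG : D ≤ G := le_trans (le_add_of_nonneg_left (by positivity)) hG₂
  have haG : d / a' ≤ G := by
    refine le_trans ?_ hDG
    rw [hD, mul_div_right_comm]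
    exact le_mul_of_one_le_right (by positivity) hθ
  refine ⟨C, Real.exp 1 * C₁ * max 1 (l⁻¹ ^ β), hC1, one_le_mul_of_one_le_of_one_le
    (one_le_mul_of_one_le_of_one_le (Real.one_le_exp zero_le_one) hC₁) (le_max_left _ _),
    fun k s hk hs => ?_⟩
  have hk' : (1 : ℝ) ≤ k := by exact_mod_cast hk
  have hs' : (1 : ℝ) ≤ s := by exact_mod_cast hs
  have hkk : (1 : ℝ) ≤ (k : ℝ) ^ k := one_le_pow₀ hk'
  have hkD : (1 : ℝ) ≤ (k : ℝ) ^ (D / d) := Real.one_le_rpow hk' (by positivity)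
  -- Below the threshold `s ~ k^(D/d)` no decay is available, but `(1+s)^(dk+2)` is itself of order
  -- `C^k (k^k)^D`, and `D ≤ G`.
  rcases le_or_gt (1 + s : ℝ) ((K + 8) * (k : ℝ) ^ (D / d)) with hsmall | hlarge
  · left
    calc (1 + s : ℝ) ^ (d * k + 2) ≤ ((K + 8) * (k : ℝ) ^ (D / d)) ^ (d * k + 2) := by gcongr
      _ = (K + 8) ^ ((d * k + 2 : ℕ) : ℝ) * (k : ℝ) ^ (D * k + 2 * D / d) := by
          rw [mul_pow, ← Real.rpow_natCast, ← Real.rpow_natCast, ← Real.rpow_mul (by positivity)]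
          congr 2
          push_cast
          field_simp
      _ ≤ B₁ ^ k * (B₂ ^ k * ((k : ℝ) ^ k) ^ D) := by
          gcongr
          · exact hB₁' k hk _ _ (by positivity) le_rfl (by positivity) (by push_cast; rfl)
          · exact hB₂' k hk _ _ (by positivity) (by rw [one_mul]) (by positivity) le_rfl
      _ = (B₁ * B₂) ^ k * ((k : ℝ) ^ k) ^ D := by rw [mul_pow]; ring
      _ ≤ _ := by gcongr
  right
  have hs8 : (8 : ℝ) ≤ s := by nlinarith
  have hsK : K * (k : ℝ) ^ (D / d) ≤ s := by nlinarith
  set r₂ : ℝ := ε * (s : ℝ) ^ (1 / D) * (k : ℝ) ^ (-(1 / (d : ℝ))) with hr₂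
  have hr₂1 : 1 ≤ r₂ := by
    have h1 := hK' (s / (k : ℝ) ^ (D / d)) (by rw [le_div_iff₀ (by positivity)]; exact hsK)
    rwa [Real.div_rpow (by positivity) (by positivity), ← Real.rpow_mul (by positivity),
      show D / d * (1 / D) = 1 / (d : ℝ) by field_simp, div_eq_mul_inv,
      ← Real.rpow_neg (by positivity), ← mul_assoc] at h1
  -- The bound `s / 8` keeps the enlarged cubes apart, and `r₂` keeps the volume term small. Either
  -- choice admits a Markov bound, which is why `G` has to dominate both `bd` and `bdD + D`.
  set r : ℝ := min ((s : ℝ) / 8) r₂ with hr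
  have hr1 : 1 ≤ r := le_min (by linarith) hr₂1
  have hrs : r ≤ s / 8 := min_le_left _ _
  have hrr : r ≤ r₂ := min_le_right _ _
  have hgap : (s : ℝ) / 2 ≤ s - 1 - 2 * r := by linarith
  set E₀ : ℝ := E ^ k * ((k : ℝ) ^ k) ^ G / (1 + s) ^ (d * k + 2) with hE₀
  have hE1' : 1 ≤ E := hE₁.trans hE1
  have hE₀0 : 0 < E₀ := by positivity
  have hmono : ∀ E' γ : ℝ, 0 ≤ E' → E' ≤ E → γ ≤ G →
      E' ^ k * ((k : ℝ) ^ k) ^ γ / (1 + s) ^ (d * k + 2) ≤ E₀ := by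
    intro E' γ h0 h1 h2
    rw [hE₀]
    gcongr
  obtain ⟨N, hN, hNr⟩ : ∃ N : ℕ, 1 ≤ N ∧ C₁ ^ N * (N ! : ℝ) ^ b * r⁻¹ ^ N ≤ E₀ ^ 2 := by
    rcases min_choice ((s : ℝ) / 8) r₂ with h | h
    · obtain ⟨N, hN, hle⟩ := hE₁' k s hk hs
      refine ⟨N, hN, ?_⟩
      rw [hr, h]
      refine hle.trans ?_
      gcongr
      exact hmono _ _ (by positivity) hE1 hG₁
    · obtain ⟨N, hN, hle⟩ := hE₂' k s hk hs hr₂1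
      refine ⟨N, hN, ?_⟩
      rw [hr, h]
      refine hle.trans ?_
      gcongr
      exact hmono _ _ (by positivity) hE2 hG₂
  set y : ℝ := (s : ℝ) ^ a' with hy
  have hy1 : 1 ≤ y := Real.one_le_rpow hs' ha'.le
  set m : ℕ := ⌈y⌉₊ with hm
  have hm1 : 1 ≤ m := Nat.one_le_iff_ne_zero.2 (Nat.ceil_pos.2 (by positivity)).ne'
  have hm1' : (0 : ℝ) < m := by exact_mod_cast hm1
  -- The Markov bound for the score at order `m = ⌈s^a'⌉` is then at most `exp (-m)`, of the same
  -- kind as the decay of correlations.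
  set T : ℝ := Real.exp 1 * C₁ * (m : ℝ) ^ β with hT
  have hT0 : 0 < T := by positivity
  have hTm : C₁ ^ m * (m ! : ℝ) ^ β * T⁻¹ ^ m ≤ E₀ ^ 2 := by
    have h1 : (m ! : ℝ) ^ β ≤ ((m : ℝ) ^ β) ^ m := by
      refine (factorial_rpow_le hβ m).trans_eq ?_
      rw [Real.rpow_mul (by positivity), Real.rpow_natCast]
    calc C₁ ^ m * (m ! : ℝ) ^ β * T⁻¹ ^ m ≤ C₁ ^ m * ((m : ℝ) ^ β) ^ m * T⁻¹ ^ m := by gcongr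
      _ = Real.exp (-(m : ℝ)) := by
          have h2 : Real.exp (-(m : ℝ)) = (Real.exp 1)⁻¹ ^ m := by
            rw [← Real.exp_neg, ← Real.exp_nat_mul]; simp
          rw [h2, ← mul_pow, ← mul_pow, hT]
          congr 1
          field_simp
      _ ≤ Real.exp (-y) := by
          gcongr
          exact Nat.le_ceil y
      _ = Real.exp (-(1 / 2) * y) ^ 2 := by
          rw [← Real.exp_nat_mul]; congr 1; push_cast; ring
      _ ≤ E₀ ^ 2 := by
          gcongr
          exact (hE₃' k s hk hs).trans (hmono _ _ (by positivity) hE3 haG)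
  have hexp : c₂ * (k * (1 + 2 * r) ^ d) ^ θ - c * (s - 1 - 2 * r) ^ a' ≤ -(2 * c₄) * y := by
    have h1 : c₂ * (k * (1 + 2 * r) ^ d) ^ θ ≤ 2 * c₄ * y := by
      -- The factor `k^(-1/d)` in `r₂` cancels the number `k` of cubes, and `1 + 2r ≤ 3 r₂` because
      -- `r₂ ≥ 1`.
      have h2 : (k : ℝ) * (1 + 2 * r) ^ d ≤ 3 ^ d * ε ^ d * (s : ℝ) ^ (d / D) := by
        calc (k : ℝ) * (1 + 2 * r) ^ d ≤ k * (3 * r₂) ^ d := by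
              gcongr
              linarith
          _ = 3 ^ d * ε ^ d * ((s : ℝ) ^ (1 / D)) ^ d
              * (k * ((k : ℝ) ^ (-(1 / (d : ℝ)))) ^ d) := by rw [hr₂]; ring
          _ = _ := by
              rw [← Real.rpow_natCast ((k : ℝ) ^ _), ← Real.rpow_mul (by positivity),
                ← Real.rpow_natCast ((s : ℝ) ^ _), ← Real.rpow_mul (by positivity),
                show -(1 / (d : ℝ)) * d = -1 by field_simp, Real.rpow_neg_one,
                mul_inv_cancel₀ (by positivity), mul_one]
              congr 2
              ring
      calc c₂ * (k * (1 + 2 * r) ^ d) ^ θ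
          ≤ c₂ * (3 ^ d * ε ^ d * (s : ℝ) ^ (d / D)) ^ θ := by gcongr
        _ = c₂ * (3 ^ d * ε ^ d) ^ θ * y := by
            rw [Real.mul_rpow (by positivity) (by positivity), ← Real.rpow_mul (by positivity),
              show d / D * θ = a' by rw [hD]; field_simp, mul_assoc]
        _ ≤ _ := by gcongr
    have h3 : 4 * c₄ * y ≤ c * (s - 1 - 2 * r) ^ a' := by
      calc 4 * c₄ * y = c * ((s : ℝ) / 2) ^ a' := by
            rw [hc₄, hy, div_eq_mul_one_div (s : ℝ), Real.mul_rpow (by positivity) (by norm_num)]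
            ring
        _ ≤ _ := by gcongr
    linarith
  -- Both Markov bounds are at most `E₀ ^ 2`, so their sum times `k * C₁` is below the square of
  -- this `p`; the prefactors of `E₀` are later absorbed in `C ^ k`.
  refine ⟨N, m, r, T, 2 * k * C₁ * E₀, hN, hm1, by positivity, hT0, by positivity,
    by linarith, ?_, ?_, fun j => ?_⟩
  · calc k * (C₁ * (C₁ ^ N * (N ! : ℝ) ^ b * r⁻¹ ^ N + C₁ ^ m * (m ! : ℝ) ^ β * T⁻¹ ^ m))
        ≤ k * (C₁ * (E₀ ^ 2 + E₀ ^ 2)) := by gcongr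
      _ = (2 * k * C₁) * 1 * E₀ ^ 2 := by ring
      _ ≤ (2 * k * C₁) * (2 * k * C₁) * E₀ ^ 2 := by
          gcongr
          nlinarith
      _ = _ := by ring
  · have h2k : (k : ℝ) ≤ 2 ^ k := by exact_mod_cast (Nat.lt_two_pow_self (n := k)).le
    have h12 : 12 * C₁ ≤ (12 * C₁) ^ k := le_self_pow₀ (by linarith) (by omega)
    calc 6 * (2 * k * C₁ * E₀) = k * (12 * C₁) * E₀ := by ring
      _ ≤ 2 ^ k * (12 * C₁) ^ k * E₀ := by gcongr
      _ = (24 * C₁ * E) ^ k * ((k : ℝ) ^ k) ^ G / (1 + s) ^ (d * k + 2) := by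
          rw [hE₀, ← mul_pow, mul_pow _ E, ← mul_div_assoc]
          ring_nf
      _ ≤ _ := by gcongr
  · have h1 : T ^ j ≤ (Real.exp 1 * C₁ * max 1 (l⁻¹ ^ β)) ^ j * (j ! : ℝ) ^ β
        * Real.exp (c₄ * (y + 1)) := by
      calc T ^ j = (Real.exp 1 * C₁) ^ j * ((m : ℝ) ^ β) ^ j := by rw [hT, mul_pow]
        _ ≤ (Real.exp 1 * C₁) ^ j
            * (((l⁻¹ ^ β) ^ j * (j ! : ℝ) ^ β) * Real.exp (β * l * (y + 1))) := by
            gcongr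
            exact natCeil_rpow_mul_le hβ hl0 (by positivity) j
        _ ≤ (Real.exp 1 * C₁) ^ j
            * (((max 1 (l⁻¹ ^ β)) ^ j * (j ! : ℝ) ^ β) * Real.exp (c₄ * (y + 1))) := by
            gcongr
            exact le_max_right _ _
        _ = _ := by rw [mul_pow (Real.exp 1 * C₁)]; ring
    have h4 : 4 * Real.exp c₄ * Real.exp (-c₄ * y)
        ≤ C ^ k * ((k : ℝ) ^ k) ^ G / (1 + s) ^ (d * k + 2) := by
      have h5 : 4 * Real.exp c₄ ≤ (4 * Real.exp c₄) ^ k :=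
        le_self_pow₀ (by linarith [Real.one_le_exp hc40.le]) (by omega)
      calc 4 * Real.exp c₄ * Real.exp (-c₄ * y)
          ≤ (4 * Real.exp c₄) ^ k
            * (E₄ ^ k * ((k : ℝ) ^ k) ^ (d / a') / (1 + s) ^ (d * k + 2)) := by
            gcongr
            exact hE₄' k s hk hs
        _ = (4 * Real.exp c₄ * E₄) ^ k * ((k : ℝ) ^ k) ^ (d / a') / (1 + s) ^ (d * k + 2) := by
            rw [mul_pow _ E₄]; ring
        _ ≤ _ := by gcongr
    calc T ^ j * (4 * Real.exp (c₂ * (k * (1 + 2 * r) ^ d) ^ θ - c * (s - 1 - 2 * r) ^ a'))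
        ≤ ((Real.exp 1 * C₁ * max 1 (l⁻¹ ^ β)) ^ j * (j ! : ℝ) ^ β * Real.exp (c₄ * (y + 1)))
          * (4 * Real.exp (-(2 * c₄) * y)) := by gcongr
      _ = (4 * Real.exp c₄ * Real.exp (-c₄ * y))
          * ((Real.exp 1 * C₁ * max 1 (l⁻¹ ^ β)) ^ j * (j ! : ℝ) ^ β) := by
          have : Real.exp (c₄ * (y + 1)) * Real.exp (-(2 * c₄) * y)
              = Real.exp c₄ * Real.exp (-c₄ * y) := by
            rw [← Real.exp_add, ← Real.exp_add]; congr 1; ring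
          linear_combination (4 * ((Real.exp 1 * C₁ * max 1 (l⁻¹ ^ β)) ^ j * (j ! : ℝ) ^ β)) * this
      _ ≤ _ := by gcongr

end Parameters

/-! ### Covering the observation window by cubes -/

section Window

variable {d : ℕ}

theorem measurableSet_obsWindow (d n : ℕ) : MeasurableSet (obsWindow d n) := by
  have : obsWindow d n = ⋂ i, {x : EuclideanSpace ℝ (Fin d) |
      |x i| ≤ (n : ℝ) ^ (1 / (d : ℝ)) / 2} := by
    ext x; simp [obsWindow]
  rw [this]
  exact MeasurableSet.iInter fun i => measurableSet_le (by fun_prop) measurable_const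

theorem isBounded_obsWindow (d n : ℕ) : Bornology.IsBounded (obsWindow d n) := by
  refine (isBounded_enlargedCube 0 ((n : ℝ) ^ (1 / (d : ℝ)) / 2)).subset fun x hx i => ?_
  have := abs_le.1 (hx i)
  simp only [Pi.zero_apply, Int.cast_zero, Set.mem_Icc]
  exact ⟨by linarith, by linarith⟩

/-- The indices of the unit cubes meeting the observation window. -/
noncomputable def windowIndices (d n : ℕ) : Finset (Fin d → ℤ) :=
  Fintype.piFinset fun _ =>
    Finset.Icc ⌊-((n : ℝ) ^ (1 / (d : ℝ)) / 2)⌋ ⌊(n : ℝ) ^ (1 / (d : ℝ)) / 2⌋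

/-- In each coordinate there are at most `h + 2 ≤ 3 h` integers, where `h = n^(1/d) ≥ 1` is the side
length. -/
theorem card_windowIndices_le {n : ℕ} (hd : 1 ≤ d) (hn : 1 ≤ n) :
    ((windowIndices d n).card : ℝ) ≤ 3 ^ d * n := by
  have hd0 : (d : ℝ) ≠ 0 := by positivity
  have hn' : (1 : ℝ) ≤ n := by exact_mod_cast hn
  set h : ℝ := (n : ℝ) ^ (1 / (d : ℝ)) with hh
  have h1 : 1 ≤ h := Real.one_le_rpow hn' (by positivity)
  rw [windowIndices, Fintype.card_piFinset, Finset.prod_const, Finset.card_univ, Fintype.card_fin,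
    Int.card_Icc]
  push_cast
  have h2 : (((⌊h / 2⌋ + 1 - ⌊-(h / 2)⌋).toNat : ℕ) : ℝ) ≤ 3 * h := by
    have h3 : (0 : ℤ) ≤ ⌊h / 2⌋ + 1 - ⌊-(h / 2)⌋ := by
      have : ⌊-(h / 2)⌋ ≤ ⌊h / 2⌋ := Int.floor_le_floor (by linarith)
      omega
    have h4 : (((⌊h / 2⌋ + 1 - ⌊-(h / 2)⌋).toNat : ℤ) : ℝ)
        = ((⌊h / 2⌋ + 1 - ⌊-(h / 2)⌋ : ℤ) : ℝ) := by rw [Int.toNat_of_nonneg h3]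
    rw [Int.cast_natCast] at h4
    rw [h4]
    push_cast
    have h5 := Int.floor_le (h / 2)
    have h6 := Int.sub_one_lt_floor (-(h / 2))
    linarith
  calc _ ≤ (3 * h) ^ d := by gcongr
    _ = 3 ^ d * n := by
      rw [mul_pow, hh, ← Real.rpow_natCast (_ ^ (1 / (d : ℝ))), ← Real.rpow_mul (by positivity),
        one_div, inv_mul_cancel₀ hd0, Real.rpow_one]

theorem weightedSum_eq_sum_cubeSum (ξ : EuclideanSpace ℝ (Fin d) → Config d → ℝ) (n : ℕ)
    (f : EuclideanSpace ℝ (Fin d) → ℝ) (X : Config d) :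
    weightedSum ξ n f X = ∑ z ∈ windowIndices d n, cubeSum (obsWindow d n) z
      (fun x X => ξ x X * f ((n : ℝ) ^ (-1 / (d : ℝ)) • x)) X := by
  classical
  have hW := isBounded_obsWindow d n
  have h1 : weightedSum ξ n f X = ∑ x ∈ X.pts (obsWindow d n),
      ξ x (X.restrict (obsWindow d n)) * f ((n : ℝ) ^ (-1 / (d : ℝ)) • x) := by
    rw [weightedSum, ← Config.coe_pts hW, finsum_mem_coe_finset]
  rw [h1, ← Finset.sum_fiberwise_of_maps_to (t := windowIndices d n)
    (g := fun x : EuclideanSpace ℝ (Fin d) => fun i => ⌊x i⌋)]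
  · refine Finset.sum_congr rfl fun z _ => Finset.sum_congr ?_ fun _ _ => rfl
    ext x
    rw [Finset.mem_filter, Config.mem_pts hW, Config.mem_pts (isBounded_unitCube_inter z _)]
    simp only [unitCube, Set.mem_inter_iff, Set.mem_ofPred_eq, funext_iff]
    tauto
  · intro x hx
    rw [Config.mem_pts hW] at hx
    rw [windowIndices, Fintype.mem_piFinset]
    intro i
    have := abs_le.1 (hx.2 i)
    exact Finset.mem_Icc.2 ⟨Int.floor_le_floor this.1, Int.floor_le_floor this.2⟩

end Window

/-! ### The cumulant bound for a general exponent -/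

section CumulantGrowth

variable {d : ℕ} {P : Measure (Config d)}
  {ρ : (p : ℕ) → (Fin p → EuclideanSpace ℝ (Fin d)) → ℝ}
  {Q : (p : ℕ) → Kernel (Fin p → EuclideanSpace ℝ (Fin d)) (Config d)}
  {ξ : EuclideanSpace ℝ (Fin d) → Config d → ℝ}

theorem pow_self_le_exp_mul_factorial (k : ℕ) : (k : ℝ) ^ k ≤ Real.exp 1 ^ k * k ! := by
  have h := Real.pow_div_factorial_le_exp (k : ℝ) (by positivity) k
  rw [div_le_iff₀ (by positivity)] at h
  rwa [← Real.exp_nat_mul, mul_one]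

/-- The moments and cumulants of the `ξ`-weighted sums, with a growth exponent of the cumulants
that is admissible for the choice of the truncation levels. -/
theorem exists_kthCumulant_weightedSum_le (hd : 1 ≤ d) [IsProbabilityMeasure P]
    (hstat : IsStationaryProcess P) (hρ : IsCorrelationFamily P ρ)
    (hQ : IsPalmFamily P ρ Q) (hξ : Measurable (Function.uncurry ξ))
    (hR : Measurable (Function.uncurry (stabRadius ξ))) {a a' b β : ℝ} (ha : 0 ≤ a) (ha1 : a < 1)
    (ha' : 0 < a') (hb : 0 ≤ b) (hβ : 0 ≤ β) (hEDC : ExpDecayCorrelations ρ a a')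
    (hST : StabilizationCond ρ Q ξ b) (hMG : MomentGrowthCond ρ Q ξ β) {G : ℝ}
    (hG₁ : b * d ≤ G) (hG₂ : b * d * (d / ((1 - a) * a')) + d / ((1 - a) * a') ≤ G) :
    ∃ C : ℝ, 1 ≤ C ∧ ∀ k n : ℕ, 1 ≤ k → 1 ≤ n →
      ∀ f : EuclideanSpace ℝ (Fin d) → ℝ, Measurable f → BddAbove (Set.range fun x => |f x|) →
        MemLp (weightedSum ξ n f) k P ∧
        |kthCumulant P (weightedSum ξ n f) k|
          ≤ n * (⨆ x, |f x|) ^ k * C ^ k * (k ! : ℝ) ^ (2 + β + G) := by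
  obtain ⟨C₂, c, hcb⟩ := hρ.exists_correlationBound hstat ha ha' hEDC
  obtain ⟨u, C₁, c₂, hu, hC₁, hc₂, hcl⟩ := exists_cluster_bounds hρ hQ hξ hR ha ha1 hcb hβ hST hMG
    (measurableSet_obsWindow d)
  have hθ : 0 < 1 - a := by linarith
  have hθ1 : 1 ≤ 1 / (1 - a) := by
    rw [le_div_iff₀ hθ]
    linarith
  have hD : (d : ℝ) * (1 / (1 - a)) / a' = d / ((1 - a) * a') := by field_simp
  obtain ⟨C, c₀, hC, hc₀, htr⟩ := exists_truncation_levels hd (β := β) ha' hθ1 hb hβ hC₁ hcb.pos hc₂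
    hG₁ (by rwa [hD])
  have hG0 : 0 ≤ G := le_trans (by positivity) hG₁
  set v := max u c₀ with hv
  have hv0 : 1 ≤ v := hu.trans (le_max_left _ _)
  have hκ : 1 ≤ 1 + β := by linarith
  refine ⟨3 ^ d * Real.exp 1 * 2 ^ d * 4 * C * Real.exp 1 ^ G * (8 * v), ?_, ?_⟩
  · have h1 : (1 : ℝ) ≤ Real.exp 1 := Real.one_le_exp zero_le_one
    refine one_le_mul_of_one_le_of_one_le (one_le_mul_of_one_le_of_one_le
      (one_le_mul_of_one_le_of_one_le (one_le_mul_of_one_le_of_one_le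
      (one_le_mul_of_one_le_of_one_le (one_le_mul_of_one_le_of_one_le
      (one_le_pow₀ (by norm_num)) h1) (one_le_pow₀ (by norm_num))) (by norm_num)) hC)
      (Real.one_le_rpow h1 hG0)) (by linarith)
  intro k n hk hn f hf hfb
  set F := ⨆ x, |f x| with hF
  have hfF : ∀ x, |f x| ≤ F := fun x => le_ciSup hfb x
  have hF0 : 0 ≤ F := (abs_nonneg _).trans (hfF 0)
  set g : EuclideanSpace ℝ (Fin d) → ℝ := fun x => f ((n : ℝ) ^ (-1 / (d : ℝ)) • x) with hg
  have hgm : Measurable g := hf.comp (measurable_const_smul _)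
  set Y : (Fin d → ℤ) → Config d → ℝ := fun z =>
    cubeSum (obsWindow d n) z fun x X => ξ x X * g x with hY
  have hYm : ∀ z, Measurable (Y z) := fun z =>
    measurable_cubeSum (h := fun x X => ξ x X * g x) (measurableSet_obsWindow d n)
      (hξ.mul (hgm.comp measurable_fst)) z
  have hws : weightedSum ξ n f = fun X => ∑ z ∈ windowIndices d n, Y z X :=
    funext fun X => weightedSum_eq_sum_cubeSum ξ n f X
  have hcl' := hcl n hn g F hgm (fun x => hfF _) k
  have hk' : (1 : ℝ) ≤ k := by exact_mod_cast hk
  have hkk : (1 : ℝ) ≤ (k : ℝ) ^ k := one_le_pow₀ hk'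
  refine ⟨?_, ?_⟩
  · rw [hws]
    refine memLp_finsetSum _ fun z _ => ?_
    rw [← integrable_norm_rpow_iff (hYm z).aestronglyMeasurable (by simp; omega) (by simp)]
    -- For a constant tuple of indices the mixed moment is the `k`-th moment of a single cube sum.
    have h1 := ((hcl' fun _ => z).1 Finset.univ).1.norm
    refine h1.congr (Filter.Eventually.of_forall fun X => ?_)
    simp [hY]
  -- The factor `2` covers the triangle inequality for close groups and the two error terms,
  -- truncation and covariance, for distant ones.
  set M := 2 * (C ^ k * ((k : ℝ) ^ k) ^ G) with hM
  have hM1 : 1 ≤ C ^ k * ((k : ℝ) ^ k) ^ G :=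
    one_le_mul_of_one_le_of_one_le (one_le_pow₀ hC) (Real.one_le_rpow hkk hG0)
  have hvu : ∀ j : ℕ, (F * u) ^ j * (j ! : ℝ) ^ (1 + β) ≤ (F * v) ^ j * (j ! : ℝ) ^ (1 + β) := by
    intro j
    gcongr
    exact le_max_left _ _
  have key := abs_kthCumulant_sum_le (P := P) hk (windowIndices d n) Y (c := F * v) (κ := 1 + β)
    (M := M) hκ (by positivity) (by linarith) (fun z A => ((hcl' z).1 A).1)
    (fun z A => ((hcl' z).1 A).2.trans (hvu _)) (fun z s hs I hsep A => ?_)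
  · rw [hws]
    refine key.trans ?_
    have hkf := pow_self_le_exp_mul_factorial k
    have hf1 : (0 : ℝ) < k ! := by positivity
    have h3 : (3 : ℝ) ^ d ≤ (3 ^ d) ^ k := le_self_pow₀ (one_le_pow₀ (by norm_num)) (by omega)
    have h4 : (4 : ℝ) ≤ 4 ^ k := le_self_pow₀ (by norm_num) (by omega)
    -- By `k^k ≤ e^k k!` the tree count contributes one power of `k!` and the clustering error
    -- contributes `k!^G`, in addition to `k!^(1+β)` from the moments.
    calc ((windowIndices d n).card : ℝ) * ((k : ℝ) ^ k * (2 ^ (d * k) * (2 * (M * ((8 * (F * v)) ^ k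
          * (k ! : ℝ) ^ (1 + β))))))
        = (windowIndices d n).card * ((k : ℝ) ^ k * (2 ^ (d * k) * (4 * ((C ^ k * ((k : ℝ) ^ k) ^ G)
          * ((8 * (F * v)) ^ k * (k ! : ℝ) ^ (1 + β)))))) := by rw [hM]; ring
      _ ≤ ((3 ^ d) ^ k * n) * ((Real.exp 1 ^ k * k !) * (2 ^ (d * k) * (4 ^ k *
          ((C ^ k * (Real.exp 1 ^ k * k !) ^ G) * ((8 * (F * v)) ^ k
            * (k ! : ℝ) ^ (1 + β)))))) := by
          gcongr
          exact (card_windowIndices_le hd hn).trans (by gcongr)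
      _ = _ := by
          have e1 : (Real.exp 1 ^ k * (k ! : ℝ)) ^ G = (Real.exp 1 ^ G) ^ k * (k ! : ℝ) ^ G := by
            rw [Real.mul_rpow (by positivity) (by positivity), ← Real.rpow_natCast,
              ← Real.rpow_natCast, ← Real.rpow_mul (by positivity), ← Real.rpow_mul (by positivity),
              mul_comm G]
          have e2 : (k ! : ℝ) ^ (2 + β + G) = k ! * (k ! : ℝ) ^ (1 + β) * (k ! : ℝ) ^ G := by
            rw [show 2 + β + G = 1 + (1 + β) + G by ring, Real.rpow_add hf1, Real.rpow_add hf1,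
              Real.rpow_one]
          rw [e1, e2]
          simp only [mul_pow, pow_mul]
          ring
  -- In the first case `M / (1+s)^(dk+2) ≥ 2`, and the moment bounds alone suffice. In the second
  -- one the cluster bounds apply with the levels provided.
  · rcases htr k s hk hs with h | ⟨N, m, r, T, p, hN, hm, hr, hT, hp, hgap, hpp, hp6, hTe⟩
    · have hmul : |(∫ X, ∏ i ∈ A, Y (z i) X ∂P)
          - (∫ X, ∏ i ∈ A ∩ I, Y (z i) X ∂P) * ∫ X, ∏ i ∈ A \ I, Y (z i) X ∂P|
          ≤ 2 * ((F * v) ^ A.card * (A.card ! : ℝ) ^ (1 + β)) := by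
        refine (abs_sub _ _).trans ?_
        rw [abs_mul, two_mul]
        refine add_le_add (((hcl' z).1 A).2.trans (hvu _)) ?_
        exact (mul_le_mul (((hcl' z).1 _).2.trans (hvu _)) (((hcl' z).1 _).2.trans (hvu _))
          (abs_nonneg _) (by positivity)).trans
          (pow_mul_factorial_rpow_mul_le (by positivity) (by linarith) A I)
      refine hmul.trans ?_
      gcongr
      rw [le_div_iff₀ (by positivity), hM]
      gcongr
    · refine ((hcl' z).2 s N m r T p I hN hm hr hT hp hsep hgap hpp A).trans ?_
      have h1 := hTe A.card
      set E := C ^ k * ((k : ℝ) ^ k) ^ G / (1 + s) ^ (d * k + 2) with hE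
      have hE0 : 0 ≤ E := by positivity
      have h2 : 6 * p * ((F * u) ^ A.card * (A.card ! : ℝ) ^ (1 + β))
          ≤ E * ((F * v) ^ A.card * (A.card ! : ℝ) ^ (1 + β)) :=
        mul_le_mul hp6 (hvu _) (by positivity) hE0
      have h3 : (F * T) ^ A.card * (A.card ! : ℝ) * (4 * Real.exp
          (c₂ * (k * (1 + 2 * r) ^ d) ^ (1 / (1 - a)) - c * (s - 1 - 2 * r) ^ a'))
          ≤ E * ((F * v) ^ A.card * (A.card ! : ℝ) ^ (1 + β)) := by
        calc _ = F ^ A.card * (A.card ! : ℝ) * (T ^ A.card * (4 * Real.exp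
            (c₂ * (k * (1 + 2 * r) ^ d) ^ (1 / (1 - a)) - c * (s - 1 - 2 * r) ^ a'))) := by
              rw [mul_pow]; ring
          _ ≤ F ^ A.card * (A.card ! : ℝ) * (E * (v ^ A.card * (A.card ! : ℝ) ^ β)) := by
              refine mul_le_mul_of_nonneg_left (h1.trans ?_) (by positivity)
              gcongr
              exact le_max_right _ _
          _ = _ := by
              rw [Real.rpow_add (by positivity), Real.rpow_one, mul_pow]; ring
      refine (add_le_add h2 h3).trans_eq ?_
      rw [hM, hE]
      ring

end CumulantGrowth

/-! ### The two ranges of `D = d / ((1-a) a')` -/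

theorem mainTheorem1 (d : ℕ) (hd : 1 ≤ d)
    (P : Measure (Config d)) [IsProbabilityMeasure P] (hstat : IsStationaryProcess P)
    (ρ : (p : ℕ) → (Fin p → EuclideanSpace ℝ (Fin d)) → ℝ) (hρ : IsCorrelationFamily P ρ)
    (Q : (p : ℕ) → Kernel (Fin p → EuclideanSpace ℝ (Fin d)) (Config d))
    (hQ : IsPalmFamily P ρ Q)
    (ξ : EuclideanSpace ℝ (Fin d) → Config d → ℝ) (hξ : Measurable (Function.uncurry ξ))
    (hR : Measurable (Function.uncurry (stabRadius ξ)))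
    (a a' b β γ₁ γ₂ : ℝ) (ha : 0 ≤ a) (ha1 : a < 1) (ha' : 0 < a') (hb : 0 ≤ b) (hβ : 0 ≤ β)
    (hγ₁ : 0 ≤ γ₁) (hγ₂ : 0 ≤ γ₂)
    (hEDC : ExpDecayCorrelations ρ a a') (hST : StabilizationCond ρ Q ξ b)
    (hMG : MomentGrowthCond ρ Q ξ β) (hPG : PowerGrowthCond ξ γ₁ γ₂) :
    ∃ C : ℝ, 1 ≤ C ∧ ∀ k n : ℕ, 1 ≤ k → 1 ≤ n →
      ∀ f : EuclideanSpace ℝ (Fin d) → ℝ, Measurable f → BddAbove (Set.range fun x => |f x|) →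
        MemLp (weightedSum ξ n f) k P ∧
        ((1 - a) * a' / d ≤ 1 →
          |kthCumulant P (weightedSum ξ n f) k| ≤ n * (⨆ x, |f x|) ^ k * C ^ k *
            (k ! : ℝ) ^ (2 + max γ₂ β + d / ((1 - a) * a') + b * d ^ 2 / ((1 - a) * a'))) ∧
        (1 ≤ (1 - a) * a' / d →
          |kthCumulant P (weightedSum ξ n f) k| ≤ n * (⨆ x, |f x|) ^ k * C ^ k *
            (k ! : ℝ) ^ (2 + max γ₂ β + d / a' + a + b * d)) := by
  have hd0 : (0 : ℝ) < d := by exact_mod_cast hd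
  have hθ : 0 < 1 - a := by linarith
  set D : ℝ := d / ((1 - a) * a') with hD
  have hD0 : 0 < D := by positivity
  have hbd : 0 ≤ b * d := by positivity
  have key := fun {G : ℝ} => exists_kthCumulant_weightedSum_le (G := G) hd hstat hρ hQ hξ hR ha ha1
    ha' hb hβ hEDC hST hMG
  have hbD : b * d ^ 2 / ((1 - a) * a') = b * d * D := by rw [hD]; ring
  have hmax : β ≤ max γ₂ β := le_max_right _ _
  -- The finiteness of moments is the same in both ranges; any admissible exponent serves, for
  -- example the sum of the two lower bounds.
  obtain ⟨C₁, hC₁, h₁⟩ := key (G := b * d + (b * d * D + D)) (by linarith [mul_nonneg hbd hD0.le])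
    (by linarith)
  obtain ⟨C₂, hC₂, h₂⟩ : ∃ C : ℝ, 1 ≤ C ∧ ((1 - a) * a' / d ≤ 1 → ∀ k n : ℕ, 1 ≤ k → 1 ≤ n →
      ∀ f : EuclideanSpace ℝ (Fin d) → ℝ, Measurable f → BddAbove (Set.range fun x => |f x|) →
        |kthCumulant P (weightedSum ξ n f) k|
          ≤ n * (⨆ x, |f x|) ^ k * C ^ k * (k ! : ℝ) ^ (2 + β + (D + b * d * D))) := by
    by_cases hc : (1 - a) * a' / d ≤ 1
    · have hD1 : 1 ≤ D := by
        rw [hD, le_div_iff₀ (by positivity), one_mul]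
        rwa [div_le_one hd0] at hc
      -- For `D ≥ 1` the requirement `bd ≤ G` follows from `bd ≤ bdD`.
      obtain ⟨C, hC, h⟩ := key (G := D + b * d * D) (by nlinarith) (by linarith)
      exact ⟨C, hC, fun _ k n hk hn f hf hfb => (h k n hk hn f hf hfb).2⟩
    · exact ⟨1, le_rfl, fun h => (hc h).elim⟩
  obtain ⟨C₃, hC₃, h₃⟩ : ∃ C : ℝ, 1 ≤ C ∧ (1 ≤ (1 - a) * a' / d → ∀ k n : ℕ, 1 ≤ k → 1 ≤ n →
      ∀ f : EuclideanSpace ℝ (Fin d) → ℝ, Measurable f → BddAbove (Set.range fun x => |f x|) →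
        |kthCumulant P (weightedSum ξ n f) k|
          ≤ n * (⨆ x, |f x|) ^ k * C ^ k * (k ! : ℝ) ^ (2 + β + (d / a' + a + b * d))) := by
    by_cases hc : 1 ≤ (1 - a) * a' / d
    · have hD1 : D ≤ 1 := by
        rw [hD, div_le_one (by positivity)]
        rwa [le_div_iff₀ hd0, one_mul] at hc
      have hDa : d / a' = (1 - a) * D := by rw [hD]; field_simp
      have hDa' : D ≤ d / a' + a := by rw [hDa]; nlinarith
      have : 0 < d / a' := by positivity
      -- For `D ≤ 1` one has `D = d/a' + aD ≤ d/a' + a` and `bdD ≤ bd`, so that this exponent is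
      -- admissible.
      obtain ⟨C, hC, h⟩ := key (G := d / a' + a + b * d) (by linarith) (by nlinarith)
      exact ⟨C, hC, fun _ k n hk hn f hf hfb => (h k n hk hn f hf hfb).2⟩
    · exact ⟨1, le_rfl, fun h => (hc h).elim⟩
  refine ⟨max C₂ C₃, hC₂.trans (le_max_left _ _), fun k n hk hn f hf hfb =>
    ⟨(h₁ k n hk hn f hf hfb).1, fun hc => (h₂ hc k n hk hn f hf hfb).trans ?_,
      fun hc => (h₃ hc k n hk hn f hf hfb).trans ?_⟩⟩
  all_goals
    have hF : 0 ≤ ⨆ x, |f x| := Real.iSup_nonneg fun x => abs_nonneg (f x)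
    have hk1 : (1 : ℝ) ≤ k ! := by exact_mod_cast Nat.one_le_iff_ne_zero.2 k.factorial_ne_zero
  · have : (0 : ℝ) ≤ C₂ := by linarith
    have he : 2 + β + (D + b * d * D) ≤ 2 + max γ₂ β + D + b * d ^ 2 / ((1 - a) * a') := by
      rw [hbD]; linarith
    gcongr
    exact le_max_left _ _
  · have : (0 : ℝ) ≤ C₃ := by linarith
    have he : 2 + β + (d / a' + a + b * d) ≤ 2 + max γ₂ β + d / a' + a + b * d := by linarith
    gcongr
    exact le_max_right _ _
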